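/- Let $F$ be a non-archimedean local field of odd residue characteristic $p$, $E/F$ the unramified quadratic extension with non-trivial automorphism $x\mapsto\bar x$, $\mathfrak o_E$, $\mathfrak p_E$, $k_E$ the ring of integers, maximal ideal and residue field of $E$, $q=|k_F|$, and $\varpi_E$ a uniformizer of $E$ lying in $F$. Let $G=U(2,1)(E/F)\subset GL_3(E)$ be the unitary group of the Hermitian form $(v_1,v_2)\mapsto v_1^{T}\beta\bar v_2$, where $\beta$ is the antidiagonal matrix with entries $1,1,1$. Put $\alpha=\mathrm{diag}(\varpi_E^{-1},1,\varpi_E)$, $\beta'=\beta\alpha^{-1}$, and $h(x)=\mathrm{diag}(x,-\bar x x^{-1},\bar x^{-1})$ for $x\in E^\times$. Let $K$ be one of the two maximal compact open subgroups $$K_0=GL_3(\mathfrak o_E)\cap G,\qquad K_1=\begin{pmatrix}\mathfrak o_E&\mathfrak o_E&\mathfrak p_E^{-1}\\ \mathfrak p_E&\mathfrak o_E&\mathfrak o_E\\ \mathfrak p_E&\mathfrak p_E&\mathfrak o_E\end{pmatrix}\cap G,$$ let $K^1$ be its maximal normal pro-$p$ subgroup, $I_K$ (resp. $I_{1,K}$)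 the inverse image in $K$ of the upper triangular subgroup $\mathbb B$ of $\Gamma_K=K/K^1$ (resp. of its unipotent radical), and put $\beta_K=\beta$ if $K=K_0$, $\beta_K=\beta'$ if $K=K_1$. For $k\in\mathbb Z$ let $N_k$ (resp. $N'_k$) be the group of all $$n(x,y)=\begin{pmatrix}1&x&y\\0&1&-\bar x\\0&0&1\end{pmatrix}\quad\Big(\text{resp. } n'(x,y)=\begin{pmatrix}1&0&0\\x&1&0\\y&-\bar x&1\end{pmatrix}\Big),\qquad x\bar x+y+\bar y=0,\ y\in\mathfrak p_E^k .$$ Let $n_K,m_K$ be the integers such that $N_{n_K}$ (resp. $N'_{m_K}$) is the group of all $n(x,y)$ (resp. $n'(x,y)$) in $I_{1,K}$; thus $(n_K,m_K)=(0,1)$ for $K_0$ and $(-1,2)$ for $K_1$. Put $t_K=3$ if $K=K_0$ and $t_K=1$ if $K=K_1$. Let $L_{q^3}=\{(x,t)\in k_E^2: x\bar x+t+\bar t=0\}$ and $L_q=\{(0,t)\in L_{q^3}\}$, and let $L^\times$ denote $L$ with $(0,0)$ removed. Fix $\mathfrak t\in\mathfrak o_E^\times$ of trace zero. Let $\sigma$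 be an irreducible smooth $\overline{\mathbf F}_p$-representation of $K$. Then $\sigma^{I_{1,K}}$ is a line; let $\chi_\sigma$ be the character by which $I_K$ acts on it, and for $t\in k_E^\times$ write $\chi_\sigma(h(t))=\chi_\sigma(h(\tilde t))$ for any lift $\tilde t\in\mathfrak o_E^\times$ of $t$. Fix a non-zero $v_0\in\sigma^{I_{1,K}}$. Let $\mathrm{ind}_K^G\sigma$ be the space of smooth compactly supported functions $f$ on $G$ with values in $\sigma$ such that $f(\kappa g)=\sigma(\kappa)f(g)$ for $\kappa\in K$, with $G$ acting by right translation. For $n\in\mathbb Z$ let $f_n\in(\mathrm{ind}_K^G\sigma)^{I_{1,K}}$ be the function supported on $K\alpha^{-n}I_{1,K}$ with $f_n(\alpha^{-n})=\beta_Kv_0$ if $n>0$ and $f_n(\alpha^{-n})=v_0$ if $n\le 0$. The functions $f_n$ $(n\in\mathbb Z)$ form a basis of $(\mathrm{ind}_K^G\sigma)^{I_{1,K}}$. For $v\in(\mathrm{ind}_K^G\sigma)^{I_{1,K}}$ put $$S_Kv=\sum_{u\in N_{n_K}/N_{n_K+1}}u\beta_Kv,\qquad S_-v=\sum_{u'\in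 N'_{m_K}/N'_{m_K+1}}u'\beta_K\alpha^{-1}v .$$ Then: (1) For $n\ge1$: $S_Kf_n=f_{-n}$ and $S_-f_n=c_-f_n$, where $c_-=\sum_{(x,t)\in L^\times_{q^{4-t_K}}}\chi_\sigma(h(t))$. (2) For $n\ge0$: $S_Kf_{-n}=d_nf_{-n}$ and $S_-f_{-n}=f_{n+1}$, where $d_n=\sum_{(x,t)\in L^\times_{q^{t_K}}}\chi_\sigma(h(t))$ for $n\ge1$, while $d_0=-\chi_\sigma(h(\mathfrak t))$ if $\sigma$ is isomorphic to a twist, by a smooth character of $K$, of the Steinberg weight (the inflation to $K$ of the representation of $\Gamma_K$ on the $\overline{\mathbf F}_p$-valued functions on $\Gamma_K/\mathbb B$ modulo constants), and $d_0=0$ otherwise. -/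

import Mathlib

open ValuativeRel
open scoped Topology Matrix

namespace U21

noncomputable section

/-- `x` is a uniformizer of the non-archimedean local field `L`. -/
def IsUniformizer (L : Type*) [Field L] [ValuativeRel L] (x : L) : Prop :=
  ∃ hx : x ∈ 𝒪[L], Irreducible (⟨x, hx⟩ : 𝒪[L])

/-- `E / F` is an unramified quadratic extension: it has degree two, and every uniformizer of `F`
is still a uniformizer of `E` (the residue fields being finite, their extension is separable). -/
class IsUnramifiedQuadratic (F E : Type*) [Field F] [ValuativeRel F] [Field E] [ValuativeRel E]
    [Algebra F E] : Prop where
  finrank_eq : Module.finrank F E = 2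
  uniformizer : ∀ x : F, IsUniformizer F x → IsUniformizer E (algebraMap F E x)

section Representations

variable {k Γ V : Type*} [Field k] [Group Γ] [AddCommGroup V] [Module k V]

/-- The vectors of a representation fixed by a subgroup `H`. -/
def fixedBy (ρ : Representation k Γ V) (H : Subgroup Γ) : Submodule k V :=
  Representation.invariants (ρ.comp H.subtype)

/-- A representation is smooth if every vector is fixed by an open subgroup. -/
def IsSmooth [TopologicalSpace Γ] (ρ : Representation k Γ V) : Prop :=
  ∀ v : V, ∃ U : Subgroup Γ, IsOpen (U : Set Γ) ∧ ∀ u ∈ U, ρ u v = v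

/-- The twist of a representation by a character. -/
def twist (ψ : Γ →* kˣ) (ρ : Representation k Γ V) : Representation k Γ V where
  toFun g := (ψ g : k) • ρ g
  map_one' := by simp
  map_mul' g g' := by
    ext v
    simp [mul_smul, smul_comm (ψ g' : k)]

variable (k) in
/-- The representation of `Γ` on the `k`-valued functions on `Γ ⧸ H`. -/
def funRep (H : Subgroup Γ) : Representation k Γ (Γ ⧸ H → k) where
  toFun g := LinearMap.funLeft k k fun x => g⁻¹ • x
  map_one' := by ext; simp [LinearMap.funLeft]
  map_mul' g g' := by ext; simp [LinearMap.funLeft, mul_smul]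

variable (k) in
/-- The constant functions on `Γ ⧸ H`. -/
def constFun (H : Subgroup Γ) : Submodule k (Γ ⧸ H → k) :=
  Submodule.span k {fun _ => 1}

variable (k) in
/-- The representation of `Γ` on the functions on `Γ ⧸ H` modulo the constant functions. -/
def funModConst (H : Subgroup Γ) : Representation k Γ ((Γ ⧸ H → k) ⧸ constFun k H) :=
  (funRep k H).quotient (constFun k H) fun g => by
    rw [constFun, Submodule.span_le]
    rintro _ rfl
    exact Submodule.subset_span (by rfl)

end Representations

section LocalFields

set_option linter.unusedSectionVars false

variable {F E : Type*} [Field F] [ValuativeRel F] [TopologicalSpace F]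
  [IsNonarchimedeanLocalField F] [Field E] [ValuativeRel E] [TopologicalSpace E]
  [IsNonarchimedeanLocalField E] [Algebra F E] [ValuativeExtension F E]

section Auxiliary

theorem aut_aut {F E : Type*} [Field F] [ValuativeRel F] [Field E] [ValuativeRel E]
    [Algebra F E] [IsUnramifiedQuadratic F E] (c : E ≃ₐ[F] E) (x : E) : c (c x) = x := by
  have h2 : Module.finrank F E = 2 := IsUnramifiedQuadratic.finrank_eq
  have : FiniteDimensional F E := FiniteDimensional.of_finrank_pos (by omega)
  have hle := AlgEquiv.card_le (F := F) (K := E)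
  rw [h2] at hle
  have hc : c ^ 2 = 1 := by
    by_cases h1 : c = 1
    · simp [h1]
    have : Nontrivial (E ≃ₐ[F] E) := ⟨c, 1, h1⟩
    have h3 : Fintype.card (E ≃ₐ[F] E) = 2 := by
      have := Fintype.one_lt_card (α := (E ≃ₐ[F] E))
      omega
    rw [← h3]; exact pow_card_eq_one
  have := congrArg (fun f : E ≃ₐ[F] E => f x) hc
  simpa [pow_two] using this

theorem continuous_algebraMap_ext : Continuous (algebraMap F E) := by
  refine continuous_of_continuousAt_zero (algebraMap F E) ?_
  unfold ContinuousAt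
  rw [map_zero]
  rw [(IsValuativeTopology.hasBasis_nhds_zero' F).tendsto_iff (IsValuativeTopology.hasBasis_nhds_zero' E)]
  intro γ hγ
  obtain ⟨a, ha0, ha1⟩ := Valuation.IsNontrivial.exists_lt_one (v := valuation F)
  have ha1' : valuation E (algebraMap F E a) < 1 := by
    have := (ValuativeExtension.mapValueGroupWithZero_strictMono (A := F) (B := E)) ha1
    simpa using this
  obtain ⟨n, hn⟩ := exists_pow_lt₀ ha1' (Units.mk0 γ hγ)
  refine ⟨valuation F a ^ n, pow_ne_zero _ (by simpa using ha0), fun x hx => ?_⟩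
  have := (ValuativeExtension.mapValueGroupWithZero_strictMono (A := F) (B := E)) hx
  simp only [map_pow, ValuativeExtension.mapValueGroupWithZero_valuation] at this
  exact this.trans hn

theorem continuous_aut [IsUnramifiedQuadratic F E] (c : E ≃ₐ[F] E) : Continuous c := by
  have h2 : Module.finrank F E = 2 := IsUnramifiedQuadratic.finrank_eq
  have : FiniteDimensional F E := FiniteDimensional.of_finrank_pos (by omega)
  let := IsTopologicalAddGroup.rightUniformSpace F
  have := isUniformAddGroup_of_addCommGroup (G := F)
  let := IsTopologicalAddGroup.rightUniformSpace E
  have := isUniformAddGroup_of_addCommGroup (G := E)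
  let : (Valued.v (R := F)).RankOne :=
  { hom' := IsRankLeOne.nonempty.some.emb (R := F).comp MonoidWithZeroHom.ValueGroup₀.embedding
    strictMono' := IsRankLeOne.nonempty.some.strictMono.comp
        MonoidWithZeroHom.ValueGroup₀.embedding_strictMono }
  let : NontriviallyNormedField F := Valued.toNontriviallyNormedField F (ValueGroupWithZero F)
  have : ContinuousSMul F E := ⟨by
    simp only [Algebra.smul_def]
    exact (continuous_algebraMap_ext.comp continuous_fst).mul continuous_snd⟩
  have : T2Space E := inferInstance
  exact LinearMap.continuous_of_finiteDimensional (𝕜 := F) (E := E) (F' := E) c.toLinearMap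

theorem aut_le_one [IsUnramifiedQuadratic F E] (c : E ≃ₐ[F] E) {x : E} (hx : valuation E x ≤ 1) :
    valuation E (c x) ≤ 1 := by
  by_contra hlt
  rw [not_le] at hlt
  have hx0 : x ≠ 0 := by rintro rfl; simp at hlt
  have h0 := (continuous_aut c).tendsto 0
  rw [map_zero, (IsValuativeTopology.hasBasis_nhds_zero' E).tendsto_iff
    (IsValuativeTopology.hasBasis_nhds_zero' E)] at h0
  obtain ⟨γ, hγ, H⟩ := h0 1 one_ne_zero
  obtain ⟨n, hn⟩ := exists_pow_lt₀ (inv_lt_one_of_one_lt₀ hlt) (Units.mk0 γ hγ)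
  have := H ((c x)⁻¹ ^ n) (by simpa using hn)
  simp only [map_pow, map_inv₀, aut_aut, Set.mem_ofPred_eq] at this
  refine absurd this (not_lt.mpr ?_)
  have : 1 ≤ (valuation E x)⁻¹ := (one_le_inv₀ (by simpa [zero_lt_iff] using hx0)).mpr hx
  exact one_le_pow₀ this

theorem valuation_aut [IsUnramifiedQuadratic F E] (c : E ≃ₐ[F] E) (x : E) : valuation E (c x) = valuation E x := by
  have key : ∀ y : E, valuation E (c y) ≤ valuation E y := by
    intro y
    by_contra h
    rw [not_le] at h
    have h0 : c y ≠ 0 := by intro h0; simp [h0] at h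
    have h1 : valuation E (y / c y) ≤ 1 := by
      rw [map_div₀]; exact div_le_one_of_le₀ h.le zero_le
    have h2 := aut_le_one c h1
    rw [map_div₀, aut_aut, map_div₀] at h2
    have hy0 : y ≠ 0 := by rintro rfl; simp at h0
    rw [div_le_one₀ (by simpa [zero_lt_iff] using hy0)] at h2
    exact absurd h (not_lt.mpr h2)
  refine le_antisymm (key x) ?_
  simpa [aut_aut] using key (c x)

end Auxiliary

/-- The choices behind the notation: the non-trivial automorphism of `E / F`, and a uniformizer
of `E` which lies in `F` (this is what makes `diag(ϖ⁻¹, 1, ϖ)` unitary). -/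
structure Datum (F E : Type*) [Field F] [Field E] [ValuativeRel E] [Algebra F E] where
  conj : E ≃ₐ[F] E
  conj_ne : conj ≠ AlgEquiv.refl
  ϖ : E
  isUniformizer : IsUniformizer E ϖ
  conj_ϖ : conj ϖ = ϖ

/-- The two conjugacy classes of maximal compact open subgroups: `K0` (hyperspecial) and `K1`. -/
inductive MaxCompact
  | K0
  | K1

/-- The Hermitian matrix, as a matrix over `E`. -/
def βmat (E : Type*) [Field E] : Matrix (Fin 3) (Fin 3) E := !![0, 0, 1; 0, 1, 0; 1, 0, 0]

theorem βmat_mul_self (E : Type*) [Field E] : βmat E * βmat E = 1 := by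
  ext i j
  fin_cases i <;> fin_cases j <;> simp [βmat, Matrix.mul_apply, Fin.sum_univ_three]

namespace Datum

section Algebraic

variable {F E : Type*} [Field F] [Field E] [ValuativeRel E] [Algebra F E] (D : Datum F E)

/-- The Hermitian form `h(v, w) = vᵀ β w̄`. -/
def herm (v w : Fin 3 → E) : E := v ⬝ᵥ (βmat E *ᵥ fun i => D.conj (w i))

/-- The unitary group `G = U(2,1)(E/F)`. -/
def G : Subgroup (GL (Fin 3) E) where
  carrier := {g | ∀ v w : Fin 3 → E,
    D.herm ((g : Matrix (Fin 3) (Fin 3) E) *ᵥ v) ((g : Matrix (Fin 3) (Fin 3) E) *ᵥ w) = D.herm v w}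
  one_mem' := by intro v w; simp
  mul_mem' := by
    intro a b ha hb v w
    rw [Units.val_mul, ← Matrix.mulVec_mulVec, ← Matrix.mulVec_mulVec, ha, hb]
  inv_mem' := by
    intro a ha v w
    rw [← ha]
    simp [Matrix.mulVec_mulVec]

/-- The matrix of an element of `G`. -/
def mat (g : D.G) : Matrix (Fin 3) (Fin 3) E := ((g : GL (Fin 3) E) : Matrix (Fin 3) (Fin 3) E)

theorem herm_mulVec (M : Matrix (Fin 3) (Fin 3) E) (v w : Fin 3 → E) :
    D.herm (M *ᵥ v) (M *ᵥ w) =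
      v ⬝ᵥ ((Mᵀ * βmat E * M.map D.conj) *ᵥ fun i => D.conj (w i)) := by
  have h1 : (fun i => D.conj ((M *ᵥ w) i)) = M.map D.conj *ᵥ fun i => D.conj (w i) := by
    ext i
    simp [Matrix.mulVec, dotProduct]
  rw [herm, h1]
  simp only [Matrix.dotProduct_mulVec, Matrix.vecMul_mulVec, Matrix.mul_assoc,
    Matrix.mulVec_mulVec]

theorem mem_G_iff (g : GL (Fin 3) E) :
    g ∈ D.G ↔ (g : Matrix (Fin 3) (Fin 3) E)ᵀ * βmat E *
      (g : Matrix (Fin 3) (Fin 3) E).map D.conj = βmat E := by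
  constructor
  · intro h
    ext i j
    have h1 := h (Pi.single i 1) (Pi.single j 1)
    have h2 : (fun l => D.conj ((Pi.single j 1 : Fin 3 → E) l)) = Pi.single j 1 := by
      ext l
      by_cases hl : l = j
      · subst hl; simp
      · simp [Pi.single_eq_of_ne hl]
    rw [herm_mulVec, h2] at h1
    rw [herm, h2] at h1
    simpa using h1
  · intro h v w
    rw [herm_mulVec, h, herm]

theorem mat_eq (g : D.G) : (D.mat g)ᵀ * βmat E * (D.mat g).map D.conj = βmat E :=
  (D.mem_G_iff _).1 g.2

@[simp] theorem mat_mul (g g' : D.G) : D.mat (g * g') = D.mat g * D.mat g' := rfl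

@[simp] theorem mat_one : D.mat 1 = 1 := rfl

theorem βmat_map : (βmat E).map D.conj = βmat E := by
  ext i j
  fin_cases i <;> fin_cases j <;> simp [βmat]

/-- The element of `G` with a given matrix. -/
def ofMatrix (M : Matrix (Fin 3) (Fin 3) E) (hM : Mᵀ * βmat E * M.map D.conj = βmat E) : D.G :=
  ⟨Matrix.GeneralLinearGroup.mkOfDetNeZero M (by
    intro h0
    have h1 := congrArg Matrix.det hM
    have h2 := congrArg Matrix.det (βmat_mul_self E)
    rw [Matrix.det_mul, Matrix.det_mul, Matrix.det_transpose, h0] at h1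
    rw [Matrix.det_mul, ← h1] at h2
    simp at h2), (D.mem_G_iff _).2 hM⟩

@[simp] theorem mat_ofMatrix (M : Matrix (Fin 3) (Fin 3) E) (hM) : D.mat (D.ofMatrix M hM) = M :=
  rfl

theorem mat_inv [ValuativeRel F] [IsUnramifiedQuadratic F E] (g : D.G) :
    D.mat g⁻¹ = βmat E * ((D.mat g).map D.conj)ᵀ * βmat E := by
  have h1 : (βmat E * ((D.mat g).map D.conj)ᵀ * βmat E) * D.mat g = 1 := by
    have h2 := congrArg (fun M : Matrix (Fin 3) (Fin 3) E => M.map D.conj) (D.mat_eq g)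
    simp only [Matrix.map_mul, βmat_map, Matrix.map_map] at h2
    have h3 : (⇑D.conj ∘ ⇑D.conj) = id := by
      ext x
      exact aut_aut D.conj x
    rw [h3, Matrix.map_id, Matrix.transpose_map] at h2
    rw [Matrix.mul_assoc, Matrix.mul_assoc, ← Matrix.mul_assoc _ (βmat E) (D.mat g), h2,
      βmat_mul_self]
  have h4 : D.mat g * D.mat g⁻¹ = 1 := by rw [← mat_mul, mul_inv_cancel, mat_one]
  calc D.mat g⁻¹ = ((βmat E * ((D.mat g).map D.conj)ᵀ * βmat E) * D.mat g) * D.mat g⁻¹ := by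
        rw [h1, one_mul]
    _ = _ := by rw [Matrix.mul_assoc, h4, mul_one]

theorem mat_inv_apply [ValuativeRel F] [IsUnramifiedQuadratic F E] (g : D.G) (i j : Fin 3) :
    D.mat g⁻¹ i j = D.conj (D.mat g j.rev i.rev) := by
  rw [mat_inv]
  fin_cases i <;> fin_cases j <;>
    simp [βmat, Matrix.mul_apply, Matrix.vecMul, dotProduct, Fin.sum_univ_three]

theorem ϖ_ne_zero : D.ϖ ≠ 0 := by
  obtain ⟨h, h'⟩ := D.isUniformizer
  intro h0
  exact h'.ne_zero (Subtype.ext h0)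

/-- The element `β` of `G`. -/
def β : D.G := D.ofMatrix (βmat E) (by
  rw [βmat_map]
  ext i j
  fin_cases i <;> fin_cases j <;> simp [βmat, Matrix.mul_apply, Fin.sum_univ_three])

/-- The element `α = diag(ϖ⁻¹, 1, ϖ)` of `G`. -/
def α : D.G := D.ofMatrix (!![D.ϖ⁻¹, 0, 0; 0, 1, 0; 0, 0, D.ϖ]) (by
  have := D.ϖ_ne_zero
  ext i j
  fin_cases i <;> fin_cases j <;>
    simp [βmat, Matrix.mul_apply, Fin.sum_univ_three, D.conj_ϖ, this])

/-- The element `h(x) = diag(x, - x̄ x⁻¹, x̄⁻¹)` of `G`, for `x ∈ Eˣ`. -/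
def h [ValuativeRel F] [IsUnramifiedQuadratic F E] (x : Eˣ) : D.G :=
  D.ofMatrix (!![(x : E), 0, 0; 0, -D.conj x * (x : E)⁻¹, 0; 0, 0, (D.conj x)⁻¹]) (by
    have h0 : (x : E) ≠ 0 := x.ne_zero
    have h1 : D.conj (x : E) ≠ 0 := by simp
    ext i j
    fin_cases i <;> fin_cases j <;>
      simp [βmat, Matrix.mul_apply, Fin.sum_univ_three, aut_aut D.conj, h0, h1]
    field_simp)

end Algebraic

section Valuative

variable [IsUnramifiedQuadratic F E] (D : Datum F E)

theorem val_ϖ_lt_one : valuation E D.ϖ < 1 := by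
  obtain ⟨hx, hirr⟩ := D.isUniformizer
  refine lt_of_le_of_ne hx fun h1 => hirr.not_isUnit ?_
  have h0 : D.ϖ ≠ 0 := D.ϖ_ne_zero
  refine isUnit_iff_exists_inv.mpr ⟨⟨D.ϖ⁻¹, ?_⟩, Subtype.ext (mul_inv_cancel₀ h0)⟩
  rw [Valuation.mem_integer_iff, map_inv₀, h1, inv_one]

theorem val_ϖ_pos : 0 < valuation E D.ϖ := by
  simpa [zero_lt_iff] using D.ϖ_ne_zero

/-- `D.InP k y` says that `y` lies in the fractional ideal `𝔭ᵏ = ϖᵏ 𝔬` of `E`. -/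
def InP (k : ℤ) (y : E) : Prop := valuation E y ≤ valuation E D.ϖ ^ k

variable {D}

theorem InP.mono {k l : ℤ} {y : E} (hy : D.InP k y) (hl : l ≤ k) : D.InP l y :=
  le_trans hy (zpow_le_zpow_right_of_le_one₀ D.val_ϖ_pos D.val_ϖ_lt_one.le hl)

theorem InP.add {k : ℤ} {x y : E} (hx : D.InP k x) (hy : D.InP k y) : D.InP k (x + y) :=
  (Valuation.map_add _ _ _).trans (max_le hx hy)

theorem InP.neg {k : ℤ} {x : E} (hx : D.InP k x) : D.InP k (-x) := by
  simpa [InP] using hx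

theorem InP.mul {k l : ℤ} {x y : E} (hx : D.InP k x) (hy : D.InP l y) : D.InP (k + l) (x * y) := by
  rw [InP, map_mul, zpow_add₀ D.val_ϖ_pos.ne']
  exact mul_le_mul' hx hy

theorem InP.zero {k : ℤ} : D.InP k 0 := by simp [InP]

theorem InP.one : D.InP 0 1 := by simp [InP]

theorem InP.conj {k : ℤ} {x : E} (hx : D.InP k x) : D.InP k (D.conj x) := by
  rwa [InP, valuation_aut]

theorem InP.sum {ι : Type*} {s : Finset ι} {k : ℤ} {f : ι → E} (hf : ∀ i ∈ s, D.InP k (f i)) :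
    D.InP k (∑ i ∈ s, f i) :=
  Valuation.map_sum_le _ hf

variable (D)

/-- The subgroup of all `g ∈ G` with `g i j ∈ 𝔭 ^ (e i j)` for all `i`, `j`. -/
def latticeSubgroup (e : Fin 3 → Fin 3 → ℤ) (hdiag : ∀ i, e i i = 0)
    (hmul : ∀ i j k, e i k ≤ e i j + e j k) (hrev : ∀ i j, e j.rev i.rev = e i j) :
    Subgroup D.G where
  carrier := {g | ∀ i j, D.InP (e i j) (D.mat g i j)}
  one_mem' := by
    intro i j
    rw [mat_one]
    by_cases hij : i = j
    · subst hij
      rw [hdiag, Matrix.one_apply_eq]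
      exact InP.one
    · rw [Matrix.one_apply_ne hij]
      exact InP.zero
  mul_mem' := by
    intro a b ha hb i k
    rw [mat_mul, Matrix.mul_apply]
    exact InP.sum fun j _ => ((ha i j).mul (hb j k)).mono (hmul i j k)
  inv_mem' := by
    intro a ha i j
    rw [mat_inv_apply, ← hrev]
    exact (ha _ _).conj

/-- Exponents `e` such that `K = (𝔭 ^ (e i j)) ∩ G`:
`K₀ = GL₃(𝔬) ∩ G`, and `K₁ = (𝔬 𝔬 𝔭⁻¹; 𝔭 𝔬 𝔬; 𝔭 𝔭 𝔬) ∩ G`. -/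
def expK : MaxCompact → Fin 3 → Fin 3 → ℤ
  | .K0 => ![![0, 0, 0], ![0, 0, 0], ![0, 0, 0]]
  | .K1 => ![![0, 0, -1], ![1, 0, 0], ![1, 1, 0]]

/-- Exponents for the Iwahori subgroup of `K`. -/
def expI : MaxCompact → Fin 3 → Fin 3 → ℤ
  | .K0 => ![![0, 0, 0], ![1, 0, 0], ![1, 1, 0]]
  | .K1 => ![![0, 0, -1], ![1, 0, 0], ![2, 1, 0]]

/-- The maximal compact open subgroup `K`. -/
def K (T : MaxCompact) : Subgroup D.G :=
  D.latticeSubgroup (expK T) (by cases T <;> decide) (by cases T <;> decide)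
    (by cases T <;> decide)

/-- The Iwahori subgroup `I_K`: the inverse image in `K` of the upper triangular subgroup of the
reductive quotient `Γ_K = K / K¹`. -/
def I (T : MaxCompact) : Subgroup D.G :=
  D.latticeSubgroup (expI T) (by cases T <;> decide) (by cases T <;> decide)
    (by cases T <;> decide)

theorem I_le_K (T : MaxCompact) : D.I T ≤ D.K T := fun _ hg i j =>
  (hg i j).mono ((by cases T <;> decide : ∀ i j, expK T i j ≤ expI T i j) i j)

/-- The pro-`p` Iwahori subgroup `I_{1,K}`: the elements of `I_K` whose diagonal entries are
congruent to `1` modulo `𝔭`. -/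
def I1 (T : MaxCompact) : Subgroup D.G where
  carrier := {g | g ∈ D.I T ∧ ∀ i, D.InP 1 (D.mat g i i - 1)}
  one_mem' := ⟨one_mem _, fun i => by simpa using InP.zero⟩
  mul_mem' := by
    rintro a b ⟨ha, ha'⟩ ⟨hb, hb'⟩
    refine ⟨mul_mem ha hb, fun i => ?_⟩
    have h1 : D.mat (a * b) i i - 1 = (D.mat a i i - 1) * D.mat b i i + (D.mat b i i - 1) +
        ∑ j ∈ Finset.univ.erase i, D.mat a i j * D.mat b j i := by
      rw [mat_mul, Matrix.mul_apply, ← Finset.add_sum_erase _ _ (Finset.mem_univ i)]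
      ring
    rw [h1]
    have hd : expI T i i = 0 := (by cases T <;> decide : ∀ i, expI T i i = 0) i
    have hb2 := hb i i
    rw [hd] at hb2
    refine (((ha' i).mul hb2).add (hb' i)).add (InP.sum fun j hj => ?_)
    refine ((ha i j).mul (hb j i)).mono ?_
    exact (by cases T <;> decide : ∀ i j, j ≠ i → 1 ≤ expI T i j + expI T j i) i j
      (Finset.ne_of_mem_erase hj)
  inv_mem' := by
    rintro a ⟨ha, ha'⟩
    refine ⟨inv_mem ha, fun i => ?_⟩
    rw [mat_inv_apply]
    simpa using (ha' i.rev).conj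

theorem I1_le_I (T : MaxCompact) : D.I1 T ≤ D.I T := fun _ hg => hg.1

theorem I1_le_K (T : MaxCompact) : D.I1 T ≤ D.K T := (D.I1_le_I T).trans (D.I_le_K T)

/-- `β_K`: the element `β` for `K₀` and `β' = β α⁻¹` for `K₁`. -/
def βK : MaxCompact → D.G
  | .K0 => D.β
  | .K1 => D.β * D.α⁻¹

theorem βK_mem (T : MaxCompact) : D.βK T ∈ D.K T := by
  have h1 : valuation E D.ϖ ≤ 1 := D.val_ϖ_lt_one.le
  cases T
  · intro i j
    fin_cases i <;> fin_cases j <;> simp [βK, β, βmat, expK, InP]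
  · intro i j
    rw [βK, mat_mul, Matrix.mul_apply]
    simp only [mat_inv_apply]
    fin_cases i <;> fin_cases j <;>
      simp [β, α, βmat, expK, InP, Fin.sum_univ_three, D.conj_ϖ]

/-- The matrix `n(x, y)`. -/
def nMat (x y : E) : Matrix (Fin 3) (Fin 3) E := !![1, x, y; 0, 1, -D.conj x; 0, 0, 1]

/-- The matrix `n'(x, y)`. -/
def nMat' (x y : E) : Matrix (Fin 3) (Fin 3) E := !![1, 0, 0; x, 1, 0; y, -D.conj x, 1]

theorem InP_cross {k : ℤ} {x y x' y' : E} (h : x * D.conj x + y + D.conj y = 0) (hy : D.InP k y)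
    (h' : x' * D.conj x' + y' + D.conj y' = 0) (hy' : D.InP k y') : D.InP k (x * D.conj x') := by
  have aux : ∀ {x y : E}, x * D.conj x + y + D.conj y = 0 → D.InP k y →
      valuation E x * valuation E x ≤ valuation E D.ϖ ^ k := by
    intro x y h hy
    have h1 : x * D.conj x = -(y + D.conj y) := by linear_combination h
    have h2 : D.InP k (x * D.conj x) := h1 ▸ (hy.add hy.conj).neg
    rwa [InP, map_mul, valuation_aut] at h2
  have h1 := aux h hy
  have h2 := aux h' hy'
  rw [InP, map_mul, valuation_aut]
  rcases le_total (valuation E x) (valuation E x') with hl | hl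
  · exact (mul_le_mul_left hl _).trans h2
  · exact (mul_le_mul_right hl _).trans h1

/-- The group `N_k` of all `n(x, y)` in `G` with `y ∈ 𝔭ᵏ`. -/
def N (k : ℤ) : Subgroup D.G where
  carrier := {g | ∃ x y, x * D.conj x + y + D.conj y = 0 ∧ D.InP k y ∧ D.mat g = D.nMat x y}
  one_mem' := ⟨0, 0, by simp, InP.zero, by
    ext i j; fin_cases i <;> fin_cases j <;> simp [nMat]⟩
  mul_mem' := by
    rintro a b ⟨x, y, h, hy, ha⟩ ⟨x', y', h', hy', hb⟩
    refine ⟨x + x', y + y' - x * D.conj x', ?_, ?_, ?_⟩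
    · simp only [map_add, map_sub, map_mul, aut_aut]
      linear_combination h + h'
    · rw [sub_eq_add_neg]
      exact (hy.add hy').add (D.InP_cross h hy h' hy').neg
    · rw [mat_mul, ha, hb]
      ext i j
      fin_cases i <;> fin_cases j <;>
        simp [nMat, Matrix.mul_apply, Fin.sum_univ_three] <;> ring
  inv_mem' := by
    rintro a ⟨x, y, h, hy, ha⟩
    refine ⟨-x, D.conj y, ?_, hy.conj, ?_⟩
    · simp only [map_neg, aut_aut]
      linear_combination h
    · ext i j
      rw [mat_inv_apply, ha]
      fin_cases i <;> fin_cases j <;> simp [nMat, aut_aut]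

/-- The group `N'_k` of all `n'(x, y)` in `G` with `y ∈ 𝔭ᵏ`. -/
def N' (k : ℤ) : Subgroup D.G where
  carrier := {g | ∃ x y, x * D.conj x + y + D.conj y = 0 ∧ D.InP k y ∧ D.mat g = D.nMat' x y}
  one_mem' := ⟨0, 0, by simp, InP.zero, by
    ext i j; fin_cases i <;> fin_cases j <;> simp [nMat']⟩
  mul_mem' := by
    rintro a b ⟨x, y, h, hy, ha⟩ ⟨x', y', h', hy', hb⟩
    refine ⟨x + x', y + y' - D.conj x * x', ?_, ?_, ?_⟩
    · simp only [map_add, map_sub, map_mul, aut_aut]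
      linear_combination h + h'
    · rw [sub_eq_add_neg, mul_comm]
      exact (hy.add hy').add (D.InP_cross h' hy' h hy).neg
    · rw [mat_mul, ha, hb]
      ext i j
      fin_cases i <;> fin_cases j <;>
        simp [nMat', Matrix.mul_apply, Fin.sum_univ_three] <;> ring
  inv_mem' := by
    rintro a ⟨x, y, h, hy, ha⟩
    refine ⟨-x, D.conj y, ?_, hy.conj, ?_⟩
    · simp only [map_neg, aut_aut]
      linear_combination h
    · ext i j
      rw [mat_inv_apply, ha]
      fin_cases i <;> fin_cases j <;> simp [nMat', aut_aut]

/-- The integer `n_K` with `N ∩ I_{1,K} = N_{n_K}`. -/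
def nK : MaxCompact → ℤ
  | .K0 => 0
  | .K1 => -1

/-- The integer `m_K` with `N' ∩ I_{1,K} = N'_{m_K}`. -/
def mK : MaxCompact → ℤ
  | .K0 => 1
  | .K1 => 2

/-- `t_K`: the group `N_{n_K} / N_{n_K + 1}` has order `q ^ t_K`. -/
def tK : MaxCompact → ℕ
  | .K0 => 3
  | .K1 => 1

theorem InP_of_val_lt_one {x : E} (hx : valuation E x < 1) : D.InP 1 x := by
  obtain ⟨hϖ, hirr⟩ := D.isUniformizer
  rw [InP, zpow_one]
  have h1 : (⟨x, hx.le⟩ : 𝒪[E]) ∈ IsLocalRing.maximalIdeal 𝒪[E] := by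
    rw [IsLocalRing.mem_maximalIdeal, mem_nonunits_iff]
    intro hu
    obtain ⟨y, hy⟩ := isUnit_iff_exists_inv.mp hu
    have h2 := congrArg (fun z : 𝒪[E] => valuation E (z : E)) hy
    simp only [Subring.coe_mul, Subring.coe_one, map_mul, map_one] at h2
    exact absurd h2 (mul_lt_one_of_lt_of_le hx y.2).ne
  rw [hirr.maximalIdeal_eq, Ideal.mem_span_singleton'] at h1
  obtain ⟨a, ha⟩ := h1
  have h2 := congrArg (fun z : 𝒪[E] => valuation E (z : E)) ha
  simp only [Subring.coe_mul, map_mul] at h2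
  rw [← h2]
  exact mul_le_of_le_one_left' a.2

theorem val_le_of_sq {x : E} {k : ℤ} (h : D.InP (2 * k - 1) (x * x)) : D.InP k x := by
  by_contra hx
  rw [InP, not_le] at hx
  have hp := D.val_ϖ_pos
  have hpk : (0 : ValueGroupWithZero E) < valuation E D.ϖ ^ k := zpow_pos hp k
  have hx0 : x ≠ 0 := by
    rintro rfl
    simp at hx
  have hvx : (0 : ValueGroupWithZero E) < valuation E x := by simpa [zero_lt_iff] using hx0
  have h1 : valuation E (D.ϖ ^ k / x) < 1 := by
    rw [map_div₀, map_zpow₀]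
    exact (div_lt_one₀ hvx).2 hx
  have h2 := (D.InP_of_val_lt_one h1).mul (D.InP_of_val_lt_one h1) |>.mul h
  have h3 : D.ϖ ^ k / x * (D.ϖ ^ k / x) * (x * x) = D.ϖ ^ (2 * k) := by
    rw [two_mul, zpow_add₀ D.ϖ_ne_zero]
    field_simp
  rw [h3, InP, map_zpow₀] at h2
  have h4 := (zpow_lt_zpow_iff_right_of_lt_one₀ hp D.val_ϖ_lt_one).2
    (show (2 * k : ℤ) < 1 + 1 + (2 * k - 1) by omega)
  exact absurd h2 (not_le.mpr h4)

/-- `N ∩ I_{1,K} = N_{n_K}`. -/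
theorem N_inter_I1 (T : MaxCompact) (g : D.G) :
    (g ∈ D.I1 T ∧ ∃ x y, x * D.conj x + y + D.conj y = 0 ∧ D.mat g = D.nMat x y) ↔
      g ∈ D.N (nK T) := by
  constructor
  · rintro ⟨hg, x, y, h, hm⟩
    refine ⟨x, y, h, ?_, hm⟩
    have := hg.1 0 2
    rw [hm] at this
    cases T <;> simpa [expI, nK, nMat] using this
  · rintro ⟨x, y, h, hy, hm⟩
    refine ⟨⟨?_, ?_⟩, x, y, h, hm⟩
    · have hx : D.InP 0 x := by
        refine D.val_le_of_sq ?_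
        have := D.InP_cross h hy h hy
        rw [InP, map_mul, valuation_aut, ← map_mul] at this
        exact InP.mono this (by cases T <;> decide)
      intro i j
      rw [hm]
      have h1 : D.InP 0 (D.conj x) := hx.conj
      cases T <;> fin_cases i <;> fin_cases j <;>
        simp [expI, nMat, InP.zero, InP.one, hx, h1.neg] <;> exact hy
    · intro i
      rw [hm]
      fin_cases i <;> simp [nMat, InP.zero]

/-- `N' ∩ I_{1,K} = N'_{m_K}`. -/
theorem N'_inter_I1 (T : MaxCompact) (g : D.G) :
    (g ∈ D.I1 T ∧ ∃ x y, x * D.conj x + y + D.conj y = 0 ∧ D.mat g = D.nMat' x y) ↔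
      g ∈ D.N' (mK T) := by
  constructor
  · rintro ⟨hg, x, y, h, hm⟩
    refine ⟨x, y, h, ?_, hm⟩
    have := hg.1 2 0
    rw [hm] at this
    cases T <;> simpa [expI, mK, nMat'] using this
  · rintro ⟨x, y, h, hy, hm⟩
    refine ⟨⟨?_, ?_⟩, x, y, h, hm⟩
    · have hx : D.InP 1 x := by
        refine D.val_le_of_sq ?_
        have := D.InP_cross h hy h hy
        rw [InP, map_mul, valuation_aut, ← map_mul] at this
        exact InP.mono this (by cases T <;> decide)
      intro i j
      rw [hm]
      have h1 : D.InP 1 (D.conj x) := hx.conj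
      cases T <;> fin_cases i <;> fin_cases j <;>
        simp [expI, nMat', InP.zero, InP.one, hx, h1.neg] <;> exact hy
    · intro i
      rw [hm]
      fin_cases i <;> simp [nMat', InP.zero]

/-- The conjugation on `𝔬_E`. -/
def conjInt : 𝒪[E] ≃+* 𝒪[E] where
  toFun x := ⟨D.conj x, by rw [Valuation.mem_integer_iff, valuation_aut]; exact x.2⟩
  invFun x := ⟨D.conj x, by rw [Valuation.mem_integer_iff, valuation_aut]; exact x.2⟩
  left_inv x := Subtype.ext (aut_aut D.conj x)
  right_inv x := Subtype.ext (aut_aut D.conj x)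
  map_mul' x y := Subtype.ext (map_mul D.conj (x : E) y)
  map_add' x y := Subtype.ext (map_add D.conj (x : E) y)

/-- The conjugation on the residue field `k_E`. -/
def conjRes : 𝓀[E] ≃+* 𝓀[E] := IsLocalRing.ResidueField.mapEquiv D.conjInt

/-- For `t = 3` the group `L_{q³} = {(x, t) ∈ k_E² | x x̄ + t + t̄ = 0}`, for `t = 1` its central
subgroup `L_q = {(0, t) | t + t̄ = 0}`, as sets. -/
def L (t : ℕ) : Set (𝓀[E] × 𝓀[E]) :=
  {a | a.1 * D.conjRes a.1 + a.2 + D.conjRes a.2 = 0 ∧ (t = 1 → a.1 = 0)}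

/-- `h(t)` for a unit `t` of `𝔬_E`, as an element of `I_K`. -/
def hI (T : MaxCompact) (t : (𝒪[E])ˣ) : D.I T :=
  ⟨D.h (Units.map (𝒪[E]).subtype.toMonoidHom t), by
    have h0 : valuation E ((t : 𝒪[E]) : E) ≤ 1 := (t : 𝒪[E]).2
    have h1 : valuation E (((t⁻¹ : (𝒪[E])ˣ) : 𝒪[E]) : E) ≤ 1 := ((t⁻¹ : (𝒪[E])ˣ) : 𝒪[E]).2
    have h2 : valuation E ((t : 𝒪[E]) : E) * valuation E (((t⁻¹ : (𝒪[E])ˣ) : 𝒪[E]) : E) = 1 := by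
      rw [← map_mul, ← Subring.coe_mul, Units.mul_inv]
      simp
    have h3 : valuation E ((t : 𝒪[E]) : E) = 1 := by
      refine le_antisymm h0 (h2 ▸ mul_le_of_le_one_right' h1)
    intro i j
    cases T <;> fin_cases i <;> fin_cases j <;>
      simp [h, expI, InP, valuation_aut, h3]⟩


section CompactInduction

variable {k W : Type*} [Field k] [AddCommGroup W] [Module k W]

/-- The space of the compact induction `ind_K^G σ`: the smooth functions `f : G → W` with compact
support such that `f(κ g) = σ(κ) f(g)` for `κ ∈ K`. -/
def compInd {T : MaxCompact} (σ : Representation k (D.K T) W) : Submodule k (D.G → W) where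
  carrier := {f | (∀ (κ : D.K T) (g : D.G), f (κ * g) = σ κ (f g)) ∧
    (∃ U : Subgroup D.G, IsOpen (U : Set D.G) ∧ ∀ u ∈ U, ∀ g, f (g * u) = f g) ∧
    HasCompactSupport f}
  zero_mem' := ⟨fun _ _ => by simp, ⟨⊤, isOpen_univ, fun _ _ _ => rfl⟩, HasCompactSupport.zero⟩
  add_mem' := by
    rintro f f' ⟨h1, ⟨U, hU, h2⟩, h3⟩ ⟨h1', ⟨U', hU', h2'⟩, h3'⟩
    refine ⟨fun κ g => by simp [h1, h1'], ⟨U ⊓ U', hU.inter hU', fun u hu g => ?_⟩, h3.add h3'⟩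
    simp [h2 u hu.1, h2' u hu.2]
  smul_mem' := by
    rintro c f ⟨h1, ⟨U, hU, h2⟩, h3⟩
    refine ⟨fun κ g => by simp [h1], ⟨U, hU, fun u hu g => by simp [h2 u hu]⟩, ?_⟩
    exact h3.mono fun g hg hg' => hg (by simp [hg'])

/-- `ind_K^G σ`: the group `G` acts on `compInd σ` by right translation. -/
def ind {T : MaxCompact} (σ : Representation k (D.K T) W) :
    Representation k D.G (D.compInd σ) where
  toFun g :=
    { toFun := fun f => ⟨fun x => (f : D.G → W) (x * g), by
        obtain ⟨f, h1, ⟨U, hU, h2⟩, h3⟩ := f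
        refine ⟨fun κ x => by simp only [mul_assoc, h1], ⟨U.comap (MulAut.conj g⁻¹).toMonoidHom,
          ?_, fun u hu x => ?_⟩, ?_⟩
        · refine hU.preimage (f := fun u : D.G => g⁻¹ * u * g⁻¹⁻¹) ?_
          fun_prop
        · have h4 : x * u * g = x * g * (g⁻¹ * u * g) := by group
          have h5 : g⁻¹ * u * g ∈ U := by simpa using hu
          change f (x * u * g) = f (x * g)
          rw [h4, h2 _ h5]
        · exact h3.comp_homeomorph (Homeomorph.mulRight g)⟩
      map_add' := fun _ _ => rfl
      map_smul' := fun _ _ => rfl }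
  map_one' := by ext f x; simp
  map_mul' g g' := by ext f x; simp [mul_assoc]

/-- The line `σ^{I_{1,K}}`. -/
def weightLine {T : MaxCompact} (σ : Representation k (D.K T) W) : Submodule k W :=
  fixedBy σ ((D.I1 T).subgroupOf (D.K T))

/-- The character `χ_σ` of `I_K`: the scalar by which an element of `I_K` acts on the line
`σ^{I_{1,K}}`. -/
def χ {T : MaxCompact} (σ : Representation k (D.K T) W) (i : D.I T) : k :=
  Classical.epsilon fun c : k =>
    ∀ v ∈ D.weightLine σ, σ (Subgroup.inclusion (D.I_le_K T) i) v = c • v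

open Classical in
/-- `χ_σ(h(t))` for a non-zero `t` in the residue field: `t` is lifted to a unit of `𝔬_E`. -/
def χh {T : MaxCompact} (σ : Representation k (D.K T) W) (t : 𝓀[E]) : k :=
  if ht : t ≠ 0 then
    D.χ σ (D.hI T (Function.surjInv
      (IsLocalRing.surjective_units_map_of_local_ringHom (IsLocalRing.residue 𝒪[E])
        IsLocalRing.residue_surjective inferInstance) (Units.mk0 t ht)))
  else 0

/-- The sum of `χ_σ(h(t))` over all `(x, t) ∈ L_{q^r}` different from the identity. -/
def charSum {T : MaxCompact} (σ : Representation k (D.K T) W) (r : ℕ) : k :=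
  ∑ᶠ a ∈ D.L r \ {(0, 0)}, D.χh σ a.2

/-- `σ` is a twist, by a smooth character of `K`, of the Steinberg weight of `K`, i.e. of the
inflation to `K` of the representation of `Γ_K` on the functions on
`Γ_K / 𝔹 = K / I_K` modulo the constant functions. -/
def IsSteinbergTwist {T : MaxCompact} (σ : Representation k (D.K T) W) : Prop :=
  ∃ ψ : D.K T →* kˣ, IsOpen (ψ.ker : Set (D.K T)) ∧
    Nonempty (σ.Equiv (twist ψ (funModConst k ((D.I T).subgroupOf (D.K T)))))

/-- `f = f_n`: it is supported on `K α⁻ⁿ I_{1,K}`, and its value at `α⁻ⁿ` is `β_K v₀` if `n > 0`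
and `v₀` if `n ≤ 0`. -/
def IsBasisFunction {T : MaxCompact} (σ : Representation k (D.K T) W) (v₀ : W) (n : ℤ)
    (f : D.G → W) : Prop :=
  (∀ g, f g ≠ 0 → ∃ κ ∈ D.K T, ∃ i ∈ D.I1 T, g = κ * D.α ^ (-n) * i) ∧
    f (D.α ^ (-n)) = if 0 < n then σ ⟨D.βK T, D.βK_mem T⟩ v₀ else v₀

variable {V : Type*} [AddCommGroup V] [Module k V]

/-- The map `S_K v = ∑ u β_K v`, the sum over `u ∈ N_{n_K} / N_{n_K + 1}`; it is meant for vectors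
`v` fixed by `N'_{m_K}`, for which `u β_K v` depends only on the coset of `u`. -/
def SK (T : MaxCompact) (π : Representation k D.G V) (v : V) : V :=
  ∑ᶠ u : D.N (nK T) ⧸ (D.N (nK T + 1)).subgroupOf (D.N (nK T)),
    π (u.out : D.N (nK T)) (π (D.βK T) v)

theorem antidiag_conj (γ g : D.G) {c : E} (hc : D.conj c = c) (hc0 : c ≠ 0)
    (hγ : D.mat γ = !![0, 0, c⁻¹; 0, 1, 0; c, 0, 0]) {x y : E} :
    (D.mat g = D.nMat x y → D.mat (γ⁻¹ * g * γ) = D.nMat' (-c * D.conj x) (c ^ 2 * y)) ∧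
    (D.mat g = D.nMat' x y → D.mat (γ⁻¹ * g * γ) = D.nMat (-c⁻¹ * D.conj x) (c⁻¹ ^ 2 * y)) := by
  have hi : D.mat γ⁻¹ = !![0, 0, c⁻¹; 0, 1, 0; c, 0, 0] := by
    ext i j
    rw [mat_inv_apply, hγ]
    fin_cases i <;> fin_cases j <;> simp [hc]
  constructor <;>
  · intro hm
    rw [mat_mul, mat_mul, hm, hi, hγ]
    ext i j
    rw [Matrix.mul_apply, Fin.sum_univ_three]
    simp only [Matrix.mul_apply, Fin.sum_univ_three]
    fin_cases i <;> fin_cases j <;> simp [nMat, nMat', aut_aut, hc, hc0] <;> ring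

theorem InP_of_eq {x : E} {k : ℤ} (hx : x = D.ϖ ^ k) : D.InP k x := by
  rw [hx, InP, map_zpow₀]

theorem mat_βK (T : MaxCompact) :
    ∃ c : E, D.conj c = c ∧ c ≠ 0 ∧ D.InP (mK T - 1 - nK T) (c ^ 2) ∧
      D.mat (D.βK T) = !![0, 0, c⁻¹; 0, 1, 0; c, 0, 0] := by
  cases T
  · refine ⟨1, by simp, by simp, by simp [InP, mK, nK], ?_⟩
    simp [βK, β, βmat]
  · refine ⟨D.ϖ, D.conj_ϖ, D.ϖ_ne_zero, D.InP_of_eq (zpow_natCast D.ϖ 2).symm, ?_⟩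
    ext i j
    rw [βK, mat_mul, Matrix.mul_apply, Fin.sum_univ_three]
    simp only [mat_inv_apply]
    fin_cases i <;> fin_cases j <;> simp [β, α, βmat, D.conj_ϖ]

theorem mat_βK_mul_αinv (T : MaxCompact) :
    ∃ c : E, D.conj c = c ∧ c ≠ 0 ∧ D.InP (nK T - (mK T + 1)) (c⁻¹ ^ 2) ∧
      D.mat (D.βK T * D.α⁻¹) = !![0, 0, c⁻¹; 0, 1, 0; c, 0, 0] := by
  have key : ∀ (γ : D.G) (c : E), D.mat γ = !![0, 0, c⁻¹; 0, 1, 0; c, 0, 0] →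
      D.mat (γ * D.α⁻¹) = !![0, 0, (c * D.ϖ)⁻¹; 0, 1, 0; c * D.ϖ, 0, 0] := by
    intro γ c hγ
    ext i j
    rw [mat_mul, Matrix.mul_apply, Fin.sum_univ_three]
    simp only [mat_inv_apply, hγ]
    fin_cases i <;> fin_cases j <;> simp [α, D.conj_ϖ, mul_comm]
  have h0 : D.mat D.β = !![0, 0, (1 : E)⁻¹; 0, 1, 0; 1, 0, 0] := by simp [β, βmat]
  cases T
  · refine ⟨1 * D.ϖ, by simp [D.conj_ϖ], by simp [D.ϖ_ne_zero], ?_, key _ _ h0⟩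
    refine D.InP_of_eq (?_ : _ = D.ϖ ^ (-2 : ℤ))
    rw [one_mul, inv_pow, zpow_neg]
    exact congrArg _ (zpow_natCast D.ϖ 2).symm
  · refine ⟨1 * D.ϖ * D.ϖ, by simp [D.conj_ϖ], by simp [D.ϖ_ne_zero], ?_, key _ _ (key _ _ h0)⟩
    refine D.InP_of_eq (?_ : _ = D.ϖ ^ (-4 : ℤ))
    have h4 : D.ϖ ^ (4 : ℤ) = D.ϖ ^ 4 := zpow_natCast D.ϖ 4
    rw [zpow_neg, h4]
    ring

theorem βK_conj_N (T : MaxCompact) {g : D.G} (hg : g ∈ D.N (nK T + 1)) :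
    (D.βK T)⁻¹ * g * D.βK T ∈ D.N' (mK T) := by
  obtain ⟨x, y, h, hy, hm⟩ := hg
  obtain ⟨c, hc, hc0, hcP, hβ⟩ := D.mat_βK T
  refine ⟨_, _, ?_, (hcP.mul hy).mono (by omega), (D.antidiag_conj _ _ hc hc0 hβ).1 hm⟩
  simp only [map_neg, map_mul, map_pow, hc, aut_aut]
  linear_combination c ^ 2 * h

theorem βK_conj_N' (T : MaxCompact) {g : D.G} (hg : g ∈ D.N' (mK T + 1)) :
    (D.βK T * D.α⁻¹)⁻¹ * g * (D.βK T * D.α⁻¹) ∈ D.N (nK T) := by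
  obtain ⟨x, y, h, hy, hm⟩ := hg
  obtain ⟨c, hc, hc0, hcP, hβ⟩ := D.mat_βK_mul_αinv T
  refine ⟨_, _, ?_, (hcP.mul hy).mono (by omega), (D.antidiag_conj _ _ hc hc0 hβ).2 hm⟩
  simp only [map_neg, map_mul, map_pow, map_inv₀, hc, aut_aut]
  linear_combination c⁻¹ ^ 2 * h

theorem SK_summand (T : MaxCompact) (π : Representation k D.G V) {v : V}
    (hv : v ∈ fixedBy π (D.N' (mK T))) {u u' : D.G} (h : u⁻¹ * u' ∈ D.N (nK T + 1)) :
    π u (π (D.βK T) v) = π u' (π (D.βK T) v) := by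
  have h1 : π ((D.βK T)⁻¹ * (u⁻¹ * u') * D.βK T) v = v := hv ⟨_, D.βK_conj_N T h⟩
  have h2 : u' * D.βK T = u * D.βK T * ((D.βK T)⁻¹ * (u⁻¹ * u') * D.βK T) := by group
  rw [← Module.End.mul_apply, ← Module.End.mul_apply, ← map_mul, ← map_mul, h2, map_mul π (_ * _) (_ * _ * _),
    Module.End.mul_apply, h1]

/-- The map `S_- v = ∑ u' β_K α⁻¹ v`, the sum over `u' ∈ N'_{m_K} / N'_{m_K + 1}`; it is
meant for vectors `v` fixed by `N_{n_K}`, for which `u' β_K α⁻¹ v` depends only on the coset of `u'`. -/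
def Sminus (T : MaxCompact) (π : Representation k D.G V) (v : V) : V :=
  ∑ᶠ u : D.N' (mK T) ⧸ (D.N' (mK T + 1)).subgroupOf (D.N' (mK T)),
    π (u.out : D.N' (mK T)) (π (D.βK T * D.α⁻¹) v)

theorem Sminus_summand (T : MaxCompact) (π : Representation k D.G V) {v : V}
    (hv : v ∈ fixedBy π (D.N (nK T))) {u u' : D.G} (h : u⁻¹ * u' ∈ D.N' (mK T + 1)) :
    π u (π (D.βK T * D.α⁻¹) v) = π u' (π (D.βK T * D.α⁻¹) v) := by
  have h1 : π ((D.βK T * D.α⁻¹)⁻¹ * (u⁻¹ * u') * (D.βK T * D.α⁻¹)) v = v :=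
    hv ⟨_, D.βK_conj_N' T h⟩
  have h2 : u' * (D.βK T * D.α⁻¹) = u * (D.βK T * D.α⁻¹) *
      ((D.βK T * D.α⁻¹)⁻¹ * (u⁻¹ * u') * (D.βK T * D.α⁻¹)) := by group
  rw [← Module.End.mul_apply, ← Module.End.mul_apply, ← map_mul, ← map_mul, h2, map_mul π (_ * _) (_ * _ * _),
    Module.End.mul_apply, h1]

end CompactInduction

end Valuative

end Datum

end LocalFields

end

end U21

open U21

/-! `G` is the disjoint union of the double cosets `K αⁿ I₁`, so an `I₁`-fixed vector of the compact
induction is determined by its values at the powers of `α`. Both `S_K` and `S_-` preserve `I₁`-fixed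
vectors, and every formula becomes an evaluation of `∑ f(α⁻ᵐ u β_K)` or `∑ f(α⁻ᵐ u' β_K α⁻¹)` for
each integer `m`.

For one sign of `m`, conjugation by `α⁻ᵐ` carries the summation group into the kernel `Z` of `K →
Γ_K`, which acts trivially on `σ`. All terms then agree, and their number is a multiple of `p`, so
the sum is zero (`SK_value_of_pos`, `Sminus_value_of_nonpos`). For the other sign, the trivial coset
contributes `β_K` applied to the value at a reflected power of `α`. On a nontrivial coset the rank
one relation `n(x, y) β_K = n' h(z) n`, with `z` the unit `ϖ^(-n_K) y`, applies: `n'` crosses the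
power of `α` and lands in `Z`, `n` is absorbed by right `I₁`-invariance, and `h(z)` acts through
`χ_σ`. The reductions of the `(x, y)` run through `L` without its origin, which produces `charSum`
(`SK_value_of_neg`, `Sminus_value_of_pos`, `IsCoord.finsum_eq`).

The value of `S_K f_0` at `1` is a question about the finite group `Γ_K`, treated in `K` modulo `Z`
through the axioms `RankOne`: how does `S = ∑ u w` act on the `I₁`-fixed vectors of an irreducible
representation? These form a line because the dual contains a vector whose translates by the `u w`
span it (`RankOne.finrank_fixedBy`). If `S v = d v` with `d ≠ 0`, the kernel of `Ind χ → σ` contains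
no nonzero function vanishing at `1`, so it is spanned by one function; that function is a
character, and untwisting by it identifies `σ` with functions modulo constants
(`RankOne.exists_equiv_twist`). Conversely, in the Steinberg representation the indicator of the big
cell is minus that of the trivial coset, and a relation in `K` evaluates the twisting character at
`w`, giving `-χ_σ(h(𝔱))` (`RankOne.sum_eq_of_equiv_twist`). -/

namespace U21

/-! ### Fixed vectors and eigenvectors in representations of abstract groups. -/

section AbstractRepresentations

variable {k Γ V : Type*} [Field k] [Group Γ] [AddCommGroup V] [Module k V]

theorem mem_fixedBy_iff {ρ : Representation k Γ V} {H : Subgroup Γ} {v : V} :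
    v ∈ fixedBy ρ H ↔ ∀ g ∈ H, ρ g v = v :=
  ⟨fun h g hg => h ⟨g, hg⟩, fun h g => h g g.2⟩

theorem rep_mul_apply (ρ : Representation k Γ V) (g g' : Γ) (v : V) :
    ρ (g * g') v = ρ g (ρ g' v) := by
  rw [map_mul, Module.End.mul_apply]

/-- A group acting through a finite `p`-group on a nonzero space in characteristic `p` has a
nonzero fixed vector. -/
theorem exists_fixed_of_pow_mem (p : ℕ) [Fact p.Prime] [CharP k p] (ρ : Representation k Γ V)
    (P Z : Subgroup Γ) [Z.FiniteIndex] (hpow : ∀ g ∈ P, ∃ n : ℕ, g ^ p ^ n ∈ Z)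
    (M : Submodule k V) (hM : ∀ g ∈ P, ∀ v ∈ M, ρ g v ∈ M) (hZ : ∀ z ∈ Z, ∀ v ∈ M, ρ z v = v)
    (hM0 : M ≠ ⊥) : ∃ v ∈ M, v ≠ 0 ∧ ∀ g ∈ P, ρ g v = v := by
  obtain ⟨v, hvM, hv0⟩ := M.ne_bot_iff.1 hM0
  -- The additive span is used instead of the `k`-span because `k` may be infinite: a finitely
  -- generated group killed by `p` is finite, so its fixed points can be counted.
  let S : AddSubgroup V := AddSubgroup.closure (Set.range fun g : P => ρ g v)
  have hSM : ∀ s ∈ S, s ∈ M := by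
    intro s hs
    have : S ≤ M.toAddSubgroup := by
      rw [AddSubgroup.closure_le]
      rintro _ ⟨g, rfl⟩
      exact hM g g.2 v hvM
    exact this hs
  have hS : ∀ g ∈ P, ∀ s ∈ S, ρ g s ∈ S := by
    intro g hg s hs
    have : S ≤ S.comap (ρ g).toAddMonoidHom := by
      rw [AddSubgroup.closure_le]
      rintro _ ⟨h, rfl⟩
      refine AddSubgroup.subset_closure ⟨⟨g, hg⟩ * h, ?_⟩
      exact rep_mul_apply ρ g h v
    exact this hs
  have hvS : v ∈ S := AddSubgroup.subset_closure ⟨1, by simp⟩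
  have htors : ∀ s : S, p • s = 0 := fun s => Subtype.ext (by
    rw [AddSubgroup.coe_nsmul, ← Nat.cast_smul_eq_nsmul k]; simp)
  have hfin : (Set.range fun g : P => ρ g v).Finite := by
    let f : P ⧸ Z.subgroupOf P → V := Quotient.lift (fun g : P => ρ g v) (by
      intro a b hab
      have h1 : ((a : Γ)⁻¹ * b) ∈ Z := by
        have h0 : a⁻¹ * b ∈ Z.subgroupOf P := QuotientGroup.leftRel_apply.1 hab
        exact h0
      have h2 : (b : Γ) = a * ((a : Γ)⁻¹ * b) := by group
      change ρ (a : Γ) v = ρ (b : Γ) v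
      rw [h2, rep_mul_apply, hZ _ h1 v hvM])
    refine (Set.finite_range f).subset ?_
    rintro _ ⟨g, rfl⟩
    exact ⟨(g : P ⧸ Z.subgroupOf P), rfl⟩
  have : Finite S := by
    have : AddGroup.FG S := by
      rw [AddGroup.fg_iff_addSubgroup_fg]
      exact ⟨hfin.toFinset, by simp [S]⟩
    exact AddCommGroup.finite_of_fg_isAddTorsion S fun s =>
      isOfFinAddOrder_iff_nsmul_eq_zero.2 ⟨p, (Fact.out : p.Prime).pos, htors s⟩
  let φ : P →* Equiv.Perm S :=
    { toFun := fun g =>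
        { toFun := fun s => ⟨ρ g s, hS g g.2 s s.2⟩
          invFun := fun s => ⟨ρ g⁻¹ s, hS _ (P.inv_mem g.2) s s.2⟩
          left_inv := fun s => Subtype.ext (by simp)
          right_inv := fun s => Subtype.ext (by simp) }
      map_one' := by ext; simp
      map_mul' := fun a b => by ext; simp }
  have hφ : IsPGroup p φ.range := by
    rintro ⟨_, g, rfl⟩
    obtain ⟨n, hn⟩ := hpow g g.2
    refine ⟨n, Subtype.ext ?_⟩
    rw [SubgroupClass.coe_pow, ← map_pow]
    ext s
    exact hZ _ hn s (hSM s s.2)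
  have hcard : p ∣ Nat.card S := by
    have h1 : addOrderOf (⟨v, hvS⟩ : S) = p :=
      addOrderOf_eq_prime (htors _) fun h => hv0 (congrArg Subtype.val h)
    exact h1 ▸ addOrderOf_dvd_natCard _
  -- The number of fixed points of a `p`-group on `S` is congruent to the order of `S`, hence to
  -- `0`, modulo `p`; as `0` is fixed, there is another fixed point.
  obtain ⟨b, hb, hb0⟩ := hφ.exists_fixed_point_of_prime_dvd_card_of_fixed_point S hcard
    (a := 0) (by
      rintro ⟨_, g, rfl⟩
      exact Subtype.ext (map_zero (ρ g)))
  refine ⟨b, hSM b b.2, fun h => hb0 (Subtype.ext h.symm), fun g hg => ?_⟩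
  exact congrArg Subtype.val (hb ⟨φ ⟨g, hg⟩, ⟨g, hg⟩, rfl⟩)

/-- A sum over representatives of `P ⧸ (P ∩ w P w⁻¹)` is fixed by `P`. -/
theorem rep_finsum_eq (ρ : Representation k Γ V) (P : Subgroup Γ) (w : Γ) {ι : Type*} [Finite ι]
    (r : ι → Γ) (hex : ∀ g ∈ P, ∀ i, ∃ j, w⁻¹ * ((r j)⁻¹ * g * r i) * w ∈ P)
    (huniq : ∀ i j, w⁻¹ * ((r i)⁻¹ * r j) * w ∈ P → i = j) {v : V} (hv : v ∈ fixedBy ρ P)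
    {g : Γ} (hg : g ∈ P) : ρ g (∑ᶠ i, ρ (r i) (ρ w v)) = ∑ᶠ i, ρ (r i) (ρ w v) := by
  choose j hj using hex g hg
  have hinj : Function.Injective j := by
    intro a b hab
    refine huniq a b ?_
    have h1 := P.mul_mem (P.inv_mem (hj a)) (hj b)
    rw [hab] at h1
    convert h1 using 1
    group
  rw [map_finsum _ (Set.toFinite _)]
  refine Eq.trans ?_ (finsum_comp_equiv (Equiv.ofBijective j hinj.bijective_of_finite))
  refine finsum_congr fun i => ?_
  have h1 : g * r i * w = r (j i) * w * (w⁻¹ * ((r (j i))⁻¹ * g * r i) * w) := by group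
  rw [← rep_mul_apply, ← rep_mul_apply, h1, rep_mul_apply, mem_fixedBy_iff.1 hv _ (hj i),
    rep_mul_apply, Equiv.ofBijective_apply]

theorem irreducible_eq_top {ρ : Representation k Γ V} (hρ : ρ.IsIrreducible) (M : Submodule k V)
    (hM : ∀ g, ∀ v ∈ M, ρ g v ∈ M) (h0 : M ≠ ⊥) : M = ⊤ := by
  rcases hρ.eq_bot_or_eq_top ⟨M, fun g v hv => hM g v hv⟩ with h | h
  · exact absurd (congrArg Subrepresentation.toSubmodule h) h0
  · exact congrArg Subrepresentation.toSubmodule h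

theorem irreducible_nontrivial {ρ : Representation k Γ V} (hρ : ρ.IsIrreducible) :
    Nontrivial V := by
  by_contra h
  rw [not_nontrivial_iff_subsingleton] at h
  have h1 := hρ.toNontrivial
  obtain ⟨a, b, hab⟩ := h1
  exact hab (Subrepresentation.toSubmodule_injective (Subsingleton.elim _ _))

/-- A normal subgroup with a nonzero fixed vector in an irreducible representation acts
trivially. -/
theorem irreducible_trivial_of_normal {ρ : Representation k Γ V} (hρ : ρ.IsIrreducible)
    (Z : Subgroup Γ) (hZ : Z.Normal) {v : V} (hv0 : v ≠ 0) (hv : v ∈ fixedBy ρ Z) :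
    ∀ z ∈ Z, ∀ x, ρ z x = x := by
  have h : fixedBy ρ Z = ⊤ := by
    refine irreducible_eq_top hρ _ (fun g x hx => ?_) fun h => hv0 (by simpa [h] using hv)
    rw [mem_fixedBy_iff] at hx ⊢
    intro z hz
    have h1 : z * g = g * (g⁻¹ * z * g) := by group
    rw [← rep_mul_apply, h1, rep_mul_apply]
    rw [hx _ (by simpa using hZ.conj_mem z hz g⁻¹)]
  intro z hz x
  exact mem_fixedBy_iff.1 (h ▸ Submodule.mem_top : x ∈ fixedBy ρ Z) z hz

/-- Operators commuting on a nonzero finite-dimensional stable subspace have a common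
eigenvector. -/
theorem exists_common_eigenvector [IsAlgClosed k] [FiniteDimensional k V]
    {Γ : Type*} (A : Γ → Module.End k V) (s : Set Γ) (M : Submodule k V) (hM0 : M ≠ ⊥)
    (hM : ∀ g ∈ s, ∀ v ∈ M, A g v ∈ M)
    (hcomm : ∀ g ∈ s, ∀ g' ∈ s, ∀ v ∈ M, A g (A g' v) = A g' (A g v)) :
    ∃ v ∈ M, v ≠ 0 ∧ ∀ g ∈ s, ∃ c : k, A g v = c • v := by
  induction h : Module.finrank k M using Nat.strong_induction_on generalizing M with
  | _ n ih =>
  by_cases hsc : ∀ g ∈ s, ∃ c : k, ∀ v ∈ M, A g v = c • v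
  · obtain ⟨v, hv, hv0⟩ := M.ne_bot_iff.1 hM0
    exact ⟨v, hv, hv0, fun g hg => (hsc g hg).imp fun c hc => hc v hv⟩
  push Not at hsc
  obtain ⟨g, hg, hgM⟩ := hsc
  have : Nontrivial M := (Submodule.nontrivial_iff_ne_bot).2 hM0
  obtain ⟨c, hc⟩ := Module.End.exists_eigenvalue ((A g).restrict (hM g hg))
  obtain ⟨⟨x, hxM⟩, hx, hx0⟩ := hc.exists_hasEigenvector
  -- An operator that is not scalar on `M` has a proper nonzero eigenspace in `M`; commutation makes
  -- this eigenspace stable, and the induction on dimension applies to it.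
  let M' : Submodule k V := M ⊓ LinearMap.ker (A g - c • (1 : Module.End k V))
  have hmem : ∀ v, v ∈ M' ↔ v ∈ M ∧ A g v = c • v := fun v => by
    simp [M', sub_eq_zero]
  have hlt : M' < M := by
    refine lt_of_le_of_ne inf_le_left fun he => ?_
    obtain ⟨v, hv, hv'⟩ := hgM c
    exact hv' ((hmem v).1 (he ▸ hv)).2
  obtain ⟨v, hv, hv'⟩ := ih _ (h ▸ Submodule.finrank_lt_finrank_of_lt hlt) M'
    (M'.ne_bot_iff.2 ⟨x, (hmem x).2 ⟨hxM, by
      simpa using congrArg Subtype.val (Module.End.mem_eigenspace_iff.1 hx)⟩,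
        fun h0 => hx0 (Subtype.ext h0)⟩)
    (fun g' hg' v hv => by
      rw [hmem] at hv ⊢
      exact ⟨hM g' hg' v hv.1, by rw [hcomm g hg g' hg' v hv.1, hv.2, map_smul]⟩)
    (fun a ha b hb v hv => hcomm a ha b hb v ((hmem v).1 hv).1) rfl
  exact ⟨v, ((hmem v).1 hv).1, hv'⟩

end AbstractRepresentations

/-! ### Rank one groups: the Hecke operator `∑ u w` and the line of fixed vectors. -/

/-- A split pair of rank one, up to a normal subgroup `Z` of finite index: the images of `I`, `N`
and `w` in `Γ ⧸ Z` are a Borel subgroup, its unipotent radical (a `p`-group), and a reflection;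
`r` lists representatives of `N ⧸ (N ∩ Z)`. -/
structure RankOne (p : ℕ) {Γ ι : Type*} [Group Γ] (I I₁ N Z : Subgroup Γ) (w : Γ) (r : ι → Γ) :
    Prop where
  I₁_le : I₁ ≤ I
  N_le : N ≤ I₁
  Z_le : Z ≤ I₁
  normal : Z.Normal
  finiteIndex : Z.FiniteIndex
  w_mul_w : w * w = 1
  w_notMem : w ∉ I
  bruhat : ∀ g, g ∈ I ∨ ∃ u ∈ N, ∃ i ∈ I, g = u * w * i
  mem_Z : ∀ u ∈ N, w * u * w ∈ I → u ∈ Z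
  decomp : ∀ g ∈ I₁, ∃ u ∈ N, ∃ z ∈ Z, g = u * z
  torus : ∀ i ∈ I, ∃ i₁ ∈ I₁, ∃ h, i = i₁ * h ∧ w * h * w ∈ I ∧ ∀ u ∈ N, h * u * h⁻¹ ∈ N
  comm : ∀ a ∈ I, ∀ b ∈ I, a⁻¹ * b⁻¹ * a * b ∈ I₁
  pow_mem : ∀ u ∈ I₁, ∃ n : ℕ, u ^ p ^ n ∈ Z
  r_mem : ∀ i, r i ∈ N
  r_exists : ∀ u ∈ N, ∃ i, (r i)⁻¹ * u ∈ Z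
  r_unique : ∀ i j, (r i)⁻¹ * r j ∈ Z → i = j
  not_le : ∃ u ∈ N, u ∉ Z

namespace RankOne

variable {p : ℕ} {Γ ι : Type*} [Group Γ] {I I₁ N Z : Subgroup Γ} {w : Γ} {r : ι → Γ}

section Group

variable (h : RankOne p I I₁ N Z w r)

include h

theorem w_inv : w⁻¹ = w := inv_eq_of_mul_eq_one_left h.w_mul_w

theorem w_conj_mem {z : Γ} (hz : z ∈ Z) : w * z * w ∈ Z := by
  have := h.normal.conj_mem z hz w
  rwa [h.w_inv] at this

theorem bruhat_rep (g : Γ) : g ∈ I ∨ ∃ j, ∃ i ∈ I, g = r j * w * i := by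
  refine (h.bruhat g).imp_right ?_
  rintro ⟨u, hu, i, hi, rfl⟩
  obtain ⟨j, hj⟩ := h.r_exists u hu
  refine ⟨j, w * ((r j)⁻¹ * u) * w * i, I.mul_mem (h.I₁_le (h.Z_le (h.w_conj_mem hj))) hi, ?_⟩
  have h1 : r j * w * (w * ((r j)⁻¹ * u) * w * i) = r j * (w * w) * (r j)⁻¹ * u * w * i := by
    group
  rw [h1, h.w_mul_w]
  group

/-- The index set is in bijection with `N ⧸ (N ∩ Z)`, a nontrivial finite `p`-group. -/
theorem card_eq_zero [Fintype ι] {k : Type*} [Field k] [Fact p.Prime] [CharP k p] :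
    (Fintype.card ι : k) = 0 := by
  have hn := h.normal
  have hfi := h.finiteIndex
  let f : ι → N ⧸ Z.subgroupOf N := fun i => ((⟨r i, h.r_mem i⟩ : N) : N ⧸ Z.subgroupOf N)
  have hf : Function.Bijective f := by
    constructor
    · intro i j hij
      have h0 := QuotientGroup.eq.1 (show ((⟨r i, h.r_mem i⟩ : N) : N ⧸ Z.subgroupOf N) =
        ((⟨r j, h.r_mem j⟩ : N) : N ⧸ Z.subgroupOf N) from hij)
      exact h.r_unique i j h0
    · intro q
      obtain ⟨u, rfl⟩ := QuotientGroup.mk_surjective q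
      obtain ⟨i, hi⟩ := h.r_exists u u.2
      exact ⟨i, QuotientGroup.eq.2 hi⟩
  have hp : IsPGroup p (N ⧸ Z.subgroupOf N) := by
    intro q
    obtain ⟨u, rfl⟩ := QuotientGroup.mk_surjective q
    obtain ⟨n, hn⟩ := h.pow_mem u (h.N_le u.2)
    refine ⟨n, ?_⟩
    rw [← QuotientGroup.mk_pow, QuotientGroup.eq_one_iff]
    exact hn
  rw [CharP.cast_eq_zero_iff k p, ← Nat.card_eq_fintype_card, Nat.card_eq_of_bijective f hf]
  refine hp.card_eq_or_dvd.resolve_left fun h1 => ?_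
  obtain ⟨u, hu, hu'⟩ := h.not_le
  have h2 := (Nat.card_eq_one_iff_unique.1 h1).1
  have h3 : ((⟨u, hu⟩ : N) : N ⧸ Z.subgroupOf N) = 1 := Subsingleton.elim _ _
  have h4 := (QuotientGroup.eq_one_iff (N := Z.subgroupOf N) (⟨u, hu⟩ : N)).1 h3
  exact hu' h4

end Group

section Rep

variable {k V : Type*} [Field k] [AddCommGroup V] [Module k V] {ρ : Representation k Γ V}
  [Fintype ι] (h : RankOne p I I₁ N Z w r) (hZ : ∀ z ∈ Z, ∀ x, ρ z x = x)

set_option linter.unusedSectionVars false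

include h hZ

/-- As `Z` acts trivially, a summand depends only on the coset of the representative, so any other
transversal inside `N` gives the same sum. -/
theorem sum_reindex {a : ι → Γ} (ha : ∀ i, a i ∈ N) (ha' : ∀ i j, (a i)⁻¹ * a j ∈ Z → i = j)
    (x : V) : ∑ i, ρ (a i) x = ∑ i, ρ (r i) x := by
  choose j hj using fun i => h.r_exists (a i) (ha i)
  have hinj : Function.Injective j := by
    intro b c hbc
    refine ha' b c ?_
    have h1 := Z.mul_mem (Z.inv_mem (hj b)) (hj c)
    rw [hbc] at h1
    convert h1 using 1
    group
  refine Eq.trans ?_ (Equiv.sum_comp (Equiv.ofBijective j hinj.bijective_of_finite) _)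
  refine Finset.sum_congr rfl fun i _ => ?_
  have h1 : a i = r (j i) * ((r (j i))⁻¹ * a i) := by group
  conv_lhs => rw [h1, rep_mul_apply, hZ _ (hj i)]
  rfl

/-- `I₁ = N Z` permutes the cosets of `Z` in `N`, and `w` normalises `Z`, so `rep_finsum_eq` applies
to the reflection `w`. -/
theorem sum_mem {v : V} (hv : v ∈ fixedBy ρ I₁) : ∑ i, ρ (r i) (ρ w v) ∈ fixedBy ρ I₁ := by
  rw [mem_fixedBy_iff]
  intro g hg
  rw [← finsum_eq_sum_of_fintype]
  refine rep_finsum_eq ρ I₁ w r (fun g hg i => ?_) (fun i j hij => ?_) hv hg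
  · obtain ⟨u, hu, z, hz, hguz⟩ := h.decomp _ (I₁.mul_mem hg (h.N_le (h.r_mem i)))
    obtain ⟨j, hj⟩ := h.r_exists u hu
    refine ⟨j, h.Z_le ?_⟩
    rw [mul_assoc _ g, hguz, ← mul_assoc (r j)⁻¹, h.w_inv]
    exact h.w_conj_mem (Z.mul_mem hj hz)
  · rw [h.w_inv] at hij
    exact h.r_unique i j (h.mem_Z _ (N.mul_mem (N.inv_mem (h.r_mem i)) (h.r_mem j))
      (h.I₁_le hij))

/-- Modulo `I₁` an element of `I` is some `t` normalising `N`. Conjugation by `t` permutes the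
representatives, and moving `t` across `w` leaves `w t w ∈ I`, which acts on `v` by a scalar. -/
theorem sum_eigen {v : V} (hv : v ∈ fixedBy ρ I₁) (hI : ∀ i ∈ I, ∃ c : k, ρ i v = c • v) :
    ∀ i ∈ I, ∃ c : k, ρ i (∑ i, ρ (r i) (ρ w v)) = c • ∑ i, ρ (r i) (ρ w v) := by
  intro i hi
  obtain ⟨i₁, hi₁, t, rfl, ht, htN⟩ := h.torus i hi
  obtain ⟨c, hc⟩ := hI _ ht
  refine ⟨c, ?_⟩
  have h1 : ρ t (∑ i, ρ (r i) (ρ w v)) = c • ∑ i, ρ (r i) (ρ w v) := by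
    refine Eq.trans ?_ (congrArg (c • ·) (h.sum_reindex hZ (a := fun i => t * r i * t⁻¹)
      (fun i => htN _ (h.r_mem i)) ?_ (ρ w v)))
    · rw [map_sum, Finset.smul_sum]
      refine Finset.sum_congr rfl fun i _ => ?_
      rw [← map_smul, ← map_smul, ← hc]
      simp only [← rep_mul_apply]
      congr 2
      have h2 : t * r i * t⁻¹ * (w * (w * t * w)) = t * r i * t⁻¹ * (w * w) * t * w := by group
      rw [h2, h.w_mul_w]
      group
    · intro a b hab
      refine h.r_unique a b ?_
      have := h.normal.conj_mem _ hab t⁻¹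
      convert this using 1
      group
  rw [rep_mul_apply, h1, map_smul, mem_fixedBy_iff.1 (h.sum_mem hZ hv) _ hi₁]

/-- The quadratic Hecke relation. In the inner sum, a representative in `Z` contributes a multiple
of `card ι = 0`; for any other, the Bruhat decomposition `w r w = u w i` turns the outer sum into a
scalar multiple of the original one. -/
theorem sum_sum [Fact p.Prime] [CharP k p] {v : V} (hv : v ∈ fixedBy ρ I₁)
    (hI : ∀ i ∈ I, ∃ c : k, ρ i v = c • v) :
    ∃ c : k, ∑ i, ρ (r i) (ρ w (∑ i, ρ (r i) (ρ w v))) = c • ∑ i, ρ (r i) (ρ w v) := by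
  have key : ∀ j, ∃ c : k, ∑ i, ρ (r i) (ρ w (ρ (r j) (ρ w v))) = c • ∑ i, ρ (r i) (ρ w v) := by
    intro j
    by_cases hj : r j ∈ Z
    · refine ⟨0, ?_⟩
      have h1 : ∀ i, ρ (r i) (ρ w (ρ (r j) (ρ w v))) = v := fun i => by
        rw [hZ _ hj, ← rep_mul_apply ρ w w, h.w_mul_w, map_one, Module.End.one_apply,
          mem_fixedBy_iff.1 hv _ (h.N_le (h.r_mem i))]
      simp only [h1, Finset.sum_const, Finset.card_univ, zero_smul]
      rw [← Nat.cast_smul_eq_nsmul k, h.card_eq_zero, zero_smul]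
    · rcases h.bruhat (w * r j * w) with hw | ⟨u, hu, i, hi, hui⟩
      · exact absurd (h.mem_Z _ (h.r_mem j) hw) hj
      obtain ⟨c, hc⟩ := hI i hi
      refine ⟨c, ?_⟩
      refine Eq.trans ?_ (congrArg (c • ·) (h.sum_reindex hZ (a := fun i => r i * u)
        (fun i => N.mul_mem (h.r_mem i) hu) ?_ (ρ w v)))
      · rw [Finset.smul_sum]
        refine Finset.sum_congr rfl fun i' _ => ?_
        rw [← map_smul, ← map_smul, ← hc]
        simp only [← rep_mul_apply, ← mul_assoc] at hui ⊢
        have h2 : r i' * w * r j * w = r i' * (w * r j * w) := by group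
        rw [h2, hui]
        simp only [mul_assoc]
      · intro a b hab
        refine h.r_unique a b ?_
        have := h.normal.conj_mem _ hab u
        convert this using 1
        group
  choose c hc using key
  refine ⟨∑ j, c j, ?_⟩
  simp only [map_sum]
  rw [Finset.sum_comm, Finset.sum_smul]
  exact Finset.sum_congr rfl fun j _ => hc j

/-- By Bruhat the orbit of `v` lies in the lines of `v` and of the `r i w v`, so `v` itself is the
only vector to be checked. Irreducibility is phrased through submodules so that it can be supplied
for the dual representation. -/
theorem span_eq_top (hirr : ∀ M : Submodule k V, (∀ g, ∀ v ∈ M, ρ g v ∈ M) → M ≠ ⊥ → M = ⊤)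
    {v : V} (hv0 : v ≠ 0) (hI : ∀ i ∈ I, ∃ c : k, ρ i v = c • v)
    (hv : v ∈ Submodule.span k (Set.range fun i => ρ (r i) (ρ w v))) :
    Submodule.span k (Set.range fun i => ρ (r i) (ρ w v)) = ⊤ := by
  rw [eq_top_iff, ← hirr (Submodule.span k (Set.range fun g => ρ g v)) ?_ ?_, Submodule.span_le]
  · rintro _ ⟨g, rfl⟩
    rcases h.bruhat_rep g with hg | ⟨j, i, hi, rfl⟩
    · obtain ⟨c, hc⟩ := hI g hg
      simp only [hc]
      exact Submodule.smul_mem _ c hv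
    · obtain ⟨c, hc⟩ := hI i hi
      simp only [rep_mul_apply, hc, map_smul]
      exact Submodule.smul_mem _ c (Submodule.subset_span ⟨j, rfl⟩)
  · intro g x hx
    refine Submodule.span_induction (p := fun x _ => ρ g x ∈ _) ?_ ?_ ?_ ?_ hx
    · rintro _ ⟨g', rfl⟩
      exact Submodule.subset_span ⟨g * g', rep_mul_apply ρ g g' v⟩
    · simp
    · intro x y _ _ hx hy
      simpa using Submodule.add_mem _ hx hy
    · intro c x _ hx
      simpa using Submodule.smul_mem _ c hx
  · exact Submodule.ne_bot_iff _ |>.2 ⟨v, Submodule.subset_span ⟨1, by simp⟩, hv0⟩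

/-- Applying `w` to the vanishing sum isolates `v` from the trivial coset; the other terms `w r w v`
lie in the span by the Bruhat decomposition. -/
theorem mem_span_of_sum_eq_zero {v : V} (hI : ∀ i ∈ I, ∃ c : k, ρ i v = c • v)
    (hS : ∑ i, ρ (r i) (ρ w v) = 0) :
    v ∈ Submodule.span k (Set.range fun i => ρ (r i) (ρ w v)) := by
  classical
  obtain ⟨j₀, hj₀⟩ := h.r_exists 1 N.one_mem
  rw [mul_one, inv_mem_iff] at hj₀
  have h1 := congrArg (ρ w) hS
  rw [map_zero, map_sum, ← Finset.add_sum_erase _ _ (Finset.mem_univ j₀), hZ _ hj₀,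
    ← rep_mul_apply, h.w_mul_w, map_one, Module.End.one_apply] at h1
  have h2 := eq_neg_of_add_eq_zero_left h1
  suffices -∑ j ∈ Finset.univ.erase j₀, ρ w (ρ (r j) (ρ w v)) ∈
      Submodule.span k (Set.range fun i => ρ (r i) (ρ w v)) from
    Set.mem_of_eq_of_mem h2 this
  refine Submodule.neg_mem _ (Submodule.sum_mem _ fun j hj => ?_)
  rw [← rep_mul_apply ρ (r j), ← rep_mul_apply]
  rcases h.bruhat_rep (w * (r j * w)) with hw | ⟨l, i, hi, hli⟩
  · refine absurd (h.r_unique j₀ j ?_) (Finset.ne_of_mem_erase hj).symm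
    exact Z.mul_mem (Z.inv_mem hj₀) (h.mem_Z _ (h.r_mem j) (by rwa [mul_assoc]))
  · obtain ⟨c, hc⟩ := hI i hi
    rw [hli, rep_mul_apply, rep_mul_apply, hc, map_smul, map_smul]
    exact Submodule.smul_mem _ c (Submodule.subset_span ⟨l, rfl⟩)

/-- Start from a common eigenvector `v` of `I` among the `I₁`-fixed vectors and put `S = ∑ u w`. If
`S v = 0`, then `v` works. Otherwise `S v` works: `S (S v) = c S v`, and either `c = 0` and the
first argument applies to `S v`, or `S v = c⁻¹ S (S v)` is visibly in the span. -/
theorem exists_cyclic [Fact p.Prime] [CharP k p] [IsAlgClosed k] [FiniteDimensional k V]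
    [Nontrivial V]
    (hirr : ∀ M : Submodule k V, (∀ g, ∀ v ∈ M, ρ g v ∈ M) → M ≠ ⊥ → M = ⊤) :
    ∃ v, v ≠ 0 ∧ v ∈ fixedBy ρ I₁ ∧
      Submodule.span k (Set.range fun i => ρ (r i) (ρ w v)) = ⊤ := by
  have hfi := h.finiteIndex
  obtain ⟨x, -, hx0, hx⟩ := exists_fixed_of_pow_mem p ρ I₁ Z h.pow_mem ⊤ (by simp)
    (fun z hz v _ => hZ z hz v) top_ne_bot
  have hnorm : ∀ g ∈ I, ∀ v ∈ fixedBy ρ I₁, ρ g v ∈ fixedBy ρ I₁ := by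
    intro g hg v hv
    rw [mem_fixedBy_iff] at hv ⊢
    intro i hi
    have h1 : i * g = g * (i * (i⁻¹ * g⁻¹ * i * g)) := by group
    rw [← rep_mul_apply, h1, rep_mul_apply, hv _ (I₁.mul_mem hi (h.comm _ (h.I₁_le hi) _ hg))]
  obtain ⟨v, hv, hv0, hvI⟩ := exists_common_eigenvector ρ (I : Set Γ) (fixedBy ρ I₁)
    ((Submodule.ne_bot_iff _).2 ⟨x, mem_fixedBy_iff.2 hx, hx0⟩) hnorm (by
      intro a ha b hb v hv
      have h1 : a * b = b * a * (a⁻¹ * b⁻¹ * a * b) := by group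
      rw [← rep_mul_apply, h1, rep_mul_apply, mem_fixedBy_iff.1 hv _ (h.comm a ha b hb),
        rep_mul_apply])
  by_cases hS : ∑ i, ρ (r i) (ρ w v) = 0
  · exact ⟨v, hv0, hv, h.span_eq_top hZ hirr hv0 hvI (h.mem_span_of_sum_eq_zero hZ hvI hS)⟩
  obtain ⟨c, hc⟩ := h.sum_sum hZ hv hvI
  have hSI := h.sum_eigen hZ hv hvI
  refine ⟨_, hS, h.sum_mem hZ hv, h.span_eq_top hZ hirr hS hSI ?_⟩
  by_cases hc0 : c = 0
  · rw [hc0, zero_smul] at hc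
    exact h.mem_span_of_sum_eq_zero hZ hSI hc
  · have h1 := (inv_smul_eq_iff₀ hc0).2 hc
    have h2 : c⁻¹ • ∑ i, ρ (r i) (ρ w (∑ i, ρ (r i) (ρ w v))) ∈ Submodule.span k
        (Set.range fun i => ρ (r i) (ρ w (∑ i, ρ (r i) (ρ w v)))) :=
      Submodule.smul_mem _ _ (Submodule.sum_mem _ fun i _ => Submodule.subset_span ⟨i, rfl⟩)
    exact Set.mem_of_eq_of_mem h1.symm h2

omit [Fintype ι] in
theorem finiteDimensional (hρ : ρ.IsIrreducible) : FiniteDimensional k V := by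
  have hfi := h.finiteIndex
  have := irreducible_nontrivial hρ
  obtain ⟨v, hv0⟩ := exists_ne (0 : V)
  have hfin : (Set.range fun g => ρ g v).Finite := by
    let f : Γ ⧸ Z → V := Quotient.lift (fun g : Γ => ρ g v) (by
      intro a b hab
      have h1 : a⁻¹ * b ∈ Z := QuotientGroup.leftRel_apply.1 hab
      have h2 : b = a * (a⁻¹ * b) := by group
      change ρ a v = ρ b v
      rw [h2, rep_mul_apply, hZ _ h1])
    refine (Set.finite_range f).subset ?_
    rintro _ ⟨g, rfl⟩
    exact ⟨(g : Γ ⧸ Z), rfl⟩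
  have htop : Submodule.span k (Set.range fun g => ρ g v) = ⊤ := by
    refine irreducible_eq_top hρ _ (fun g x hx => ?_)
      ((Submodule.ne_bot_iff _).2 ⟨v, Submodule.subset_span ⟨1, by simp⟩, hv0⟩)
    refine Submodule.span_induction (p := fun x _ => ρ g x ∈ _) ?_ ?_ ?_ ?_ hx
    · rintro _ ⟨g', rfl⟩
      exact Submodule.subset_span ⟨g * g', rep_mul_apply ρ g g' v⟩
    · simp
    · intro x y _ _ hx hy
      simpa using Submodule.add_mem _ hx hy
    · intro c x _ hx
      simpa using Submodule.smul_mem _ c hx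
  exact ⟨htop ▸ Submodule.fg_span hfin⟩

/-- The fixed vectors of `I₁` in an irreducible representation form a line. -/
theorem finrank_fixedBy [Fact p.Prime] [CharP k p] [IsAlgClosed k] (hρ : ρ.IsIrreducible) :
    Module.finrank k (fixedBy ρ I₁) = 1 := by
  have hfd := h.finiteDimensional hZ hρ
  have hnt := irreducible_nontrivial hρ
  have hfi := h.finiteIndex
  obtain ⟨x, -, hx0, hx⟩ := exists_fixed_of_pow_mem p ρ I₁ Z h.pow_mem ⊤ (by simp)
    (fun z hz v _ => hZ z hz v) top_ne_bot
  -- Irreducibility passes to the dual because `M ↦ M.dualCoannihilator` reverses stable subspaces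
  -- in finite dimension.
  have hirr : ∀ M : Submodule k (Module.Dual k V), (∀ g, ∀ f ∈ M, ρ.dual g f ∈ M) → M ≠ ⊥ →
      M = ⊤ := by
    intro M hM hM0
    by_cases hbot : M.dualCoannihilator = ⊥
    · rw [← Subspace.dualCoannihilator_dualAnnihilator_eq (W := M), hbot,
        Submodule.dualAnnihilator_bot]
    · refine absurd ?_ hM0
      have h1 := irreducible_eq_top hρ _ (fun g v hv => ?_) hbot
      · rw [← Subspace.dualCoannihilator_dualAnnihilator_eq (W := M), h1,
          Submodule.dualAnnihilator_top]
      · rw [Submodule.mem_dualCoannihilator] at hv ⊢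
        intro f hf
        have := hv _ (hM g⁻¹ f hf)
        simpa [Representation.dual_apply, Module.Dual.transpose_apply] using this
  obtain ⟨f, hf0, hf, hspan⟩ := h.exists_cyclic (ρ := ρ.dual) (fun z hz f => by
    ext v
    simp [Representation.dual_apply, Module.Dual.transpose_apply, hZ _ (Z.inv_mem hz)]) hirr
  -- A fixed vector `v` with `f (w v) = 0` is killed by every `r i w f`, since `v` absorbs `(r
  -- i)⁻¹`; these functionals span the dual, so `v = 0`. Hence the fixed space embeds in `k`.
  let ℓ : fixedBy ρ I₁ →ₗ[k] k := (f ∘ₗ ρ w) ∘ₗ (fixedBy ρ I₁).subtype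
  have hℓ : Function.Injective ℓ := by
    rw [← LinearMap.ker_eq_bot, Submodule.eq_bot_iff]
    rintro ⟨v, hv⟩ hv'
    have hv1 : f (ρ w v) = 0 := hv'
    refine Subtype.ext (Module.forall_dual_apply_eq_zero_iff k v |>.1 fun g => ?_)
    have hg : g ∈ Submodule.span k (Set.range fun i => ρ.dual (r i) (ρ.dual w f)) :=
      hspan ▸ Submodule.mem_top
    refine Submodule.span_induction (p := fun g _ => g v = 0) ?_ ?_ ?_ ?_ hg
    · rintro _ ⟨i, rfl⟩
      simp only [Representation.dual_apply, Module.Dual.transpose_apply, LinearMap.comp_apply]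
      rw [mem_fixedBy_iff.1 hv _ (I₁.inv_mem (h.N_le (h.r_mem i))), h.w_inv, hv1]
    · simp
    · intro a b _ _ ha hb
      simp [ha, hb]
    · intro c a _ ha
      simp [ha]
  have hle := LinearMap.finrank_le_finrank_of_injective hℓ
  rw [Module.finrank_self] at hle
  have hnt' : Nontrivial (fixedBy ρ I₁) :=
    ⟨⟨x, mem_fixedBy_iff.2 hx⟩, 0, fun he => hx0 (congrArg Subtype.val he)⟩
  have := Module.finrank_pos (R := k) (M := fixedBy ρ I₁)
  omega

end Rep

end RankOne

/-! ### Rank one groups: recognising twists of the Steinberg representation. -/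

/-- The left regular representation on all functions on a group. -/
def leftFun (k Γ : Type*) [Field k] [Group Γ] : Representation k Γ (Γ → k) where
  toFun g := LinearMap.funLeft k k fun x => g⁻¹ * x
  map_one' := by ext; simp [LinearMap.funLeft]
  map_mul' g g' := by ext; simp [LinearMap.funLeft, mul_assoc]

theorem leftFun_apply {k Γ : Type*} [Field k] [Group Γ] (g : Γ) (φ : Γ → k) (x : Γ) :
    leftFun k Γ g φ x = φ (g⁻¹ * x) := rfl

namespace RankOne

variable {p : ℕ} {Γ ι : Type*} [Group Γ] {I I₁ N Z : Subgroup Γ} {w : Γ} {r : ι → Γ}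

/-- Representatives of `Γ ⧸ I`. -/
def rep (w : Γ) (r : ι → Γ) (a : Option ι) : Γ := a.elim 1 fun i => r i * w

section Group

variable (h : RankOne p I I₁ N Z w r)

include h

theorem rep_exists (g : Γ) : ∃ a, ∃ i ∈ I, g = rep w r a * i := by
  rcases h.bruhat_rep g with hg | ⟨j, i, hi, rfl⟩
  · exact ⟨none, g, hg, (one_mul g).symm⟩
  · exact ⟨some j, i, hi, rfl⟩

theorem mul_w_notMem (j : ι) : r j * w ∉ I := fun hj =>
  h.w_notMem ((I.mul_mem_cancel_left (h.I₁_le (h.N_le (h.r_mem j)))).1 hj)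

theorem rep_unique {a b : Option ι} (hab : (rep w r a)⁻¹ * rep w r b ∈ I) : a = b := by
  match a, b with
  | none, none => rfl
  | none, some j => exact absurd (by simpa [rep] using hab) (h.mul_w_notMem j)
  | some j, none =>
    exact absurd (by simpa [rep] using I.inv_mem hab) (h.mul_w_notMem j)
  | some i, some j =>
    have h1 : w * ((r i)⁻¹ * r j) * w ∈ I := by
      simpa [rep, h.w_inv, mul_assoc] using hab
    rw [h.r_unique i j (h.mem_Z _ (N.mul_mem (N.inv_mem (h.r_mem i)) (h.r_mem j)) h1)]

/-- Left translation by `g` permutes the cosets `Γ ⧸ I`, of which the `rep w r a` are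
representatives. -/
theorem sum_rep {V : Type*} [AddCommGroup V] [Fintype ι] (Φ : Γ → V)
    (hΦ : ∀ g, ∀ i ∈ I, Φ (g * i) = Φ g) (g : Γ) :
    ∑ a, Φ (g * rep w r a) = ∑ a, Φ (rep w r a) := by
  choose j i hi hj using fun a => h.rep_exists (g * rep w r a)
  have hinj : Function.Injective j := by
    intro a b hab
    refine h.rep_unique ?_
    have h1 : (rep w r a)⁻¹ * rep w r b = (g * rep w r a)⁻¹ * (g * rep w r b) := by group
    rw [h1, hj, hj b, hab]
    have h2 : (rep w r (j b) * i a)⁻¹ * (rep w r (j b) * i b) = (i a)⁻¹ * i b := by group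
    rw [h2]
    exact I.mul_mem (I.inv_mem (hi a)) (hi b)
  refine Eq.trans ?_ (Equiv.sum_comp (Equiv.ofBijective j hinj.bijective_of_finite) _)
  refine Finset.sum_congr rfl fun a _ => ?_
  rw [hj, hΦ _ _ (hi a)]
  rfl

end Group

section Steinberg

variable {k V : Type*} [Field k] [AddCommGroup V] [Module k V] {ρ : Representation k Γ V}
  [Fintype ι]

/-- The functions on `Γ` which transform under right translation by `I` through `χ⁻¹`. -/
def equivariantFun (I : Subgroup Γ) (χ : Γ → k) : Submodule k (Γ → k) where
  carrier := {φ | ∀ g, ∀ i ∈ I, φ (g * i) * χ i = φ g}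
  zero_mem' := by simp
  add_mem' := by
    intro a b ha hb g i hi
    simp [add_mul, ha g i hi, hb g i hi]
  smul_mem' := by
    intro c a ha g i hi
    simp [mul_assoc, ha g i hi]

/-- The map from functions on `Γ` to `V` attached to a vector of `V`. -/
noncomputable def orbitSum (ρ : Representation k Γ V) (w : Γ) (r : ι → Γ) (v : V) :
    (Γ → k) →ₗ[k] V :=
  ∑ a, (LinearMap.proj (rep w r a)).smulRight (ρ (rep w r a) v)

theorem orbitSum_apply (v : V) (φ : Γ → k) :
    orbitSum ρ w r v φ = ∑ a, φ (rep w r a) • ρ (rep w r a) v := by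
  simp [orbitSum]

variable (h : RankOne p I I₁ N Z w r) {v : V} {χ : Γ → k}

include h

/-- For `φ` in `Ind χ` the product `φ(x) • ρ x v` depends only on `x I`, so the sum runs over `Γ ⧸
I` and can be translated. This is the map of Frobenius reciprocity. -/
theorem orbitSum_leftFun (hχ : ∀ i ∈ I, ρ i v = χ i • v) {φ : Γ → k}
    (hφ : φ ∈ equivariantFun I χ) (g : Γ) :
    orbitSum ρ w r v (leftFun k Γ g φ) = ρ g (orbitSum ρ w r v φ) := by
  rw [orbitSum_apply, orbitSum_apply, map_sum]
  rw [← h.sum_rep (fun x => leftFun k Γ g φ x • ρ x v) (fun x i hi => ?_) g]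
  · refine Finset.sum_congr rfl fun a _ => ?_
    simp only [leftFun_apply, map_smul, ← rep_mul_apply, inv_mul_cancel_left]
  · simp only [leftFun_apply, rep_mul_apply, hχ i hi, map_smul, smul_smul]
    rw [← mul_assoc, hφ _ i hi]

omit [Fintype ι] h in
theorem leftFun_mem {φ : Γ → k} (hφ : φ ∈ equivariantFun I χ) (g : Γ) :
    leftFun k Γ g φ ∈ equivariantFun I χ := by
  intro x i hi
  rw [leftFun_apply, leftFun_apply, ← mul_assoc, hφ _ i hi]

/-- The kernel of the map from `Ind χ` has at most one dimension if the operator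
`∑ u w` does not kill `v`. -/
theorem eq_zero_of_orbitSum_eq_zero [Fact p.Prime] [CharP k p] (hv0 : v ≠ 0)
    (hv : v ∈ fixedBy ρ I₁) (hχ : ∀ i ∈ I, ρ i v = χ i • v) {d : k} (hd : d ≠ 0)
    (hS : ∑ i, ρ (r i) (ρ w v) = d • v) {φ : Γ → k} (hφ : φ ∈ equivariantFun I χ)
    (hφ0 : orbitSum ρ w r v φ = 0) (hφ1 : φ 1 = 0) : φ = 0 := by
  by_contra hne
  have hfi := h.finiteIndex
  have hχ1 : ∀ i ∈ I₁, χ i = 1 := fun i hi => by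
    have h1 := hχ i (h.I₁_le hi)
    rw [mem_fixedBy_iff.1 hv i hi] at h1
    exact (smul_left_injective k hv0 (by simpa using h1)).symm
  have hχ0 : ∀ i ∈ I, χ i ≠ 0 := fun i hi h0 => hv0 (by
    have h1 := hχ i hi
    rw [h0, zero_smul] at h1
    simpa using congrArg (ρ i⁻¹) h1)
  -- Elements of `M` vanish on all of `I`, which makes `M` stable under `I₁`; if it were nonzero it
  -- would contain a nonzero `I₁`-fixed function `f`.
  let M : Submodule k (Γ → k) := equivariantFun I χ ⊓ LinearMap.ker (orbitSum ρ w r v) ⊓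
    LinearMap.ker (LinearMap.proj 1)
  have hI : ∀ φ ∈ M, ∀ i ∈ I, φ i = 0 := fun φ hφ i hi => by
    have h1 := hφ.1.1 1 i hi
    rw [one_mul, show φ 1 = 0 from hφ.2] at h1
    exact (mul_eq_zero.1 h1).resolve_right (hχ0 i hi)
  obtain ⟨f, hfM, hf0, hf⟩ := exists_fixed_of_pow_mem p (leftFun k Γ) I₁ Z h.pow_mem M
    (by
      intro g hg f hf
      refine ⟨⟨leftFun_mem hf.1.1 g, ?_⟩, ?_⟩
      · have h1 : orbitSum ρ w r v f = 0 := hf.1.2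
        change orbitSum ρ w r v (leftFun k Γ g f) = 0
        rw [h.orbitSum_leftFun hχ hf.1.1, h1, map_zero]
      · change f (g⁻¹ * 1) = 0
        exact hI f hf _ (by simpa using h.I₁_le hg))
    (by
      intro z hz f hf
      ext x
      have h1 : x⁻¹ * z⁻¹ * x ∈ Z := by
        simpa using h.normal.conj_mem _ (Z.inv_mem hz) x⁻¹
      have h2 := hf.1.1 x _ (h.I₁_le (h.Z_le h1))
      rw [hχ1 _ (h.Z_le h1), mul_one] at h2
      rw [leftFun_apply, ← h2]
      congr 1
      group)
    ((Submodule.ne_bot_iff _).2 ⟨φ, ⟨⟨hφ, hφ0⟩, hφ1⟩, hne⟩)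
  have hfw : ∀ j, f (r j * w) = f w := fun j => by
    have h1 := congrFun (hf (r j) (h.N_le (h.r_mem j))) (r j * w)
    rwa [leftFun_apply, inv_mul_cancel_left, eq_comm] at h1
  have hf1 : orbitSum ρ w r v f = 0 := hfM.1.2
  -- `f` is zero on `I` and constant on the points `r j * w`, so its image in `V` is `f w * d` times
  -- `v`.
  have hw0 : f w = 0 := by
    rw [orbitSum_apply, Fintype.sum_option] at hf1
    simp only [rep, Option.elim, hfw, show f 1 = 0 from hfM.2, zero_smul, zero_add,
      rep_mul_apply, ← Finset.smul_sum, hS, smul_smul] at hf1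
    exact (mul_eq_zero.1 ((smul_eq_zero.1 hf1).resolve_right hv0)).resolve_right hd
  refine hf0 (funext fun g => ?_)
  rcases h.bruhat_rep g with hg | ⟨j, i, hi, rfl⟩
  · exact hI f hfM g hg
  · have h1 := hfM.1.1 (r j * w) i hi
    rw [hfw, hw0] at h1
    exact (mul_eq_zero.1 h1).resolve_right (hχ0 i hi)

/-- If the operator `∑ u w` does not kill `v`, then the character `χ` of `I` extends to `Γ`. -/
theorem exists_character [Fact p.Prime] [CharP k p] (hv0 : v ≠ 0)
    (hv : v ∈ fixedBy ρ I₁) (hχ : ∀ i ∈ I, ρ i v = χ i • v) {d : k} (hd : d ≠ 0)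
    (hS : ∑ i, ρ (r i) (ρ w v) = d • v) :
    ∃ φ : Γ →* k, (φ : Γ → k) ∈ equivariantFun I χ ∧ orbitSum ρ w r v φ = 0 := by
  classical
  have hχ0 : ∀ i ∈ I, χ i ≠ 0 := fun i hi h0 => hv0 (by
    have h1 := hχ i hi
    rw [h0, zero_smul] at h1
    simpa using congrArg (ρ i⁻¹) h1)
  have hinj := smul_left_injective k hv0
  have hχmul : ∀ a ∈ I, ∀ b ∈ I, χ (a * b) = χ a * χ b := fun a ha b hb => by
    refine hinj ?_
    simp only
    rw [← hχ _ (I.mul_mem ha hb), rep_mul_apply, hχ b hb, map_smul, hχ a ha, smul_smul, mul_comm]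
  have hχone : χ 1 = 1 := hinj (by
    simp only
    rw [← hχ 1 I.one_mem]; simp)
  choose a i hi hg using h.rep_exists
  have huniq : ∀ b : Option ι, ∀ j ∈ I, a (rep w r b * j) = b ∧ i (rep w r b * j) = j := by
    intro b j hj
    have h1 := hg (rep w r b * j)
    have h2 : b = a (rep w r b * j) := by
      refine h.rep_unique ?_
      have h3 : (rep w r b)⁻¹ * rep w r (a (rep w r b * j)) =
          j * (i (rep w r b * j))⁻¹ := by
        rw [eq_mul_inv_iff_mul_eq, mul_assoc, ← h1]
        group
      rw [h3]
      exact I.mul_mem hj (I.inv_mem (hi _))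
    rw [← h2] at h1
    exact ⟨h2.symm, (mul_left_cancel h1).symm⟩
  -- The values `1` on the trivial coset and `-d⁻¹` on the big cell are chosen so that the image `v
  -- - d⁻¹ • (d • v)` is zero.
  let c : Option ι → k := fun b => b.elim 1 fun _ => -d⁻¹
  let φ : Γ → k := fun g => c (a g) * (χ (i g))⁻¹
  have hφval : ∀ b : Option ι, ∀ j ∈ I, φ (rep w r b * j) = c b * (χ j)⁻¹ := fun b j hj => by
    simp only [φ, (huniq b j hj).1, (huniq b j hj).2]
  have hφ : φ ∈ equivariantFun I χ := by
    intro g j hj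
    have h1 : g * j = rep w r (a g) * (i g * j) := by rw [← mul_assoc, ← hg]
    change φ (g * j) * χ j = c (a g) * (χ (i g))⁻¹
    rw [h1, hφval _ _ (I.mul_mem (hi g) hj), hχmul _ (hi g) _ hj]
    have := hχ0 j hj
    have := hχ0 _ (hi g)
    field_simp
  have hφrep : ∀ b, φ (rep w r b) = c b := fun b => by
    have := hφval b 1 I.one_mem
    simpa [hχone] using this
  have hφ0 : orbitSum ρ w r v φ = 0 := by
    rw [orbitSum_apply, Fintype.sum_option]
    simp only [hφrep]
    simp only [c, rep, Option.elim, rep_mul_apply, ← Finset.smul_sum, hS, smul_smul]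
    simp [hd]
  have hφ1 : φ 1 = 1 := hφrep none
  refine ⟨⟨⟨φ, hφ1⟩, fun g x => ?_⟩, hφ, hφ0⟩
  -- The translate of `φ` minus `φ g • φ` lies in the kernel and vanishes at `1`, hence is zero.
  -- This says `φ (g x) = φ g φ x`.
  have h1 := h.eq_zero_of_orbitSum_eq_zero hv0 hv hχ hd hS
    (φ := leftFun k Γ g⁻¹ φ - φ g • φ)
    (Submodule.sub_mem _ (leftFun_mem hφ _) (Submodule.smul_mem _ _ hφ))
    (by rw [map_sub, h.orbitSum_leftFun hχ hφ, map_smul, hφ0]; simp)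
    (by simp [leftFun_apply, hφ1])
  have h2 := congrFun h1 x
  simpa [leftFun_apply, sub_eq_zero] using h2

/-- An irreducible representation on whose `I₁`-fixed line `∑ u w` acts by a nonzero scalar is a
twist of the Steinberg representation. -/
theorem exists_equiv_twist [Fact p.Prime] [CharP k p] (hρ : ρ.IsIrreducible) (hv0 : v ≠ 0)
    (hv : v ∈ fixedBy ρ I₁) (hI : ∀ i ∈ I, ∃ c : k, ρ i v = c • v) {d : k} (hd : d ≠ 0)
    (hS : ∑ i, ρ (r i) (ρ w v) = d • v) :
    ∃ ψ : Γ →* kˣ, Z ≤ ψ.ker ∧ Nonempty (ρ.Equiv (twist ψ (funModConst k I))) := by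
  choose! χ hχ using hI
  obtain ⟨φ, hφ, hφ0⟩ := h.exists_character hv0 hv hχ hd hS
  have hφI : ∀ i ∈ I, φ i * χ i = 1 := fun i hi => by
    simpa using hφ 1 i hi
  have hne : ∀ g, φ g ≠ 0 := fun g h0 => by
    have h1 := map_mul φ g g⁻¹
    simp [h0] at h1
  -- Multiplication by the character `φ`, which is `χ⁻¹` on `I`, identifies functions on `Γ ⧸ I`
  -- with `Ind χ` up to a twist; the constants go to the kernel of `orbitSum`.
  let A : (Γ ⧸ I → k) →ₗ[k] (Γ → k) :=
    { toFun := fun f g => f (g : Γ ⧸ I) * φ g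
      map_add' := fun f f' => by ext; simp [add_mul]
      map_smul' := fun c f => by ext; simp [mul_assoc] }
  have hA : ∀ f, A f ∈ equivariantFun I χ := fun f g i hi => by
    have h1 : ((g * i : Γ) : Γ ⧸ I) = g := by
      rw [QuotientGroup.eq]
      simpa using hi
    change f ((g * i : Γ) : Γ ⧸ I) * φ (g * i) * χ i = f g * φ g
    rw [h1, map_mul, mul_assoc, mul_assoc, hφI i hi, mul_one]
  let T := orbitSum ρ w r v ∘ₗ A
  have hT : ∀ g f, T (funRep k I g f) = φ g • ρ g (T f) := fun g f => by
    have h1 : A (funRep k I g f) = φ g • leftFun k Γ g (A f) := by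
      ext x
      change f (g⁻¹ • (x : Γ ⧸ I)) * φ x = φ g * (f ((g⁻¹ * x : Γ) : Γ ⧸ I) * φ (g⁻¹ * x))
      have h2 : φ x = φ g * φ (g⁻¹ * x) := by rw [← map_mul, mul_inv_cancel_left]
      rw [h2]
      change f ((g⁻¹ * x : Γ) : Γ ⧸ I) * _ = _
      ring
    simp only [T, LinearMap.comp_apply, h1, map_smul, h.orbitSum_leftFun hχ (hA f)]
  have hker : LinearMap.ker T = constFun k I := by
    apply le_antisymm
    · intro f hf
      have h0 : orbitSum ρ w r v (A f) = 0 := hf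
      have h1 := h.eq_zero_of_orbitSum_eq_zero hv0 hv hχ hd hS
        (φ := A f - f ((1 : Γ) : Γ ⧸ I) • (φ : Γ → k))
        (Submodule.sub_mem _ (hA f) (Submodule.smul_mem _ _ hφ))
        (by rw [map_sub, map_smul, hφ0, h0]; simp)
        (by simp [A])
      rw [constFun, Submodule.mem_span_singleton]
      refine ⟨f ((1 : Γ) : Γ ⧸ I), funext fun q => ?_⟩
      obtain ⟨g, rfl⟩ := QuotientGroup.mk_surjective q
      have h2 : f (g : Γ ⧸ I) * φ g - f ((1 : Γ) : Γ ⧸ I) * φ g = 0 := congrFun h1 g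
      rw [← sub_mul] at h2
      simpa using (sub_eq_zero.1 ((mul_eq_zero.1 h2).resolve_right (hne g))).symm
    · rw [constFun, Submodule.span_le]
      rintro _ rfl
      have h1 : A (fun _ => 1) = φ := by
        ext g
        simp [A]
      change orbitSum ρ w r v (A fun _ => 1) = 0
      rw [h1, hφ0]
  have hsurj : Function.Surjective T := by
    classical
    rw [← LinearMap.range_eq_top]
    refine irreducible_eq_top hρ _ ?_ ((Submodule.ne_bot_iff _).2
      ⟨v, ⟨fun q => if q = ((1 : Γ) : Γ ⧸ I) then 1 else 0, ?_⟩, hv0⟩)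
    · rintro g _ ⟨f, rfl⟩
      refine ⟨(φ g)⁻¹ • funRep k I g f, ?_⟩
      rw [map_smul, hT, smul_smul, inv_mul_cancel₀ (hne g), one_smul]
    · change orbitSum ρ w r v _ = v
      rw [orbitSum_apply, Finset.sum_eq_single none]
      · simp [A, rep]
      · intro b _ hb
        have h1 : ¬ ((rep w r b : Γ) : Γ ⧸ I) = ((1 : Γ) : Γ ⧸ I) := by
          intro he
          exact hb (h.rep_unique (b := none) (QuotientGroup.eq.1 he))
        simp [A, h1]
      · simp
  -- Since `T` intertwines only up to the factor `φ g`, the twisting character is the inverse of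
  -- `φ`.
  let ψ : Γ →* kˣ := (φ.toHomUnits)⁻¹
  have hψ : ∀ g, ((ψ g : kˣ) : k) = (φ g)⁻¹ := fun g => by
    simp [ψ]
  let e := (Submodule.quotEquivOfEq _ _ hker.symm).trans (T.quotKerEquivOfSurjective hsurj)
  have he : ∀ f, e (Submodule.Quotient.mk f) = T f := fun f => rfl
  refine ⟨ψ, fun z hz => ?_, ⟨(Representation.Equiv.mk (ρ := twist ψ (funModConst k I)) (σ := ρ)
    e fun g => ?_).symm⟩⟩
  · rw [MonoidHom.mem_ker]
    refine Units.ext ?_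
    rw [hψ]
    have h1 := hφI z (h.I₁_le (h.Z_le hz))
    have h2 := hχ z (h.I₁_le (h.Z_le hz))
    rw [mem_fixedBy_iff.1 hv z (h.Z_le hz)] at h2
    have h3 : (1 : k) = χ z := smul_left_injective k hv0 (by simpa using h2)
    rw [← h3, mul_one] at h1
    rw [h1]
    simp
  · refine LinearMap.ext fun f => ?_
    obtain ⟨f, rfl⟩ := Submodule.Quotient.mk_surjective _ f
    change e ((ψ g : k) • Submodule.Quotient.mk (funRep k I g f)) = ρ g (e _)
    rw [map_smul, he, he, hT, smul_smul, hψ, inv_mul_cancel₀ (hne g), one_smul]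

/-- The scalar by which `∑ u w` acts on the `I₁`-fixed line of a twist of the Steinberg
representation. -/
theorem sum_eq_of_equiv_twist [Fact p.Prime] [CharP k p] (hZ : ∀ z ∈ Z, ∀ x, ρ z x = x)
    (hline : Module.finrank k (fixedBy ρ I₁) = 1) (hv0 : v ≠ 0) (hv : v ∈ fixedBy ρ I₁)
    {ψ : Γ →* kˣ} (e : ρ.Equiv (twist ψ (funModConst k I))) {n n' n'' t : Γ} (hn : n ∈ I₁)
    (hn' : n' ∈ I₁) (hn'' : n'' ∈ I₁) (ht : t ∈ I) (hrel : n * w = w * n' * w * t * n'') {c : k}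
    (hc : ρ t v = c • v) : ∑ i, ρ (r i) (ρ w v) = (-c) • v := by
  classical
  let δ : Γ → (Γ ⧸ I → k) := fun g q => if q = (g : Γ ⧸ I) then 1 else 0
  have hδ : ∀ g x, funRep k I g (δ x) = δ (g * x) := fun g x => by
    ext q
    change (if g⁻¹ • q = (x : Γ ⧸ I) then (1 : k) else 0) = if q = ((g * x : Γ) : Γ ⧸ I) then 1 else 0
    simp only [inv_smul_eq_iff]
    rfl
  have hδI : ∀ g, ∀ i ∈ I, δ (g * i) = δ g := fun g i hi => by
    have h1 : ((g * i : Γ) : Γ ⧸ I) = g := by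
      rw [QuotientGroup.eq]
      simpa using hi
    simp only [δ, h1]
  let mk : (Γ ⧸ I → k) →ₗ[k] ((Γ ⧸ I → k) ⧸ constFun k I) := (constFun k I).mkQ
  -- The class of the indicator of the trivial coset is an explicit `I₁`-fixed vector, hence
  -- proportional to `v` by `hline`.
  let x := e.symm (mk (δ 1))
  have hx : ∀ g, ρ g x = (ψ g : k) • e.symm (mk (δ g)) := fun g => by
    have h1 := Representation.IntertwiningMap.isIntertwining _ _ e.symm.toIntertwiningMap g (mk (δ 1))
    change e.symm ((ψ g : k) • mk (funRep k I g (δ 1))) = ρ g x at h1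
    rw [← h1, hδ, mul_one, map_smul]
  have hw1 : ¬ ((1 : Γ) : Γ ⧸ I) = ((w : Γ) : Γ ⧸ I) := fun he =>
    h.w_notMem (by simpa using QuotientGroup.eq.1 he)
  have hx0 : x ≠ 0 := by
    intro h0
    have h1 : mk (δ 1) = 0 := by
      have := congrArg e h0
      simpa [x] using this
    rw [Submodule.mkQ_apply, Submodule.Quotient.mk_eq_zero, constFun,
      Submodule.mem_span_singleton] at h1
    obtain ⟨a, ha⟩ := h1
    have h2 := congrFun ha ((1 : Γ) : Γ ⧸ I)
    have h3 := congrFun ha ((w : Γ) : Γ ⧸ I)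
    simp only [δ, Pi.smul_apply, smul_eq_mul, mul_one, if_true] at h2 h3
    rw [if_neg (Ne.symm hw1)] at h3
    exact one_ne_zero (h2.symm.trans h3)
  have hxI : ∀ i ∈ I, ρ i x = (ψ i : k) • x := fun i hi => by
    rw [hx, ← one_mul i, hδI 1 i hi, one_mul]
  have hψZ : ∀ z ∈ Z, ψ z = 1 := fun z hz => by
    have h1 := hxI z (h.I₁_le (h.Z_le hz))
    rw [hZ z hz] at h1
    exact Units.ext (smul_left_injective k hx0 (by simpa using h1.symm))
  -- An element of `I₁` has a `p`-power in `Z`, and in characteristic `p` the only root of unity of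
  -- `p`-power order is `1`.
  have hψI₁ : ∀ u ∈ I₁, ψ u = 1 := fun u hu => by
    obtain ⟨m, hm⟩ := h.pow_mem u hu
    have h1 := hψZ _ hm
    rw [map_pow] at h1
    have h2 : ((ψ u : kˣ) : k) ^ p ^ m = 1 := by rw [← Units.val_pow_eq_pow_val, h1]; rfl
    have h3 : ((ψ u : kˣ) : k) - 1 = 0 := by
      refine eq_zero_of_pow_eq_zero (n := p ^ m) ?_
      rw [sub_pow_char_pow, h2, one_pow, sub_self]
    exact Units.ext (sub_eq_zero.1 h3)
  have hxmem : x ∈ fixedBy ρ I₁ := mem_fixedBy_iff.2 fun u hu => by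
    rw [hxI u (h.I₁_le hu), hψI₁ u hu]
    simp
  -- Applied to `hrel`, the character gives `ψ w = (ψ w)² ψ t`, and `w` is an involution.
  have hψw : ψ w = ψ t := by
    have h1 := congrArg ψ hrel
    have h2 : ψ w * ψ w = 1 := by rw [← map_mul, h.w_mul_w, map_one]
    simp only [map_mul, hψI₁ _ hn, hψI₁ _ hn', hψI₁ _ hn'', one_mul, mul_one, h2] at h1
    exact h1
  -- The cosets `r i w I` are exactly those different from `I`, so modulo constants the sum over the
  -- big cell is `-δ 1`.
  have hsum : ∑ i, δ (r i * w) = (fun _ => 1) - δ 1 := by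
    ext q
    obtain ⟨g, rfl⟩ := QuotientGroup.mk_surjective q
    obtain ⟨a, i, hi, rfl⟩ := h.rep_exists g
    have h1 : ((rep w r a * i : Γ) : Γ ⧸ I) = ((rep w r a : Γ) : Γ ⧸ I) := by
      rw [QuotientGroup.eq]
      simpa using hi
    have h2 : ∀ b, (((rep w r a : Γ) : Γ ⧸ I) = ((rep w r b : Γ) : Γ ⧸ I)) ↔ a = b := fun b =>
      ⟨fun he => h.rep_unique (QuotientGroup.eq.1 he), fun he => he ▸ rfl⟩
    have h3 : ∑ b, δ (rep w r b) ((rep w r a : Γ) : Γ ⧸ I) = 1 := by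
      simp only [δ, h2]
      simp
    rw [Fintype.sum_option] at h3
    rw [Finset.sum_apply, h1, Pi.sub_apply, eq_sub_iff_add_eq, add_comm]
    exact h3
  have hxS : ∑ i, ρ (r i) (ρ w x) = (-(ψ t : k)) • x := by
    have h1 : ∀ i, ρ (r i) (ρ w x) = (ψ t : k) • e.symm (mk (δ (r i * w))) := fun i => by
      rw [← rep_mul_apply, hx, map_mul, hψI₁ _ (h.N_le (h.r_mem i)), one_mul, hψw]
    simp only [h1]
    rw [← Finset.smul_sum, ← map_sum, ← map_sum, hsum, map_sub]
    have h2 : mk (fun _ => 1) = 0 := by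
      rw [Submodule.mkQ_apply, Submodule.Quotient.mk_eq_zero]
      exact Submodule.subset_span rfl
    rw [h2, zero_sub, map_neg, smul_neg, neg_smul]
  obtain ⟨a, ha⟩ := (finrank_eq_one_iff_of_nonzero' (⟨x, hxmem⟩ : fixedBy ρ I₁)
    (fun h0 => hx0 (congrArg Subtype.val h0))).1 hline ⟨v, hv⟩
  have ha' : a • x = v := congrArg Subtype.val ha
  have hct : c = ψ t := by
    refine smul_left_injective k hv0 ?_
    simp only
    rw [← hc, ← ha', map_smul, hxI t ht, smul_comm]
  rw [hct, ← ha']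
  simp only [map_smul, ← Finset.smul_sum, hxS]
  rw [smul_comm]

end Steinberg

end RankOne

namespace Datum

/-! ### Explicit elements of `U(2,1)` and the relations between them. -/

section Elements

set_option linter.unusedSectionVars false

variable {F E : Type*} [Field F] [Field E] [ValuativeRel E] [Algebra F E] (D : Datum F E)

theorem mat_injective : Function.Injective D.mat := fun _ _ h =>
  Subtype.ext (Units.ext h)

variable [ValuativeRel F] [IsUnramifiedQuadratic F E]

theorem conj_conj (x : E) : D.conj (D.conj x) = x := aut_aut D.conj x

/-- The element `n(x, y)` of `G`. -/
noncomputable def nEl (x y : E) (h : x * D.conj x + y + D.conj y = 0) : D.G :=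
  D.ofMatrix (D.nMat x y) (by
    ext i j
    fin_cases i <;> fin_cases j <;>
      simp [βmat, nMat, Matrix.mul_apply, Fin.sum_univ_three, D.conj_conj]
    linear_combination h)

/-- The element `n'(x, y)` of `G`. -/
noncomputable def nEl' (x y : E) (h : x * D.conj x + y + D.conj y = 0) : D.G :=
  D.ofMatrix (D.nMat' x y) (by
    ext i j
    fin_cases i <;> fin_cases j <;>
      simp [βmat, nMat', Matrix.mul_apply, Fin.sum_univ_three, D.conj_conj]
    linear_combination h)

/-- The element `diag(a, b, ā⁻¹)` of `G`. -/
noncomputable def dEl (a b : E) (ha : a ≠ 0) (hb : b * D.conj b = 1) : D.G :=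
  D.ofMatrix (!![a, 0, 0; 0, b, 0; 0, 0, (D.conj a)⁻¹]) (by
    have h1 : D.conj a ≠ 0 := by simpa using ha
    ext i j
    fin_cases i <;> fin_cases j <;>
      simp [βmat, Matrix.mul_apply, Fin.sum_univ_three, D.conj_conj, ha, h1, hb])

/-- The antidiagonal element with entries `c⁻¹`, `1`, `c` of `G`. -/
noncomputable def antiEl (c : E) (hc : D.conj c = c) (hc0 : c ≠ 0) : D.G :=
  D.ofMatrix (!![0, 0, c⁻¹; 0, 1, 0; c, 0, 0]) (by
    ext i j
    fin_cases i <;> fin_cases j <;>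
      simp [βmat, Matrix.mul_apply, Fin.sum_univ_three, hc, hc0])

@[simp] theorem mat_nEl (x y : E) (h) : D.mat (D.nEl x y h) = D.nMat x y := rfl
@[simp] theorem mat_nEl' (x y : E) (h) : D.mat (D.nEl' x y h) = D.nMat' x y := rfl
@[simp] theorem mat_dEl (a b : E) (ha hb) :
    D.mat (D.dEl a b ha hb) = !![a, 0, 0; 0, b, 0; 0, 0, (D.conj a)⁻¹] := rfl
@[simp] theorem mat_antiEl (c : E) (hc hc0) :
    D.mat (D.antiEl c hc hc0) = !![0, 0, c⁻¹; 0, 1, 0; c, 0, 0] := rfl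

theorem norm_conj {x y : E} (h : x * D.conj x + y + D.conj y = 0) :
    -x * D.conj (-x) + D.conj y + D.conj (D.conj y) = 0 := by
  simp only [map_neg, D.conj_conj]
  linear_combination h

theorem nEl_inv {x y : E} (h) : (D.nEl x y h)⁻¹ = D.nEl (-x) (D.conj y) (D.norm_conj h) := by
  apply D.mat_injective
  ext i j
  rw [mat_inv_apply]
  fin_cases i <;> fin_cases j <;> simp [nMat, D.conj_conj]

theorem nEl'_inv {x y : E} (h) :
    (D.nEl' x y h)⁻¹ = D.nEl' (-x) (D.conj y) (D.norm_conj h) := by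
  apply D.mat_injective
  ext i j
  rw [mat_inv_apply]
  fin_cases i <;> fin_cases j <;> simp [nMat', D.conj_conj]

theorem antiEl_mul_self (c : E) (hc hc0) : D.antiEl c hc hc0 * D.antiEl c hc hc0 = 1 := by
  apply D.mat_injective
  ext i j
  fin_cases i <;> fin_cases j <;> simp [Matrix.mul_apply, Fin.sum_univ_three, hc0]

theorem antiEl_inv (c : E) (hc hc0) : (D.antiEl c hc hc0)⁻¹ = D.antiEl c hc hc0 :=
  inv_eq_of_mul_eq_one_left (D.antiEl_mul_self c hc hc0)

theorem dEl_mul {a b a' b' : E} (ha hb ha' hb') :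
    D.dEl a b ha hb * D.dEl a' b' ha' hb' = D.dEl (a * a') (b * b') (mul_ne_zero ha ha')
      (by rw [map_mul]; linear_combination b' * D.conj b' * hb + hb') := by
  apply D.mat_injective
  ext i j
  fin_cases i <;> fin_cases j <;> simp [Matrix.mul_apply, Fin.sum_univ_three, mul_comm]

theorem dEl_mul_nEl {a b x y : E} (ha hb h) :
    D.dEl a b ha hb * D.nEl x y h = D.nEl (a * D.conj b * x) (a * D.conj a * y)
      (by simp only [map_mul, D.conj_conj]; linear_combination a * D.conj a * h +
            a * D.conj a * x * D.conj x * hb) * D.dEl a b ha hb := by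
  have h1 : D.conj a ≠ 0 := by simpa using ha
  apply D.mat_injective
  ext i j
  fin_cases i <;> fin_cases j <;>
    simp [Matrix.mul_apply, Fin.sum_univ_three, nMat, D.conj_conj]
  · linear_combination (-a * x) * hb
  · field_simp
  · field_simp

theorem dEl_mul_nEl' {a b x y : E} (ha hb h) :
    D.dEl a b ha hb * D.nEl' x y h = D.nEl' (a⁻¹ * b * x) ((a * D.conj a)⁻¹ * y)
      (by
        have h1 : D.conj a ≠ 0 := by simpa using ha
        simp only [map_mul, map_inv₀, D.conj_conj]
        field_simp
        linear_combination h + x * D.conj x * hb) * D.dEl a b ha hb := by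
  have h1 : D.conj a ≠ 0 := by simpa using ha
  apply D.mat_injective
  ext i j
  fin_cases i <;> fin_cases j <;>
    simp [Matrix.mul_apply, Fin.sum_univ_three, nMat']
  · field_simp
  · field_simp
  · linear_combination (-(D.conj a)⁻¹ * D.conj x) * hb

theorem antiEl_mul_nEl {c x y : E} (hc hc0 h) :
    D.antiEl c hc hc0 * D.nEl x y h = D.nEl' (-c * D.conj x) (c ^ 2 * y)
      (by simp only [map_mul, map_neg, map_pow, hc, D.conj_conj]; linear_combination c ^ 2 * h) *
      D.antiEl c hc hc0 := by
  apply D.mat_injective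
  ext i j
  fin_cases i <;> fin_cases j <;>
    simp [Matrix.mul_apply, Fin.sum_univ_three, nMat, nMat', D.conj_conj, hc]
  all_goals field_simp

theorem antiEl_mul_nEl' {c x y : E} (hc hc0 h) :
    D.antiEl c hc hc0 * D.nEl' x y h = D.nEl (-c⁻¹ * D.conj x) (c⁻¹ ^ 2 * y)
      (by simp only [map_mul, map_neg, map_pow, map_inv₀, hc, D.conj_conj]
          linear_combination c⁻¹ ^ 2 * h) *
      D.antiEl c hc hc0 := by
  apply D.mat_injective
  ext i j
  fin_cases i <;> fin_cases j <;>
    simp [Matrix.mul_apply, Fin.sum_univ_three, nMat, nMat', D.conj_conj, hc]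
  all_goals field_simp

theorem antiEl_mul_dEl {c a b : E} (hc hc0 ha hb) :
    D.antiEl c hc hc0 * D.dEl a b ha hb = D.dEl (D.conj a)⁻¹ b (by simpa using ha) hb *
      D.antiEl c hc hc0 := by
  apply D.mat_injective
  ext i j
  fin_cases i <;> fin_cases j <;>
    simp [Matrix.mul_apply, Fin.sum_univ_three, D.conj_conj, mul_comm]

/-- The middle entry of `h(y)`, in the form required by `dEl`. -/
theorem norm_unit {y : E} (hy : y ≠ 0) : -D.conj y * y⁻¹ * D.conj (-D.conj y * y⁻¹) = 1 := by
  have h1 : D.conj y ≠ 0 := by simpa using hy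
  simp only [map_neg, map_mul, map_inv₀, D.conj_conj]
  field_simp

/-- The relation in the rank one group generated by `N` and the antidiagonal element. -/
theorem nEl_mul_antiEl {c x y : E} (hc hc0 h) (hy : y ≠ 0) :
    D.nEl x y h * D.antiEl c hc hc0 =
      D.nEl' (-D.conj x / y) (1 / y)
        (by
          have h1 : D.conj y ≠ 0 := by simpa using hy
          simp only [map_div₀, map_neg, map_one, D.conj_conj]
          field_simp
          linear_combination h) *
      D.dEl (c * y) (-D.conj (c * y) * (c * y)⁻¹) (mul_ne_zero hc0 hy)
        (D.norm_unit (mul_ne_zero hc0 hy)) *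
      D.nEl (x / (c * y)) (1 / (c ^ 2 * y))
        (by
          have h1 : D.conj y ≠ 0 := by simpa using hy
          simp only [map_div₀, map_mul, map_pow, hc, map_one]
          field_simp
          linear_combination h) := by
  have h1 : D.conj y ≠ 0 := by simpa using hy
  apply D.mat_injective
  ext i j
  fin_cases i <;> fin_cases j <;>
    simp [Matrix.mul_apply, Fin.sum_univ_three, nMat, nMat', D.conj_conj, hc]
  all_goals field_simp
  · linear_combination h
  · ring
  · ring
  · linear_combination -h

/-- The relation in the rank one group generated by `N'` and the antidiagonal element. -/
theorem nEl'_mul_antiEl {c x y : E} (hc hc0 h) (hy : y ≠ 0) :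
    D.nEl' x y h * D.antiEl c hc hc0 =
      D.nEl (-D.conj x / D.conj y) (1 / y)
        (by
          have h1 : D.conj y ≠ 0 := by simpa using hy
          simp only [map_div₀, map_neg, map_one, D.conj_conj]
          field_simp
          linear_combination h) *
      D.dEl (c / D.conj y) (-D.conj (c / D.conj y) * (c / D.conj y)⁻¹)
        (div_ne_zero hc0 (by simpa using hy))
        (D.norm_unit (div_ne_zero hc0 (by simpa using hy))) *
      D.nEl' (c * x / D.conj y) (c ^ 2 / y)
        (by
          have h1 : D.conj y ≠ 0 := by simpa using hy
          simp only [map_div₀, map_mul, map_pow, hc, D.conj_conj]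
          field_simp
          linear_combination c ^ 2 * h) := by
  have h1 : D.conj y ≠ 0 := by simpa using hy
  apply D.mat_injective
  ext i j
  fin_cases i <;> fin_cases j <;>
    simp [Matrix.mul_apply, Fin.sum_univ_three, nMat, nMat', D.conj_conj, hc]
  all_goals field_simp
  · linear_combination -c * h
  · ring
  · ring
  · linear_combination h

end Elements


/-! ### Fractional ideals of `E` and column reduction of unitary matrices. -/

section Lattice

set_option linter.unusedSectionVars false

variable {F E : Type*} [Field F] [ValuativeRel F] [TopologicalSpace F]
  [IsNonarchimedeanLocalField F] [Field E] [ValuativeRel E] [TopologicalSpace E]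
  [IsNonarchimedeanLocalField E] [Algebra F E] [ValuativeExtension F E]
  [IsUnramifiedQuadratic F E] {D : Datum F E}

theorem InP.sub {k : ℤ} {x y : E} (hx : D.InP k x) (hy : D.InP k y) : D.InP k (x - y) := by
  rw [sub_eq_add_neg]
  exact hx.add hy.neg

theorem InP_conj_iff {k : ℤ} {x : E} : D.InP k (D.conj x) ↔ D.InP k x := by
  rw [InP, InP, valuation_aut]

theorem InP_zpow (k : ℤ) : D.InP k (D.ϖ ^ k) := D.InP_of_eq rfl

theorem InP_zpow_mul_iff {k j : ℤ} {x : E} : D.InP k (D.ϖ ^ j * x) ↔ D.InP (k - j) x := by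
  constructor
  · intro h
    have h1 := (InP_zpow (D := D) (-j)).mul h
    rw [← mul_assoc, ← zpow_add₀ D.ϖ_ne_zero, neg_add_cancel, zpow_zero, one_mul] at h1
    convert h1 using 1
    ring
  · intro h
    convert (InP_zpow (D := D) j).mul h using 1
    ring

/-- Discreteness of the valuation: `ϖᵏ x⁻¹` has valuation less than `1`, hence lies in `𝔭`. The
gained `1` in the exponent is what makes the later estimates sharp. -/
theorem InP_of_not_InP {k : ℤ} {x : E} (h : ¬ D.InP k x) : D.InP (1 - k) x⁻¹ := by
  rw [InP, not_le] at h
  have hp := D.val_ϖ_pos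
  have hx : 0 < valuation E x := lt_of_le_of_lt zero_le h
  have h1 : valuation E (D.ϖ ^ k * x⁻¹) < 1 := by
    rw [map_mul, map_inv₀, map_zpow₀, ← div_eq_mul_inv]
    exact (div_lt_one₀ hx).2 h
  exact InP_zpow_mul_iff.1 (D.InP_of_val_lt_one h1)

theorem not_InP_zpow {k l : ℤ} (h : k < l) : ¬ D.InP l (D.ϖ ^ k) := by
  rw [InP, map_zpow₀, not_le]
  exact (zpow_lt_zpow_iff_right_of_lt_one₀ D.val_ϖ_pos D.val_ϖ_lt_one).2 h

theorem InP_mul_iff_of_val_eq_one {k : ℤ} {a x : E} (ha : valuation E a = 1) :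
    D.InP k (a * x) ↔ D.InP k x := by
  rw [InP, InP, map_mul, ha, one_mul]

theorem val_eq_one_of_mul {x y : E} (hx : D.InP 0 x) (hy : D.InP 0 y) (h : D.InP 1 (x * y - 1)) :
    valuation E x = 1 := by
  have h1 : valuation E (x * y) = 1 := by
    have h2 : valuation E (x * y - 1) < valuation E (1 : E) := by
      rw [map_one]
      exact lt_of_le_of_lt h (by simpa using D.val_ϖ_lt_one)
    have h3 := Valuation.map_add_eq_of_lt_right (valuation E) h2
    rwa [sub_add_cancel, map_one] at h3
  rw [InP, zpow_zero] at hx hy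
  rw [map_mul] at h1
  exact le_antisymm hx (h1 ▸ mul_le_of_le_one_right' hy)

theorem val_ne_zero_of_eq_one {x : E} (h : valuation E x = 1) : x ≠ 0 := by
  rintro rfl
  simp at h

theorem exists_zpow_mul {x : E} (hx : x ≠ 0) : ∃ (j : ℤ) (u : E), valuation E u = 1 ∧
    x = D.ϖ ^ j * u := by
  obtain ⟨hϖ, hirr⟩ := D.isUniformizer
  have key : ∀ y : E, y ≠ 0 → valuation E y ≤ 1 → ∃ (j : ℕ) (u : E), valuation E u = 1 ∧
      y = D.ϖ ^ j * u := by
    intro y hy0 hy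
    obtain ⟨n, u, hu⟩ := IsDiscreteValuationRing.eq_unit_mul_pow_irreducible
      (x := (⟨y, hy⟩ : 𝒪[E])) (fun h => hy0 (congrArg Subtype.val h)) hirr
    have h1 := congrArg Subtype.val hu
    refine ⟨n, ((u : 𝒪[E]) : E), ?_, ?_⟩
    · have h2 : ((u : 𝒪[E]) : E) * (((u⁻¹ : (𝒪[E])ˣ) : 𝒪[E]) : E) = 1 := by
        rw [← Subring.coe_mul, Units.mul_inv]
        simp
      refine val_eq_one_of_mul (D := D) (y := (((u⁻¹ : (𝒪[E])ˣ) : 𝒪[E]) : E)) ?_ ?_ ?_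
      · rw [InP, zpow_zero]; exact (u : 𝒪[E]).2
      · rw [InP, zpow_zero]; exact ((u⁻¹ : (𝒪[E])ˣ) : 𝒪[E]).2
      · rw [h2, sub_self]; exact InP.zero
    · simpa [mul_comm] using h1
  rcases le_total (valuation E x) 1 with h | h
  · obtain ⟨j, u, hu, h1⟩ := key x hx h
    exact ⟨j, u, hu, by simpa using h1⟩
  · obtain ⟨j, u, hu, h1⟩ := key x⁻¹ (inv_ne_zero hx) (by
      rw [map_inv₀]; exact inv_le_one_of_one_le₀ h)
    refine ⟨-j, u⁻¹, by rw [map_inv₀, hu, inv_one], ?_⟩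
    rw [← inv_inv x, h1, mul_inv, zpow_neg, zpow_natCast]

/-- If `x x̄ + y + ȳ = 0` and `y ∈ 𝔭ᵏ`, then `x ∈ 𝔭ˡ` as soon as `2 l ≤ k + 1`. -/
theorem InP_of_norm {k l : ℤ} {x y : E} (h : x * D.conj x + y + D.conj y = 0) (hy : D.InP k y)
    (hl : 2 * l ≤ k + 1) : D.InP l x := by
  refine D.val_le_of_sq ?_
  have := D.InP_cross h hy h hy
  rw [InP, map_mul, valuation_aut, ← map_mul] at this
  exact InP.mono this (by omega)

/-- If `x x̄ ∈ 𝔭ᵏ` then `x ∈ 𝔭ˡ` as soon as `2 l ≤ k + 1`. -/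
theorem InP_of_mul_conj {k l : ℤ} {x : E} (h : D.InP k (x * D.conj x)) (hl : 2 * l ≤ k + 1) :
    D.InP l x := by
  refine D.val_le_of_sq ?_
  rw [InP, map_mul, valuation_aut, ← map_mul] at h
  exact InP.mono h (by omega)

section Relations

variable (D)

/-- The entries of `g g⁻¹ = 1`, where `g⁻¹` is the conjugate of `g` reflected in the antidiagonal.
With `i = 2` and `l = 0` it says that the last row is isotropic; `col_rel` does the same for
columns. -/
theorem row_rel (g : D.G) (i l : Fin 3) :
    D.mat g i 0 * D.conj (D.mat g l.rev 2) + D.mat g i 1 * D.conj (D.mat g l.rev 1) +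
      D.mat g i 2 * D.conj (D.mat g l.rev 0) = if i = l then 1 else 0 := by
  have h1 : D.mat g * D.mat g⁻¹ = 1 := by rw [← mat_mul, mul_inv_cancel, mat_one]
  have h2 := congrFun (congrFun h1 i) l
  rw [Matrix.mul_apply, Fin.sum_univ_three, Matrix.one_apply] at h2
  simp only [mat_inv_apply] at h2
  exact h2

theorem col_rel (g : D.G) (i l : Fin 3) :
    D.conj (D.mat g 2 i.rev) * D.mat g 0 l + D.conj (D.mat g 1 i.rev) * D.mat g 1 l +
      D.conj (D.mat g 0 i.rev) * D.mat g 2 l = if i = l then 1 else 0 := by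
  have h1 : D.mat g⁻¹ * D.mat g = 1 := by rw [← mat_mul, inv_mul_cancel, mat_one]
  have h2 := congrFun (congrFun h1 i) l
  rw [Matrix.mul_apply, Fin.sum_univ_three, Matrix.one_apply] at h2
  simp only [mat_inv_apply] at h2
  exact h2

/-- The first column of `g` is isotropic; divided by the norm of its top entry, this is the equation
defining `n'` with parameters the quotients of the column, and that element clears the column below
the top. -/
theorem exists_eq_nEl'_mul (g : D.G) (h0 : D.mat g 0 0 ≠ 0) :
    ∃ x h g', g = D.nEl' x (D.mat g 2 0 / D.mat g 0 0) h * g' ∧ D.mat g' 1 0 = 0 ∧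
      D.mat g' 2 0 = 0 := by
  have h1 : D.conj (D.mat g 0 0) ≠ 0 := by simpa using h0
  have h2 : D.mat g 1 0 / D.mat g 0 0 * D.conj (D.mat g 1 0 / D.mat g 0 0) +
      D.mat g 2 0 / D.mat g 0 0 + D.conj (D.mat g 2 0 / D.mat g 0 0) = 0 := by
    have h3 := D.col_rel g 2 0
    simp only [map_div₀]
    field_simp
    simp at h3
    linear_combination h3
  refine ⟨_, h2, (D.nEl' _ _ h2)⁻¹ * g, by group, ?_, ?_⟩
  · rw [nEl'_inv, mat_mul, Matrix.mul_apply, Fin.sum_univ_three]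
    simp [nMat', h0]
  · rw [nEl'_inv, mat_mul, Matrix.mul_apply, Fin.sum_univ_three]
    simp only [mat_nEl', nMat']
    simp
    simp only [map_div₀] at h2
    field_simp
    have h3 := D.col_rel g 2 0
    simp at h3
    linear_combination h3

/-- The mirror image of `exists_eq_nEl'_mul`: an `n` clears the first column above its lowest entry.
-/
theorem exists_eq_nEl_mul (g : D.G) (h0 : D.mat g 2 0 ≠ 0) :
    ∃ x h g', g = D.nEl x (D.mat g 0 0 / D.mat g 2 0) h * g' ∧ D.mat g' 0 0 = 0 ∧
      D.mat g' 1 0 = 0 := by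
  have h1 : D.conj (D.mat g 2 0) ≠ 0 := by simpa using h0
  have h2 : -D.conj (D.mat g 1 0 / D.mat g 2 0) * D.conj (-D.conj (D.mat g 1 0 / D.mat g 2 0)) +
      D.mat g 0 0 / D.mat g 2 0 + D.conj (D.mat g 0 0 / D.mat g 2 0) = 0 := by
    have h3 := D.col_rel g 2 0
    simp only [map_div₀, map_neg, D.conj_conj]
    field_simp
    simp at h3
    linear_combination h3
  refine ⟨_, h2, (D.nEl _ _ h2)⁻¹ * g, by group, ?_, ?_⟩
  · rw [nEl_inv, mat_mul, Matrix.mul_apply, Fin.sum_univ_three]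
    simp only [mat_nEl, nMat]
    simp
    field_simp
    have h3 := D.col_rel g 2 0
    simp at h3
    linear_combination h3
  · rw [nEl_inv, mat_mul, Matrix.mul_apply, Fin.sum_univ_three]
    simp [nMat, h0, D.conj_conj]

/-- Once the first column is clear below the diagonal, the unitary relations also force the `(2,1)`
entry to vanish, so `g` is upper triangular. -/
theorem exists_eq_dEl_mul_nEl (g : D.G) (h1 : D.mat g 1 0 = 0) (h2 : D.mat g 2 0 = 0) :
    ∃ b ha hb x y h, g = D.dEl (D.mat g 0 0) b ha hb * D.nEl x y h := by
  have h00 := D.col_rel g 0 0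
  have h10 := D.col_rel g 1 0
  have r11 := D.row_rel g 1 1
  have r02 := D.row_rel g 0 2
  have r12 := D.row_rel g 1 2
  simp [h1, h2] at h00 h10 r11 r02 r12
  have ha : D.mat g 0 0 ≠ 0 := right_ne_zero_of_mul_eq_one h00
  have ha' : D.conj (D.mat g 0 0) ≠ 0 := by simpa using ha
  have h21 : D.mat g 2 1 = 0 := h10.resolve_right ha
  have h22 : D.mat g 2 2 = (D.conj (D.mat g 0 0))⁻¹ := by
    have := congrArg D.conj h00
    rw [map_mul, D.conj_conj, map_one] at this
    exact eq_inv_of_mul_eq_one_left this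
  refine ⟨D.mat g 1 1, ha, r11, D.mat g 0 1 / D.mat g 0 0, D.mat g 0 2 / D.mat g 0 0, ?_, ?_⟩
  · simp only [map_div₀]
    field_simp
    linear_combination r02
  · apply D.mat_injective
    ext i j
    rw [mat_mul, Matrix.mul_apply, Fin.sum_univ_three]
    fin_cases i <;> fin_cases j <;> simp [nMat, h1, h2, h21, h22]
    · field_simp
    · field_simp
    · field_simp
      linear_combination r12

end Relations

end Lattice


/-! ### Iwahori and Bruhat decompositions of `K`, and the kernel `Z` of reduction. -/

section Subgroups

set_option linter.unusedSectionVars false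

variable {F E : Type*} [Field F] [ValuativeRel F] [TopologicalSpace F]
  [IsNonarchimedeanLocalField F] [Field E] [ValuativeRel E] [TopologicalSpace E]
  [IsNonarchimedeanLocalField E] [Algebra F E] [ValuativeExtension F E]
  [IsUnramifiedQuadratic F E] (D : Datum F E)

/-- The matrices with entries in `𝔭 ^ (e i j)`. -/
def InLat (e : Fin 3 → Fin 3 → ℤ) (M : Matrix (Fin 3) (Fin 3) E) : Prop :=
  ∀ i j, D.InP (e i j) (M i j)

variable {D}

theorem InLat.mono {e e' : Fin 3 → Fin 3 → ℤ} {M : Matrix (Fin 3) (Fin 3) E} (hM : D.InLat e M)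
    (h : ∀ i j, e' i j ≤ e i j) : D.InLat e' M := fun i j => (hM i j).mono (h i j)

theorem InLat.add {e : Fin 3 → Fin 3 → ℤ} {M M' : Matrix (Fin 3) (Fin 3) E} (hM : D.InLat e M)
    (hM' : D.InLat e M') : D.InLat e (M + M') := fun i j => (hM i j).add (hM' i j)

theorem InLat.neg {e : Fin 3 → Fin 3 → ℤ} {M : Matrix (Fin 3) (Fin 3) E} (hM : D.InLat e M) :
    D.InLat e (-M) := fun i j => (hM i j).neg

theorem InLat.zero {e : Fin 3 → Fin 3 → ℤ} : D.InLat e 0 := fun _ _ => InP.zero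

theorem InLat.mul {e e' f : Fin 3 → Fin 3 → ℤ} {M M' : Matrix (Fin 3) (Fin 3) E}
    (hM : D.InLat e M) (hM' : D.InLat e' M') (h : ∀ i j k, f i k ≤ e i j + e' j k) :
    D.InLat f (M * M') := fun i k => by
  rw [Matrix.mul_apply]
  exact InP.sum fun j _ => ((hM i j).mul (hM' j k)).mono (h i j k)

variable (D)

/-- The subgroup of the elements of `K` congruent to `1` modulo an ideal of the order of `K`. -/
def congSubgroup (T : MaxCompact) (r : Fin 3 → Fin 3 → ℤ)
    (hl : ∀ i j k, r i k ≤ expK T i j + r j k) (hr : ∀ i j k, r i k ≤ r i j + expK T j k) :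
    Subgroup D.G where
  carrier := {g | g ∈ D.K T ∧ D.InLat r (D.mat g - 1)}
  one_mem' := ⟨one_mem _, by rw [mat_one, sub_self]; exact InLat.zero⟩
  mul_mem' := by
    rintro a b ⟨ha, ha'⟩ ⟨hb, hb'⟩
    refine ⟨mul_mem ha hb, ?_⟩
    have h1 : D.mat (a * b) - 1 = (D.mat a - 1) * D.mat b + (D.mat b - 1) := by
      rw [mat_mul, sub_mul, one_mul, sub_add_sub_cancel]
    rw [h1]
    exact (ha'.mul hb hr).add hb'
  inv_mem' := by
    rintro a ⟨ha, ha'⟩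
    refine ⟨inv_mem ha, ?_⟩
    have h1 : D.mat a⁻¹ - 1 = -(D.mat a⁻¹ * (D.mat a - 1)) := by
      rw [mul_sub, ← mat_mul, inv_mul_cancel, mat_one, mul_one, neg_sub]
    rw [h1]
    exact (InLat.mul ((D.K T).inv_mem ha) ha' hl).neg

theorem congSubgroup_conj {T : MaxCompact} {r : Fin 3 → Fin 3 → ℤ} {hl hr} {κ g : D.G}
    (hκ : κ ∈ D.K T) (hg : g ∈ D.congSubgroup T r hl hr) :
    κ * g * κ⁻¹ ∈ D.congSubgroup T r hl hr := by
  refine ⟨mul_mem (mul_mem hκ hg.1) (inv_mem hκ), ?_⟩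
  have h1 : D.mat (κ * g * κ⁻¹) - 1 = D.mat κ * (D.mat g - 1) * D.mat κ⁻¹ := by
    have h2 : D.mat κ * D.mat κ⁻¹ = 1 := by rw [← D.mat_mul, mul_inv_cancel, mat_one]
    rw [mul_sub, sub_mul, mul_one, h2, mat_mul, mat_mul]
  rw [h1]
  exact (InLat.mul hκ hg.2 hl).mul ((D.K T).inv_mem hκ) hr

/-- Exponents for the radical of the order of `K`. -/
def expZ : MaxCompact → Fin 3 → Fin 3 → ℤ
  | .K0 => ![![1, 1, 1], ![1, 1, 1], ![1, 1, 1]]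
  | .K1 => ![![1, 0, 0], ![1, 1, 0], ![2, 1, 1]]

/-- The kernel of the reduction `K → Γ_K`. -/
def Z (T : MaxCompact) : Subgroup D.G :=
  D.congSubgroup T (expZ T) (by cases T <;> decide) (by cases T <;> decide)

theorem expK_mul (T : MaxCompact) (i j k : Fin 3) : expK T i k ≤ expK T i j + expK T j k :=
  (by cases T <;> decide : ∀ i j k, expK T i k ≤ expK T i j + expK T j k) i j k

/-- The elements of `K` congruent to `1` modulo `ϖ ^ m` times the order of `K`. -/
def Cong (T : MaxCompact) (m : ℕ) : Subgroup D.G :=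
  D.congSubgroup T (fun i j => expK T i j + m)
    (fun i j k => by have := expK_mul T i j k; omega)
    (fun i j k => by have := expK_mul T i j k; omega)

theorem Z_conj {T : MaxCompact} {κ g : D.G} (hκ : κ ∈ D.K T) (hg : g ∈ D.Z T) :
    κ * g * κ⁻¹ ∈ D.Z T := D.congSubgroup_conj hκ hg

theorem Z_le_K (T : MaxCompact) : D.Z T ≤ D.K T := fun _ hg => hg.1

theorem Z_le_I1 (T : MaxCompact) : D.Z T ≤ D.I1 T := by
  rintro g ⟨hg, hg'⟩
  refine ⟨fun i j => ?_, fun i => ?_⟩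
  · by_cases hij : i = j
    · subst hij
      exact (hg i i).mono ((by cases T <;> decide : ∀ i, expI T i i ≤ expK T i i) i)
    · have h1 := hg' i j
      rw [Matrix.sub_apply, Matrix.one_apply_ne hij, sub_zero] at h1
      exact h1.mono ((by cases T <;> decide : ∀ i j, expI T i j ≤ expZ T i j) i j)
  · have h1 := hg' i i
    rw [Matrix.sub_apply, Matrix.one_apply_eq] at h1
    exact h1.mono ((by cases T <;> decide : ∀ i, 1 ≤ expZ T i i) i)

theorem Cong_le_Z (T : MaxCompact) : D.Cong T 1 ≤ D.Z T := fun _ hg =>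
  ⟨hg.1, hg.2.mono (by cases T <;> decide)⟩

theorem conj_ϖ_zpow (k : ℤ) : D.conj (D.ϖ ^ k) = D.ϖ ^ k := by
  rw [map_zpow₀, D.conj_ϖ]

theorem ϖ_zpow_ne_zero (k : ℤ) : D.ϖ ^ k ≠ 0 := zpow_ne_zero k D.ϖ_ne_zero

theorem nK_eq (T : MaxCompact) : nK T = 1 - mK T := by cases T <;> rfl

theorem βK_eq (T : MaxCompact) :
    D.βK T = D.antiEl (D.ϖ ^ (mK T - 1)) (D.conj_ϖ_zpow _) (D.ϖ_zpow_ne_zero _) := by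
  apply D.mat_injective
  cases T
  · simp [βK, β, βmat, mK]
  · ext i j
    rw [βK, mat_mul, Matrix.mul_apply, Fin.sum_univ_three]
    simp only [mat_inv_apply]
    fin_cases i <;> fin_cases j <;> simp [β, α, βmat, D.conj_ϖ, mK]

theorem βK_mul_self (T : MaxCompact) : D.βK T * D.βK T = 1 := by
  rw [βK_eq, antiEl_mul_self]

theorem βK_inv (T : MaxCompact) : (D.βK T)⁻¹ = D.βK T := inv_eq_of_mul_eq_one_left (D.βK_mul_self T)

theorem α_eq : D.α = D.dEl D.ϖ⁻¹ 1 (inv_ne_zero D.ϖ_ne_zero) (by simp) := by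
  apply D.mat_injective
  simp [α, D.conj_ϖ]

theorem dEl_congr {a b a' b' : E} (ha hb ha' hb') (h : a = a') (h' : b = b') :
    D.dEl a b ha hb = D.dEl a' b' ha' hb' := by
  subst h h'
  rfl

theorem nEl_congr {x y x' y' : E} (h h') (hx : x = x') (hy : y = y') :
    D.nEl x y h = D.nEl x' y' h' := by
  subst hx hy
  rfl

theorem nEl'_congr {x y x' y' : E} (h h') (hx : x = x') (hy : y = y') :
    D.nEl' x y h = D.nEl' x' y' h' := by
  subst hx hy
  rfl

theorem α_zpow (n : ℤ) : D.α ^ n = D.dEl (D.ϖ ^ (-n)) 1 (D.ϖ_zpow_ne_zero _) (by simp) := by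
  have hone : D.dEl 1 1 one_ne_zero (by simp) = 1 := by
    apply D.mat_injective
    ext i j
    fin_cases i <;> fin_cases j <;> simp
  have hinv : (D.α)⁻¹ = D.dEl D.ϖ 1 D.ϖ_ne_zero (by simp) := by
    rw [inv_eq_iff_mul_eq_one, α_eq, dEl_mul, ← hone]
    exact D.dEl_congr _ _ _ _ (inv_mul_cancel₀ D.ϖ_ne_zero) (mul_one 1)
  induction n using Int.induction_on with
  | zero => simp [hone]
  | succ n ih =>
    rw [zpow_add_one, ih, α_eq, dEl_mul]
    refine D.dEl_congr _ _ _ _ ?_ (mul_one 1)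
    rw [← zpow_sub_one₀ D.ϖ_ne_zero]
    congr 1
    ring
  | pred n ih =>
    rw [zpow_sub_one, ih, hinv, dEl_mul]
    refine D.dEl_congr _ _ _ _ ?_ (mul_one 1)
    rw [← zpow_add_one₀ D.ϖ_ne_zero]
    congr 1
    ring

/-- The reflection used in `S_-` is again antidiagonal, with corner `ϖ^(m_K)`, so the same relations
serve both operators. -/
theorem βK_mul_α_inv (T : MaxCompact) :
    D.βK T * D.α⁻¹ = D.antiEl (D.ϖ ^ mK T) (D.conj_ϖ_zpow _) (D.ϖ_zpow_ne_zero _) := by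
  rw [βK_eq, ← zpow_neg_one, α_zpow]
  apply D.mat_injective
  have h1 : D.ϖ ^ mK T = D.ϖ ^ (mK T - 1) * D.ϖ := by
    rw [← zpow_add_one₀ D.ϖ_ne_zero, sub_add_cancel]
  ext i j
  fin_cases i <;> fin_cases j <;>
    simp [Matrix.mul_apply, Fin.sum_univ_three, h1, D.conj_ϖ, mul_comm]

theorem βK_mul_α_zpow (T : MaxCompact) (n : ℤ) : D.βK T * D.α ^ n = D.α ^ (-n) * D.βK T := by
  rw [α_zpow, α_zpow, βK_eq, antiEl_mul_dEl]
  congr 1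
  refine D.dEl_congr _ _ _ _ ?_ rfl
  rw [D.conj_ϖ_zpow, ← zpow_neg]

theorem α_zpow_mul_dEl (n : ℤ) {a b : E} (ha hb) :
    D.α ^ n * D.dEl a b ha hb = D.dEl a b ha hb * D.α ^ n := by
  rw [α_zpow, dEl_mul, dEl_mul]
  exact D.dEl_congr _ _ _ _ (mul_comm _ _) (mul_comm _ _)

theorem nEl_mem_N {k : ℤ} {x y : E} {h} : D.nEl x y h ∈ D.N k ↔ D.InP k y := by
  constructor
  · rintro ⟨x', y', -, hy, hm⟩
    have h1 := congrFun (congrFun hm 0) 2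
    simp only [mat_nEl, nMat] at h1
    simp at h1
    rwa [h1]
  · exact fun hy => ⟨x, y, h, hy, rfl⟩

theorem nEl'_mem_N' {k : ℤ} {x y : E} {h} : D.nEl' x y h ∈ D.N' k ↔ D.InP k y := by
  constructor
  · rintro ⟨x', y', -, hy, hm⟩
    have h1 := congrFun (congrFun hm 2) 0
    simp only [mat_nEl', nMat'] at h1
    simp at h1
    rwa [h1]
  · exact fun hy => ⟨x, y, h, hy, rfl⟩

theorem exists_eq_nEl {k : ℤ} {g : D.G} (hg : g ∈ D.N k) :
    ∃ x y h, D.InP k y ∧ g = D.nEl x y h := by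
  obtain ⟨x, y, h, hy, hm⟩ := hg
  exact ⟨x, y, h, hy, D.mat_injective hm⟩

theorem exists_eq_nEl' {k : ℤ} {g : D.G} (hg : g ∈ D.N' k) :
    ∃ x y h, D.InP k y ∧ g = D.nEl' x y h := by
  obtain ⟨x, y, h, hy, hm⟩ := hg
  exact ⟨x, y, h, hy, D.mat_injective hm⟩

theorem N_le_I1 (T : MaxCompact) : D.N (nK T) ≤ D.I1 T := fun g hg =>
  ((D.N_inter_I1 T g).2 hg).1

theorem N'_le_I1 (T : MaxCompact) : D.N' (mK T) ≤ D.I1 T := fun g hg =>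
  ((D.N'_inter_I1 T g).2 hg).1

theorem N_mono {k l : ℤ} (h : l ≤ k) : D.N k ≤ D.N l := by
  rintro g ⟨x, y, h0, hy, hm⟩
  exact ⟨x, y, h0, hy.mono h, hm⟩

theorem N'_le_K (T : MaxCompact) : D.N' (mK T - 1) ≤ D.K T := by
  intro g hg
  obtain ⟨x, y, h, hy, rfl⟩ := D.exists_eq_nEl' hg
  have hx : D.InP (expK T 1 0) x := InP_of_norm h hy (by cases T <;> decide)
  have hx' : D.InP (expK T 2 1) (D.conj x) :=
    InP_conj_iff.2 (hx.mono (by cases T <;> decide))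
  intro i j
  rw [mat_nEl']
  cases T <;> fin_cases i <;> fin_cases j <;>
    simp [expK, nMat', InP.zero, InP.one] <;> first | exact hx | exact hx'.neg | exact hy

/-- For `K₀`, `y ∈ 𝔭` forces `x ∈ 𝔭` through the norm equation. For `K₁` the entry `x` is already in
the radical, whose exponent at that place is `0`, and only the corner `y` matters. -/
theorem N_le_Z (T : MaxCompact) : D.N (nK T + 1) ≤ D.Z T := by
  intro g hg
  have hgK := D.I1_le_K T (D.N_le_I1 T (D.N_mono (show nK T ≤ nK T + 1 by omega) hg))
  obtain ⟨x, y, h, hy, rfl⟩ := D.exists_eq_nEl hg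
  have hx : D.InP (expZ T 0 1) x := InP_of_norm h hy (by cases T <;> decide)
  have hx' : D.InP (expZ T 1 2) (D.conj x) :=
    InP_conj_iff.2 (hx.mono (by cases T <;> decide))
  refine ⟨hgK, fun i j => ?_⟩
  rw [mat_nEl]
  cases T <;> fin_cases i <;> fin_cases j <;>
    simp [expZ, nMat, InP.zero] <;> first | exact hx | exact hx'.neg | exact hy

theorem N'_le_Z (T : MaxCompact) : D.N' (mK T) ≤ D.Z T := by
  intro g hg
  have hgK := D.I1_le_K T (D.N'_le_I1 T hg)
  obtain ⟨x, y, h, hy, rfl⟩ := D.exists_eq_nEl' hg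
  have hx : D.InP (expZ T 1 0) x := InP_of_norm h hy (by cases T <;> decide)
  have hx' : D.InP (expZ T 2 1) (D.conj x) :=
    InP_conj_iff.2 (hx.mono (by cases T <;> decide))
  refine ⟨hgK, fun i j => ?_⟩
  rw [mat_nEl']
  cases T <;> fin_cases i <;> fin_cases j <;>
    simp [expZ, nMat', InP.zero] <;> first | exact hx | exact hx'.neg | exact hy

/-- `N ∩ Z`, for the kernel `Z` of the reduction of `K`. -/
theorem mem_N_of_mem_Z (T : MaxCompact) {g : D.G} (hg : g ∈ D.N (nK T)) (hZ : g ∈ D.Z T) :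
    g ∈ D.N (nK T + 1) := by
  obtain ⟨x, y, h, hy, rfl⟩ := D.exists_eq_nEl hg
  rw [nEl_mem_N]
  have h1 := hZ.2 0 2
  rw [Matrix.sub_apply] at h1
  simp [nMat] at h1
  exact h1.mono (by cases T <;> decide)

theorem val_conj_eq_one {b : E} (hb : b * D.conj b = 1) : valuation E b = 1 := by
  have h1 := congrArg (valuation E) hb
  rw [map_mul, valuation_aut, map_one] at h1
  rcases le_total (valuation E b) 1 with h | h
  · exact le_antisymm h (h1 ▸ mul_le_of_le_one_right' h)
  · refine le_antisymm ?_ h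
    calc valuation E b ≤ valuation E b * valuation E b := le_mul_of_one_le_right' h
      _ = 1 := h1

theorem dEl_mem_I (T : MaxCompact) {a b : E} {ha hb} (h : valuation E a = 1) :
    D.dEl a b ha hb ∈ D.I T := by
  have h1 := D.val_conj_eq_one hb
  intro i j
  rw [mat_dEl]
  cases T <;> fin_cases i <;> fin_cases j <;>
    simp [expI, InP, valuation_aut, h, h1]

theorem dEl_mem_Z (T : MaxCompact) {a b : E} {ha hb} (h : D.dEl a b ha hb ∈ D.I1 T) :
    D.dEl a b ha hb ∈ D.Z T := by
  refine ⟨D.I1_le_K T h, fun i j => ?_⟩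
  by_cases hij : i = j
  · subst hij
    rw [Matrix.sub_apply, Matrix.one_apply_eq]
    exact (h.2 i).mono ((by cases T <;> decide : ∀ i, expZ T i i ≤ 1) i)
  · rw [Matrix.sub_apply, Matrix.one_apply_ne hij, sub_zero, mat_dEl]
    fin_cases i <;> fin_cases j <;> first | exact absurd rfl hij | simp [InP.zero]

/-- Products of opposite off-diagonal entries lie in `𝔭`, so the diagonal entries are multiplicative
modulo `𝔭` on `I`. -/
theorem I_diag_mul (T : MaxCompact) {a b : D.G} (ha : a ∈ D.I T) (hb : b ∈ D.I T) (i : Fin 3) :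
    D.InP 1 (D.mat (a * b) i i - D.mat a i i * D.mat b i i) := by
  have h1 : D.mat (a * b) i i - D.mat a i i * D.mat b i i =
      ∑ j ∈ Finset.univ.erase i, D.mat a i j * D.mat b j i := by
    rw [mat_mul, Matrix.mul_apply, ← Finset.add_sum_erase _ _ (Finset.mem_univ i)]
    ring
  rw [h1]
  refine InP.sum fun j hj => ((ha i j).mul (hb j i)).mono ?_
  exact (by cases T <;> decide : ∀ i j, j ≠ i → 1 ≤ expI T i j + expI T j i) i j
    (Finset.ne_of_mem_erase hj)

theorem I_diag_InP (T : MaxCompact) {g : D.G} (hg : g ∈ D.I T) (i : Fin 3) :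
    D.InP 0 (D.mat g i i) := by
  have := hg i i
  rwa [(by cases T <;> decide : ∀ i, expI T i i = 0) i] at this

theorem I_diag_val (T : MaxCompact) {g : D.G} (hg : g ∈ D.I T) (i : Fin 3) :
    valuation E (D.mat g i i) = 1 := by
  have h1 := D.I_diag_mul T hg ((D.I T).inv_mem hg) i
  rw [mul_inv_cancel, mat_one, Matrix.one_apply_eq] at h1
  refine val_eq_one_of_mul (D.I_diag_InP T hg i) (D.I_diag_InP T ((D.I T).inv_mem hg) i) ?_
  have := h1.neg
  rwa [neg_sub] at this

/-- `I ⧸ I₁` embeds in the commutative group of diagonal entries modulo `𝔭`. -/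
theorem I_comm (T : MaxCompact) {a b : D.G} (ha : a ∈ D.I T) (hb : b ∈ D.I T) :
    a⁻¹ * b⁻¹ * a * b ∈ D.I1 T := by
  have hc : a⁻¹ * b⁻¹ * a * b ∈ D.I T :=
    mul_mem (mul_mem (mul_mem (inv_mem ha) (inv_mem hb)) ha) hb
  refine ⟨hc, fun i => ?_⟩
  have hba := mul_mem hb ha
  have h1 := D.I_diag_mul T hba hc i
  have h2 : b * a * (a⁻¹ * b⁻¹ * a * b) = a * b := by group
  rw [h2] at h1
  have h3 := D.I_diag_mul T ha hb i
  have h4 := D.I_diag_mul T hb ha i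
  rw [← InP_mul_iff_of_val_eq_one (D.I_diag_val T hba i)]
  convert (h3.sub h1).sub h4 using 1
  ring

theorem I1_conj (T : MaxCompact) {a b : D.G} (ha : a ∈ D.I T) (hb : b ∈ D.I1 T) :
    a * b * a⁻¹ ∈ D.I1 T := by
  have h1 : a * b * a⁻¹ = (a⁻¹⁻¹ * b⁻¹⁻¹ * a⁻¹ * b⁻¹) * b := by group
  rw [h1]
  exact mul_mem (D.I_comm T (inv_mem ha) (inv_mem (D.I1_le_I T hb))) hb

/-- The Iwahori decomposition. -/
theorem I_decomp' (T : MaxCompact) {g : D.G} (hg : g ∈ D.I T) :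
    ∃ n' ∈ D.N' (mK T), ∃ n ∈ D.N (nK T), ∃ a b ha hb, valuation E a = 1 ∧
      g = n' * D.dEl a b ha hb * n := by
  have hv := D.I_diag_val T hg 0
  obtain ⟨x, h, g', hg', h1, h2⟩ := D.exists_eq_nEl'_mul g (val_ne_zero_of_eq_one hv)
  have hn' : D.nEl' x (D.mat g 2 0 / D.mat g 0 0) h ∈ D.N' (mK T) := by
    rw [nEl'_mem_N', div_eq_mul_inv, mul_comm,
      InP_mul_iff_of_val_eq_one (by rw [map_inv₀, hv, inv_one])]
    exact (hg 2 0).mono (by cases T <;> decide)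
  have hg'I : g' ∈ D.I T := by
    rw [hg', Subgroup.mul_mem_cancel_left _ (D.I1_le_I T (D.N'_le_I1 T hn'))] at hg
    exact hg
  obtain ⟨b, ha, hb, x', y', h', hd⟩ := D.exists_eq_dEl_mul_nEl g' h1 h2
  have hv' := D.I_diag_val T hg'I 0
  refine ⟨_, hn', D.nEl x' y' h', ?_, _, b, ha, hb, hv', ?_⟩
  · have h3 := hg'I
    rw [hd, Subgroup.mul_mem_cancel_left _ (D.dEl_mem_I T hv')] at h3
    rw [nEl_mem_N]
    have h4 := h3 0 2
    simp [nMat] at h4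
    exact h4.mono (by cases T <;> decide)
  · rw [mul_assoc, ← hd, ← hg']

theorem dEl_inv {a b : E} (ha hb) : (D.dEl a b ha hb)⁻¹ =
    D.dEl a⁻¹ (D.conj b) (inv_ne_zero ha) (by rw [D.conj_conj, mul_comm, hb]) := by
  rw [inv_eq_iff_mul_eq_one, dEl_mul]
  apply D.mat_injective
  ext i j
  fin_cases i <;> fin_cases j <;> simp [ha, hb]

/-- The Iwahori decomposition, in the opposite order. -/
theorem I_decomp (T : MaxCompact) {g : D.G} (hg : g ∈ D.I T) :
    ∃ n ∈ D.N (nK T), ∃ n' ∈ D.N' (mK T), ∃ a b ha hb, valuation E a = 1 ∧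
      g = n * D.dEl a b ha hb * n' := by
  obtain ⟨n', hn', n, hn, a, b, ha, hb, hv, h⟩ := D.I_decomp' T (inv_mem hg)
  refine ⟨n⁻¹, inv_mem hn, n'⁻¹, inv_mem hn', a⁻¹, D.conj b, inv_ne_zero ha,
    by rw [D.conj_conj, mul_comm, hb], by rw [map_inv₀, hv, inv_one], ?_⟩
  rw [← dEl_inv D ha hb, ← inv_inv g, h]
  group

/-- In the Iwahori decomposition of an element of `I₁` the torus factor is congruent to `1`, hence
lies in `Z`, and so does the factor in `N'_{m_K}`. -/
theorem I1_decomp (T : MaxCompact) {g : D.G} (hg : g ∈ D.I1 T) :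
    ∃ n ∈ D.N (nK T), ∃ z ∈ D.Z T, g = n * z := by
  obtain ⟨n, hn, n', hn', a, b, ha, hb, hv, h⟩ := D.I_decomp T (D.I1_le_I T hg)
  refine ⟨n, hn, D.dEl a b ha hb * n', mul_mem ?_ (D.N'_le_Z T hn'), by rw [h, mul_assoc]⟩
  refine D.dEl_mem_Z T ?_
  have h1 : D.dEl a b ha hb = n⁻¹ * g * n'⁻¹ := by rw [h]; group
  rw [h1]
  exact mul_mem (mul_mem (inv_mem (D.N_le_I1 T hn)) hg) (inv_mem (D.N'_le_I1 T hn'))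

/-- The Bruhat decomposition of `K`: the big cell is where the lower left entry is largest. -/
theorem mem_I_of_InP (T : MaxCompact) {g : D.G} (hg : g ∈ D.K T) (h : D.InP (mK T) (D.mat g 2 0)) :
    g ∈ D.I T := by
  cases T
  · have h20 : D.InP 1 (D.mat g 2 0) := h
    have hK : ∀ i j, D.InP 0 (D.mat g i j) := fun i j => by
      have := hg i j
      fin_cases i <;> fin_cases j <;> exact this
    have hc : ∀ {x}, D.InP 1 x → ∀ i j, D.InP 1 (x * D.conj (D.mat g i j)) := fun hx i j =>
      (hx.mul (InP_conj_iff.2 (hK i j))).mono (by norm_num)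
    -- Isotropy of the first column: the norm of its middle entry is minus the trace of an element
    -- of `𝔭`. The valuation of a norm is twice that of the entry, so the entry is in `𝔭`; `h21`
    -- uses the last row in the same way.
    have h10 : D.InP 1 (D.mat g 1 0) := by
      refine InP_of_mul_conj (k := 1) ?_ (by norm_num)
      have h1 := D.col_rel g 2 0
      simp at h1
      have h2 : D.mat g 1 0 * D.conj (D.mat g 1 0) = -(D.mat g 2 0 * D.conj (D.mat g 0 0) +
          D.conj (D.mat g 2 0 * D.conj (D.mat g 0 0))) := by
        simp only [map_mul, D.conj_conj]
        linear_combination h1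
      rw [h2]
      exact ((hc h20 0 0).add (InP_conj_iff.2 (hc h20 0 0))).neg
    have h21 : D.InP 1 (D.mat g 2 1) := by
      refine InP_of_mul_conj (k := 1) ?_ (by norm_num)
      have h1 := D.row_rel g 2 0
      simp at h1
      have h2 : D.mat g 2 1 * D.conj (D.mat g 2 1) = -(D.mat g 2 0 * D.conj (D.mat g 2 2) +
          D.conj (D.mat g 2 0 * D.conj (D.mat g 2 2))) := by
        simp only [map_mul, D.conj_conj]
        linear_combination h1
      rw [h2]
      exact ((hc h20 2 2).add (InP_conj_iff.2 (hc h20 2 2))).neg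
    intro i j
    fin_cases i <;> fin_cases j <;>
      first | exact h20 | exact h10 | exact h21 | exact hK _ _
  · have h20 : D.InP 2 (D.mat g 2 0) := h
    intro i j
    have := hg i j
    fin_cases i <;> fin_cases j <;> first | exact h20 | exact this

/-- If the lower left entry is not in `𝔭^(m_K)`, its inverse is in `𝔭^(1 - m_K) = 𝔭^(n_K)`, so the
`n` that clears the column above it lies in `N_{n_K}`. What remains, multiplied by `β_K`, has zero
lower left entry and is in `I`. -/
theorem K_bruhat (T : MaxCompact) {g : D.G} (hg : g ∈ D.K T) :
    g ∈ D.I T ∨ ∃ u ∈ D.N (nK T), ∃ i ∈ D.I T, g = u * D.βK T * i := by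
  by_cases h : D.InP (mK T) (D.mat g 2 0)
  · exact Or.inl (D.mem_I_of_InP T hg h)
  right
  have h0 : D.mat g 2 0 ≠ 0 := fun h0 => h (by rw [h0]; exact InP.zero)
  obtain ⟨x, hx, g', hg', h1, h2⟩ := D.exists_eq_nEl_mul g h0
  have hu : D.nEl x (D.mat g 0 0 / D.mat g 2 0) hx ∈ D.N (nK T) := by
    rw [nEl_mem_N, div_eq_mul_inv]
    exact ((hg 0 0).mul (InP_of_not_InP h)).mono (by cases T <;> decide)
  refine ⟨_, hu, D.βK T * g', ?_, ?_⟩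
  · have hg'K : g' ∈ D.K T := by
      rw [hg', Subgroup.mul_mem_cancel_left _ (D.I1_le_K T (D.N_le_I1 T hu))] at hg
      exact hg
    refine D.mem_I_of_InP T (mul_mem (D.βK_mem T) hg'K) ?_
    rw [βK_eq, mat_mul, Matrix.mul_apply, Fin.sum_univ_three]
    simp [h1, InP.zero]
  · rw [mul_assoc, ← mul_assoc (D.βK T), βK_mul_self, one_mul, ← hg']

theorem βK_notMem (T : MaxCompact) : D.βK T ∉ D.I T := fun h => by
  have h1 := h 2 0
  rw [βK_eq] at h1
  simp at h1
  have h2 : expI T 2 0 = mK T := by cases T <;> rfl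
  rw [h2] at h1
  exact not_InP_zpow (by omega) h1

/-- The conjugate has lower left entry `ϖ^(2(m_K - 1)) y`; its membership in `𝔭^(m_K)` means `y ∈
𝔭^(2 - m_K)`, and `2 - m_K = n_K + 1`. -/
theorem mem_N_of_βK_conj (T : MaxCompact) {u : D.G} (hu : u ∈ D.N (nK T))
    (h : D.βK T * u * D.βK T ∈ D.I T) : u ∈ D.N (nK T + 1) := by
  obtain ⟨x, y, hxy, hy, rfl⟩ := D.exists_eq_nEl hu
  rw [βK_eq, antiEl_mul_nEl, mul_assoc, antiEl_mul_self, mul_one] at h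
  have h1 := h 2 0
  rw [mat_nEl'] at h1
  simp [nMat'] at h1
  rw [nEl_mem_N]
  have h2 : expI T 2 0 = mK T := by cases T <;> rfl
  rw [h2, ← zpow_natCast, ← zpow_mul, InP_zpow_mul_iff] at h1
  exact h1.mono (by cases T <;> decide)

end Subgroups


/-! ### The double cosets `K αⁿ I₁`. -/

section Cartan

set_option linter.unusedSectionVars false

variable {F E : Type*} [Field F] [ValuativeRel F] [TopologicalSpace F]
  [IsNonarchimedeanLocalField F] [Field E] [ValuativeRel E] [TopologicalSpace E]
  [IsNonarchimedeanLocalField E] [Algebra F E] [ValuativeExtension F E]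
  [IsUnramifiedQuadratic F E] (D : Datum F E)

theorem α_conj_nEl (n : ℤ) {x y : E} (h) : D.α ^ n * D.nEl x y h = D.nEl (D.ϖ ^ (-n) * x)
    (D.ϖ ^ (-(2 * n)) * y) (by
      have h1 : D.ϖ ^ (-(2 * n)) = D.ϖ ^ (-n) * D.ϖ ^ (-n) := by
        rw [← zpow_add₀ D.ϖ_ne_zero]; congr 1; ring
      simp only [map_mul, conj_ϖ_zpow, h1]
      linear_combination D.ϖ ^ (-n) * D.ϖ ^ (-n) * h) * D.α ^ n := by
  have h1 : D.ϖ ^ (-(2 * n)) = D.ϖ ^ (-n) * D.ϖ ^ (-n) := by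
    rw [← zpow_add₀ D.ϖ_ne_zero]; congr 1; ring
  rw [α_zpow, dEl_mul_nEl]
  congr 1
  exact D.nEl_congr _ _ (by simp) (by rw [conj_ϖ_zpow, h1])

theorem α_conj_nEl' (n : ℤ) {x y : E} (h) : D.α ^ n * D.nEl' x y h = D.nEl' (D.ϖ ^ n * x)
    (D.ϖ ^ (2 * n) * y) (by
      have h1 : D.ϖ ^ (2 * n) = D.ϖ ^ n * D.ϖ ^ n := by
        rw [← zpow_add₀ D.ϖ_ne_zero]; congr 1; ring
      simp only [map_mul, conj_ϖ_zpow, h1]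
      linear_combination D.ϖ ^ n * D.ϖ ^ n * h) * D.α ^ n := by
  have h1 : D.ϖ ^ (2 * n) = D.ϖ ^ n * D.ϖ ^ n := by
    rw [← zpow_add₀ D.ϖ_ne_zero]; congr 1; ring
  rw [α_zpow, dEl_mul_nEl']
  congr 1
  refine D.nEl'_congr _ _ (by rw [zpow_neg, inv_inv, mul_one]) ?_
  rw [conj_ϖ_zpow, mul_inv, zpow_neg, inv_inv, h1]

theorem α_conj_N {k l n : ℤ} (hl : l ≤ k - 2 * n) {u : D.G} (hu : u ∈ D.N k) :
    ∃ u' ∈ D.N l, D.α ^ n * u = u' * D.α ^ n := by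
  obtain ⟨x, y, h, hy, rfl⟩ := D.exists_eq_nEl hu
  refine ⟨_, ?_, D.α_conj_nEl n h⟩
  rw [nEl_mem_N, InP_zpow_mul_iff]
  exact hy.mono (by omega)

theorem α_conj_N' {k l n : ℤ} (hl : l ≤ k + 2 * n) {u : D.G} (hu : u ∈ D.N' k) :
    ∃ u' ∈ D.N' l, D.α ^ n * u = u' * D.α ^ n := by
  obtain ⟨x, y, h, hy, rfl⟩ := D.exists_eq_nEl' hu
  refine ⟨_, ?_, D.α_conj_nEl' n h⟩
  rw [nEl'_mem_N', InP_zpow_mul_iff]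
  exact hy.mono (by omega)

/-- The Iwasawa decomposition. -/
theorem exists_mem_K_mul (T : MaxCompact) (g : D.G) :
    ∃ κ ∈ D.K T, ∃ a b ha hb x y h, g = κ * D.dEl a b ha hb * D.nEl x y h := by
  have key : ∀ g : D.G, D.mat g 0 0 ≠ 0 → D.InP (mK T - 1) (D.mat g 2 0 / D.mat g 0 0) →
      ∃ κ ∈ D.K T, ∃ a b ha hb x y h, g = κ * D.dEl a b ha hb * D.nEl x y h := by
    intro g h0 hP
    obtain ⟨x, h, g', hg', h1, h2⟩ := D.exists_eq_nEl'_mul g h0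
    obtain ⟨b, ha, hb, x', y', h', hd⟩ := D.exists_eq_dEl_mul_nEl g' h1 h2
    refine ⟨D.nEl' x _ h, D.N'_le_K T (nEl'_mem_N' D |>.2 hP), _, b, ha, hb, x', y', h', ?_⟩
    rw [mul_assoc, ← hd, ← hg']
  -- When the ratio of the corner entries of the first column is too large for `key`, the ratio for
  -- `β_K g` is its inverse scaled by `ϖ^(2(m_K - 1))`, and `key` applies to `β_K g`.
  by_cases h : D.mat g 0 0 ≠ 0 ∧ D.InP (mK T - 1) (D.mat g 2 0 / D.mat g 0 0)
  · exact key g h.1 h.2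
  have e0 : D.mat (D.βK T * g) 0 0 = (D.ϖ ^ (mK T - 1))⁻¹ * D.mat g 2 0 := by
    rw [βK_eq, mat_mul, Matrix.mul_apply, Fin.sum_univ_three]
    simp
  have e2 : D.mat (D.βK T * g) 2 0 = D.ϖ ^ (mK T - 1) * D.mat g 0 0 := by
    rw [βK_eq, mat_mul, Matrix.mul_apply, Fin.sum_univ_three]
    simp
  have h20 : D.mat g 2 0 ≠ 0 := by
    intro h20
    by_cases h00 : D.mat g 0 0 = 0
    · have h1 := D.col_rel g 2 0
      have h2 := D.col_rel g 0 0
      simp [h00, h20] at h1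
      simp [h00, h20, h1] at h2
    · exact h ⟨h00, by rw [h20, zero_div]; exact InP.zero⟩
  obtain ⟨κ, hκ, a, b, ha, hb, x, y, hxy, he⟩ := key (D.βK T * g)
    (by rw [e0]; exact mul_ne_zero (inv_ne_zero (D.ϖ_zpow_ne_zero _)) h20) (by
      have h1 : D.mat (D.βK T * g) 2 0 / D.mat (D.βK T * g) 0 0 =
          D.ϖ ^ (2 * (mK T - 1)) * (D.mat g 0 0 / D.mat g 2 0) := by
        have := D.ϖ_zpow_ne_zero (mK T - 1)
        rw [e0, e2, two_mul, zpow_add₀ D.ϖ_ne_zero]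
        field_simp
      rw [h1, InP_zpow_mul_iff]
      by_cases h00 : D.mat g 0 0 = 0
      · rw [h00, zero_div]; exact InP.zero
      · have h2 := InP_of_not_InP fun hP => h ⟨h00, hP⟩
        rw [inv_div] at h2
        exact h2.mono (by omega))
  refine ⟨D.βK T * κ, mul_mem (D.βK_mem T) hκ, a, b, ha, hb, x, y, hxy, ?_⟩
  rw [mul_assoc, mul_assoc, ← mul_assoc κ, ← he, ← mul_assoc, βK_mul_self, one_mul]

theorem exists_dEl_eq (T : MaxCompact) {a b : E} (ha hb) :
    ∃ κ ∈ D.K T, ∃ j : ℤ, D.dEl a b ha hb = κ * D.α ^ j := by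
  obtain ⟨j, u, hu, rfl⟩ := exists_zpow_mul (D := D) ha
  refine ⟨D.dEl u b (val_ne_zero_of_eq_one hu) hb, D.I_le_K T (D.dEl_mem_I T hu), -j, ?_⟩
  rw [α_zpow, dEl_mul]
  exact D.dEl_congr _ _ _ _ (by rw [neg_neg, mul_comm]) (mul_one b).symm

/-- The decomposition of `G` into the double cosets `K αⁿ I₁`. -/
theorem exists_alpha (T : MaxCompact) (g : D.G) :
    ∃ κ ∈ D.K T, ∃ n : ℤ, ∃ i ∈ D.I1 T, g = κ * D.α ^ n * i := by
  obtain ⟨κ, hκ, a, b, ha, hb, x, y, h, rfl⟩ := D.exists_mem_K_mul T g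
  obtain ⟨κ', hκ', j, hd⟩ := D.exists_dEl_eq T ha hb
  rw [hd]
  -- If `n(x, y)` is in `I₁` it is absorbed on the right; if its conjugate by `αʲ` is in `I₁ ≤ K` it
  -- is absorbed on the left (`h2`). The rank one relation is needed only when both fail.
  by_cases h1 : D.InP (nK T) y
  · exact ⟨κ * κ', mul_mem hκ hκ', j, D.nEl x y h, D.N_le_I1 T ((D.nEl_mem_N).2 h1), by group⟩
  by_cases h2 : D.InP (nK T) (D.ϖ ^ (-(2 * j)) * y)
  · obtain ⟨u', hu', he⟩ : ∃ u' ∈ D.N (nK T), D.α ^ j * D.nEl x y h = u' * D.α ^ j :=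
      ⟨_, (D.nEl_mem_N).2 h2, D.α_conj_nEl j h⟩
    refine ⟨κ * κ' * u', mul_mem (mul_mem hκ hκ') (D.I1_le_K T (D.N_le_I1 T hu')), j, 1,
      one_mem _, ?_⟩
    rw [mul_one, mul_assoc _ u', ← he]
    simp only [mul_assoc]
  have hy : y ≠ 0 := by
    rintro rfl
    exact h1 InP.zero
  have hm := nK_eq T
  -- Write `n(x, y) = n' d n β_K`. Failure of `h2` lets `n'` cross `αʲ` into `K`, failure of `h1`
  -- lets `n` cross `β_K` into `N'_{m_K} ≤ I₁`, and `d` only shifts the power of `α`.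
  have hrel := D.nEl_mul_antiEl (D.conj_ϖ_zpow (mK T - 1)) (D.ϖ_zpow_ne_zero _) h hy
  rw [← βK_eq, ← eq_mul_inv_iff_mul_eq, βK_inv] at hrel
  obtain ⟨κ₂, hκ₂, l, hd₂⟩ := D.exists_dEl_eq T
    (mul_ne_zero (D.ϖ_zpow_ne_zero (mK T - 1)) hy)
    (D.norm_unit (mul_ne_zero (D.ϖ_zpow_ne_zero (mK T - 1)) hy))
  have hn : ∀ hh, ∃ n' ∈ D.N' (mK T), D.nEl (x / (D.ϖ ^ (mK T - 1) * y))
      (1 / ((D.ϖ ^ (mK T - 1)) ^ 2 * y)) hh * D.βK T = D.βK T * n' := by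
    intro hh
    have h3 := D.antiEl_mul_nEl (D.conj_ϖ_zpow (mK T - 1)) (D.ϖ_zpow_ne_zero _) hh
    rw [← βK_eq] at h3
    have h4 : (D.ϖ ^ (mK T - 1)) ^ 2 * (1 / ((D.ϖ ^ (mK T - 1)) ^ 2 * y)) = y⁻¹ := by
      have := D.ϖ_zpow_ne_zero (mK T - 1)
      field_simp
    obtain ⟨n', hn', he⟩ : ∃ n' ∈ D.N' (mK T), D.βK T * D.nEl (x / (D.ϖ ^ (mK T - 1) * y))
        (1 / ((D.ϖ ^ (mK T - 1)) ^ 2 * y)) hh = n' * D.βK T := by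
      refine ⟨_, ?_, h3⟩
      rw [nEl'_mem_N', h4]
      exact (InP_of_not_InP h1).mono (by omega)
    refine ⟨n', hn', ?_⟩
    have h5 := D.βK_mul_self T
    calc _ = D.βK T * (D.βK T * D.nEl _ _ hh) * D.βK T := by
          rw [← mul_assoc (D.βK T) (D.βK T), h5, one_mul]
      _ = _ := by rw [he, mul_assoc, mul_assoc, h5, mul_one]
  have hleft : ∀ hh, ∃ κ₃ ∈ D.K T, D.α ^ j * D.nEl' (-D.conj x / y) (1 / y) hh =
      κ₃ * D.α ^ j := by
    intro hh
    refine ⟨_, ?_, D.α_conj_nEl' j hh⟩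
    refine D.I1_le_K T (D.N'_le_I1 T ((D.nEl'_mem_N').2 ?_))
    have h4 := InP_of_not_InP h2
    have h5 : (D.ϖ ^ (-(2 * j)) * y)⁻¹ = D.ϖ ^ (2 * j) * (1 / y) := by
      rw [mul_inv, zpow_neg, inv_inv, one_div]
    rw [h5] at h4
    exact h4.mono (by omega)
  obtain ⟨n', hn', hn''⟩ := hn (by
    have h1 : D.conj y ≠ 0 := by simpa using hy
    have hc := D.ϖ_zpow_ne_zero (mK T - 1)
    simp only [map_div₀, map_mul, map_pow, D.conj_ϖ_zpow, map_one]
    field_simp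
    linear_combination h)
  obtain ⟨κ₃, hκ₃, hκ₃'⟩ := hleft (by
    have h1 : D.conj y ≠ 0 := by simpa using hy
    simp only [map_div₀, map_neg, map_one, D.conj_conj]
    field_simp
    linear_combination h)
  obtain ⟨κ₄, hκ₄, l', hd₄⟩ : ∃ κ₄ ∈ D.K T, ∃ l' : ℤ, D.α ^ j * (κ₂ * D.α ^ l) =
      κ₄ * D.α ^ l' := by
    have hd₂' := hd₂
    rw [← hd₂, α_zpow_mul_dEl, hd₂]
    exact ⟨κ₂, hκ₂, l + j, by rw [zpow_add, mul_assoc]⟩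
  refine ⟨κ * κ' * κ₃ * κ₄ * D.βK T, mul_mem (mul_mem (mul_mem (mul_mem hκ hκ') hκ₃) hκ₄)
    (D.βK_mem T), -l', n', D.N'_le_I1 T hn', ?_⟩
  rw [hrel, hd₂, mul_assoc _ (D.nEl _ _ _) (D.βK T), hn'']
  calc κ * (κ' * D.α ^ j) * (D.nEl' (-D.conj x / y) (1 / y) _ * (κ₂ * D.α ^ l) * (D.βK T * n'))
      = κ * κ' * (D.α ^ j * D.nEl' (-D.conj x / y) (1 / y) _) * (κ₂ * D.α ^ l) *
        D.βK T * n' := by simp only [mul_assoc]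
    _ = κ * κ' * κ₃ * (D.α ^ j * (κ₂ * D.α ^ l)) * D.βK T * n' := by
        rw [hκ₃']; simp only [mul_assoc]
    _ = κ * κ' * κ₃ * κ₄ * (D.α ^ l' * D.βK T) * n' := by rw [hd₄]; simp only [mul_assoc]
    _ = _ := by
        have h6 := D.βK_mul_α_zpow T (-l')
        rw [neg_neg] at h6
        rw [← h6]; simp only [mul_assoc]

/-- Exponents of `α`. -/
def expα : Fin 3 → ℤ := ![-1, 0, 1]

theorem mat_α_conj (m n : ℤ) (g : D.G) (i j : Fin 3) :
    D.mat (D.α ^ m * g * D.α ^ n) i j = D.ϖ ^ (m * expα i + n * expα j) * D.mat g i j := by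
  have h1 : ∀ k : ℤ, D.ϖ ^ k ≠ 0 := D.ϖ_zpow_ne_zero
  rw [α_zpow, α_zpow, mat_mul, mat_mul, Matrix.mul_apply, Fin.sum_univ_three]
  simp only [Matrix.mul_apply, Fin.sum_univ_three, zpow_add₀ D.ϖ_ne_zero]
  fin_cases i <;> fin_cases j <;> simp [expα, D.conj_ϖ] <;> ring

/-- The diagonal entries of `i⁻¹` are units, so integrality of the `(0,0)` and `(2,2)` entries of
`αᵐ i⁻¹ α⁻ⁿ` gives `n - m ≥ 0` and `m - n ≥ 0`. -/
theorem alpha_unique (T : MaxCompact) {κ i : D.G} (hκ : κ ∈ D.K T) (hi : i ∈ D.I1 T) {m n : ℤ}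
    (h : D.α ^ m = κ * D.α ^ n * i) : m = n := by
  have h1 : D.α ^ m * i⁻¹ * D.α ^ (-n) = κ := by
    rw [h, zpow_neg]; group
  have hi' := inv_mem (D.I1_le_I T hi)
  have h0 := hκ 0 0
  have h2 := hκ 2 2
  rw [← h1, mat_α_conj, mul_comm, InP_mul_iff_of_val_eq_one (D.I_diag_val T hi' 0)] at h0
  rw [← h1, mat_α_conj, mul_comm, InP_mul_iff_of_val_eq_one (D.I_diag_val T hi' 2)] at h2
  have e0 : expK T 0 0 = 0 := by cases T <;> rfl
  have e2 : expK T 2 2 = 0 := by cases T <;> rfl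
  rw [e0] at h0
  rw [e2] at h2
  have h0' := fun hl => not_InP_zpow (D := D) hl h0
  have h2' := fun hl => not_InP_zpow (D := D) hl h2
  simp [expα] at h0' h2'
  omega

/-- On and above the diagonal `K` and `I` impose the same exponents; below it, conjugation by `αᵐ`
with `m ≥ 0` only raises the valuations of `i`; the diagonal is unchanged. With the next mirrored
version for `m < 0`, this makes `f_n` well defined. -/
theorem mem_I1_of_α_conj (T : MaxCompact) {i : D.G} (hi : i ∈ D.I1 T) {m : ℤ} (hm : 0 ≤ m)
    (hK : D.α ^ m * i * D.α ^ (-m) ∈ D.K T) : D.α ^ m * i * D.α ^ (-m) ∈ D.I1 T := by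
  refine ⟨fun a b => ?_, fun a => ?_⟩
  · by_cases hab : a ≤ b
    · exact (hK a b).mono ((by cases T <;> decide : ∀ a b, a ≤ b → expI T a b ≤ expK T a b) a b hab)
    · rw [mat_α_conj, InP_zpow_mul_iff]
      refine (hi.1 a b).mono ?_
      have h1 := (by decide : ∀ a b, ¬ a ≤ b → expα b ≤ expα a) a b hab
      nlinarith
  · rw [mat_α_conj]
    have h1 : m * expα a + -m * expα a = 0 := by ring
    rw [h1, zpow_zero, one_mul]
    exact hi.2 a

theorem mat_βK_conj (T : MaxCompact) (g : D.G) (i j : Fin 3) :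
    D.mat (D.βK T * g * D.βK T) i j =
      D.ϖ ^ ((mK T - 1) * (expα i - expα j)) * D.mat g i.rev j.rev := by
  have h1 : ∀ k : ℤ, D.ϖ ^ k ≠ 0 := D.ϖ_zpow_ne_zero
  have h2 := D.ϖ_ne_zero
  rw [βK_eq, mat_mul, mat_mul, Matrix.mul_apply, Fin.sum_univ_three]
  simp only [Matrix.mul_apply, Fin.sum_univ_three, mat_antiEl]
  generalize mK T - 1 = k
  have h3 := h1 k
  fin_cases i <;> fin_cases j <;>
    simp [expα, zpow_add₀ D.ϖ_ne_zero, mul_two] <;>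
    field_simp

theorem βK_conj_mem_I1_of_α_conj (T : MaxCompact) {i : D.G} (hi : i ∈ D.I1 T) {m : ℤ} (hm : m < 0)
    (hK : D.α ^ m * i * D.α ^ (-m) ∈ D.K T) :
    D.βK T * (D.α ^ m * i * D.α ^ (-m)) * D.βK T ∈ D.I1 T := by
  refine ⟨fun a b => ?_, fun a => ?_⟩
  · rw [mat_βK_conj, InP_zpow_mul_iff]
    by_cases hab : a ≤ b
    · exact (hK _ _).mono ((by cases T <;> decide : ∀ a b, a ≤ b →
        expI T a b - (mK T - 1) * (expα a - expα b) ≤ expK T a.rev b.rev) a b hab)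
    · rw [mat_α_conj, InP_zpow_mul_iff]
      refine (hi.1 _ _).mono ?_
      have h1 := (by cases T <;> decide : ∀ a b, ¬ a ≤ b →
        expI T a b - (mK T - 1) * (expα a - expα b) + (expα a.rev - expα b.rev) ≤
          expI T a.rev b.rev) a b hab
      have h2 := (by decide : ∀ a b, ¬ a ≤ b → expα a.rev - expα b.rev ≤ 0) a b hab
      nlinarith
  · rw [mat_βK_conj, mat_α_conj]
    have h1 : m * expα a.rev + -m * expα a.rev = 0 := by ring
    rw [h1, sub_self, mul_zero, zpow_zero, one_mul, one_mul]
    exact hi.2 _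

end Cartan

/-! ### `p`-th powers in the pro-`p` Iwahori subgroup. -/

section PPower

set_option linter.unusedSectionVars false

variable {F E : Type*} [Field F] [ValuativeRel F] [TopologicalSpace F]
  [IsNonarchimedeanLocalField F] [Field E] [ValuativeRel E] [TopologicalSpace E]
  [IsNonarchimedeanLocalField E] [Algebra F E] [ValuativeExtension F E]
  [IsUnramifiedQuadratic F E] (D : Datum F E)

theorem InP_natCast (p : ℕ) [CharP 𝓀[F] p] : D.InP 1 (p : E) := by
  have h1 : valuation F (p : F) < 1 := by
    have h2 : ((p : 𝒪[F]) : F) = (p : F) := by simp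
    have h3 : IsLocalRing.residue 𝒪[F] (p : 𝒪[F]) = 0 := by
      rw [map_natCast, CharP.cast_eq_zero]
    rw [IsLocalRing.residue_eq_zero_iff, IsLocalRing.mem_maximalIdeal, mem_nonunits_iff] at h3
    rw [← h2]
    refine lt_of_le_of_ne (p : 𝒪[F]).2 fun h4 => h3 ?_
    have h0 : ((p : 𝒪[F]) : F) ≠ 0 := by
      intro h0
      rw [h0, map_zero] at h4
      exact zero_ne_one h4
    refine isUnit_iff_exists_inv.mpr ⟨⟨((p : 𝒪[F]) : F)⁻¹, ?_⟩, Subtype.ext (mul_inv_cancel₀ h0)⟩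
    rw [Valuation.mem_integer_iff, map_inv₀, h4, inv_one]
  refine D.InP_of_val_lt_one ?_
  have h2 := (ValuativeExtension.mapValueGroupWithZero_strictMono (A := F) (B := E)) h1
  simpa using h2

theorem InLat.natCast_mul {e e' : Fin 3 → Fin 3 → ℤ} {M : Matrix (Fin 3) (Fin 3) E} (n : ℕ)
    (hn : D.InP 1 (n : E)) (hM : D.InLat e M) (he : ∀ i j, e' i j ≤ 1 + e i j) :
    D.InLat e' (M * (n : Matrix (Fin 3) (Fin 3) E)) := fun i j => by
  rw [(Nat.cast_commute n M).eq.symm, ← nsmul_eq_mul, Matrix.smul_apply, nsmul_eq_mul]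
  exact (hn.mul (hM i j)).mono (he i j)

theorem InLat.pow_succ {e : Fin 3 → Fin 3 → ℤ} {M : Matrix (Fin 3) (Fin 3) E} (hM : D.InLat e M)
    (he : ∀ i j k, e i k ≤ e i j + e j k) (n : ℕ) : D.InLat e (M ^ (n + 1)) := by
  induction n with
  | zero => simpa using hM
  | succ n ih =>
    rw [_root_.pow_succ]
    exact ih.mul hM he

theorem InLat.natCast {e : Fin 3 → Fin 3 → ℤ} {M : Matrix (Fin 3) (Fin 3) E} (n : ℕ)
    (hM : D.InLat e M) : D.InLat e (M * (n : Matrix (Fin 3) (Fin 3) E)) := fun i j => by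
  rw [(Nat.cast_commute n M).eq.symm, ← nsmul_eq_mul, Matrix.smul_apply]
  induction n with
  | zero => rw [zero_smul]; exact InP.zero
  | succ n ih => rw [succ_nsmul]; exact ih.add (hM i j)

/-- In the binomial expansion the intermediate coefficients are divisible by `p ∈ 𝔭`, which accounts
for the extra `1` in the exponents; only `Mᵖ` needs a separate bound. -/
theorem InLat.one_add_pow (p : ℕ) (hp : p.Prime) (hpP : D.InP 1 (p : E))
    {e e' : Fin 3 → Fin 3 → ℤ} {M : Matrix (Fin 3) (Fin 3) E} (hM : D.InLat e M)
    (he : ∀ i j k, e i k ≤ e i j + e j k) (he' : ∀ i j, e' i j ≤ 1 + e i j)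
    (hMp : D.InLat e' (M ^ p)) : D.InLat e' ((M + 1) ^ p - 1) := by
  have h1 : (M + 1) ^ p - 1 = M ^ p + ∑ m ∈ (Finset.range p).erase 0,
      M ^ m * (p.choose m : Matrix (Fin 3) (Fin 3) E) := by
    rw [(Commute.one_right M).add_pow, Finset.sum_range_succ,
      ← Finset.add_sum_erase _ _ (Finset.mem_range.2 hp.pos)]
    simp only [one_pow, mul_one, pow_zero, Nat.choose_zero_right, Nat.choose_self, Nat.cast_one]
    abel
  rw [h1]
  refine hMp.add ?_
  refine Finset.sum_induction _ (D.InLat e') (fun _ _ ha hb => ha.add hb) InLat.zero ?_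
  intro m hm
  rw [Finset.mem_erase, Finset.mem_range] at hm
  obtain ⟨c, hc⟩ := hp.dvd_choose_self hm.1 hm.2
  obtain ⟨m', rfl⟩ := Nat.exists_eq_succ_of_ne_zero hm.1
  rw [hc, Nat.cast_mul, ← mul_assoc]
  exact InLat.natCast D c (InLat.natCast_mul D p hpP (hM.pow_succ D he m') he')

/-- Exponents for the Jacobson radical of the order of the Iwahori subgroup. -/
def expJ : MaxCompact → Fin 3 → Fin 3 → ℤ
  | .K0 => ![![1, 0, 0], ![1, 1, 0], ![1, 1, 1]]
  | .K1 => ![![1, 0, -1], ![1, 1, 0], ![2, 1, 1]]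

/-- Exponents for the square of the Jacobson radical. -/
def expJ2 : MaxCompact → Fin 3 → Fin 3 → ℤ
  | .K0 => ![![1, 1, 0], ![1, 1, 1], ![2, 1, 1]]
  | .K1 => ![![1, 0, 0], ![2, 1, 0], ![2, 2, 1]]

theorem I1_InLat (T : MaxCompact) {g : D.G} (hg : g ∈ D.I1 T) : D.InLat (expJ T) (D.mat g - 1) := by
  intro i j
  rw [Matrix.sub_apply]
  by_cases hij : i = j
  · subst hij
    rw [Matrix.one_apply_eq]
    exact (hg.2 i).mono ((by cases T <;> decide : ∀ i, expJ T i i ≤ 1) i)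
  · rw [Matrix.one_apply_ne hij, sub_zero]
    exact (hg.1 i j).mono ((by cases T <;> decide : ∀ i j, i ≠ j → expJ T i j ≤ expI T i j) i j hij)

theorem mat_pow (g : D.G) (n : ℕ) : D.mat (g ^ n) = D.mat g ^ n := by
  induction n with
  | zero => simp
  | succ n ih => rw [pow_succ, pow_succ, mat_mul, ih]

/-- The cube of the Jacobson radical of the Iwahori order lies in `ϖ` times the order of `K`. As `p`
is odd, `p ≥ 3`, and `(g - 1)ᵖ` is covered. -/
theorem pow_mem_Cong (T : MaxCompact) (p : ℕ) (hp : p.Prime) (hp2 : p ≠ 2)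
    (hpP : D.InP 1 (p : E)) {g : D.G} (hg : g ∈ D.I1 T) : g ^ p ∈ D.Cong T 1 := by
  refine ⟨pow_mem (D.I1_le_K T hg) _, ?_⟩
  have h1 := D.I1_InLat T hg
  rw [mat_pow, ← sub_add_cancel (D.mat g) 1]
  refine InLat.one_add_pow D p hp hpP h1 (by cases T <;> decide) (by cases T <;> decide) ?_
  obtain ⟨l, rfl⟩ : ∃ l, p = l + 3 := ⟨p - 3, by have := hp.two_le; omega⟩
  have h2 : D.InLat (expJ2 T) ((D.mat g - 1) * (D.mat g - 1)) :=
    h1.mul h1 (by cases T <;> decide)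
  have h3 : D.InLat (fun i j => expK T i j + (1 : ℕ)) ((D.mat g - 1) ^ 3) := by
    rw [_root_.pow_succ, pow_two]
    exact h2.mul h1 (by cases T <;> decide)
  clear hp hp2 hpP
  induction l with
  | zero => exact h3
  | succ l ih =>
    rw [show l + 1 + 3 = l + 3 + 1 by ring, _root_.pow_succ]
    exact ih.mul h1 (by cases T <;> decide)

end PPower


/-! ### Open and compact subgroups; `K` satisfies the rank one axioms. -/

section TopologyOfG

set_option linter.unusedSectionVars false

variable {F E : Type*} [Field F] [ValuativeRel F] [TopologicalSpace F]
  [IsNonarchimedeanLocalField F] [Field E] [ValuativeRel E] [TopologicalSpace E]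
  [IsNonarchimedeanLocalField E] [Algebra F E] [ValuativeExtension F E]
  [IsUnramifiedQuadratic F E] (D : Datum F E)

theorem continuous_mat : Continuous D.mat :=
  Units.continuous_val.comp continuous_subtype_val

/-- The topology of `GL₃` records both `g` and `g⁻¹`, but in `G` the entries of `g⁻¹` are conjugates
of entries of `g`, and conjugation is continuous. -/
theorem isInducing_mat : Topology.IsInducing D.mat := by
  have hc : Continuous D.conj := continuous_aut D.conj
  let Φ : Matrix (Fin 3) (Fin 3) E →
      Matrix (Fin 3) (Fin 3) E × (Matrix (Fin 3) (Fin 3) E)ᵐᵒᵖ := fun M =>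
    (M, MulOpposite.op (βmat E * (M.map D.conj)ᵀ * βmat E))
  have hΦ : Continuous Φ := by
    refine continuous_id.prodMk (MulOpposite.continuous_op.comp ?_)
    exact (continuous_const.matrix_mul (continuous_id.matrix_map hc).matrix_transpose).matrix_mul
      continuous_const
  refine Topology.IsInducing.of_comp D.continuous_mat hΦ ?_
  have h : Φ ∘ D.mat = Units.embedProduct (Matrix (Fin 3) (Fin 3) E) ∘ (Subtype.val : D.G → _) := by
    ext1 g
    refine Prod.ext rfl ?_
    change MulOpposite.op _ = MulOpposite.op (D.mat g⁻¹)
    rw [mat_inv]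
  rw [h]
  exact Units.isInducing_embedProduct.comp Topology.IsInducing.subtypeVal

theorem isClopen_InP (k : ℤ) : IsClopen {x : E | D.InP k x} := by
  let A : AddSubgroup E :=
    { carrier := {x | D.InP k x}
      zero_mem' := InP.zero
      add_mem' := InP.add
      neg_mem' := InP.neg }
  have hA : IsOpen (A : Set E) := by
    refine A.isOpen_of_mem_nhds (g := 0) ?_
    rw [IsValuativeTopology.mem_nhds_zero_iff]
    exact ⟨Units.mk0 _ (zpow_pos D.val_ϖ_pos k).ne', fun x hx => le_of_lt (Set.mem_ofPred.1 hx)⟩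
  exact ⟨A.isClosed_of_isOpen hA, hA⟩

theorem isCompact_InP (k : ℤ) : IsCompact {x : E | D.InP k x} :=
  IsNonarchimedeanLocalField.isCompact_closedBall E _

variable (E) in
theorem t2Space : T2Space E := by
  let := IsTopologicalAddGroup.rightUniformSpace E
  have := isUniformAddGroup_of_addCommGroup (G := E)
  infer_instance

theorem continuous_entry (i j : Fin 3) : Continuous fun g : D.G => D.mat g i j :=
  (continuous_apply_apply i j).comp D.continuous_mat

theorem isOpen_Cong (T : MaxCompact) (m : ℕ) : IsOpen (D.Cong T m : Set D.G) := by
  have h : (D.Cong T m : Set D.G) = ⋂ i, ⋂ j,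
      ((fun g : D.G => D.mat g i j) ⁻¹' {x | D.InP (expK T i j) x} ∩
      (fun g : D.G => D.mat g i j - (1 : Matrix (Fin 3) (Fin 3) E) i j) ⁻¹'
        {x | D.InP (expK T i j + m) x}) := by
    ext g
    simp only [Set.mem_iInter]
    exact ⟨fun h i j => ⟨h.1 i j, h.2 i j⟩, fun h => ⟨fun i j => (h i j).1, fun i j => (h i j).2⟩⟩
  rw [h]
  exact isOpen_iInter_of_finite fun i => isOpen_iInter_of_finite fun j =>
    ((D.isClopen_InP _).2.preimage (D.continuous_entry i j)).inter
    ((D.isClopen_InP _).2.preimage ((D.continuous_entry i j).sub continuous_const))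

theorem isOpen_of_Cong_le (T : MaxCompact) (m : ℕ) {H : Subgroup D.G} (h : D.Cong T m ≤ H) :
    IsOpen (H : Set D.G) :=
  Subgroup.isOpen_mono h (D.isOpen_Cong T m)

theorem isOpen_I1 (T : MaxCompact) : IsOpen (D.I1 T : Set D.G) :=
  D.isOpen_of_Cong_le T 1 ((D.Cong_le_Z T).trans (D.Z_le_I1 T))

theorem isCompact_K (T : MaxCompact) : IsCompact (D.K T : Set D.G) := by
  have := t2Space E
  have hc : Continuous D.conj := continuous_aut D.conj
  rw [D.isInducing_mat.isCompact_iff]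
  have h : D.mat '' (D.K T : Set D.G) =
      (Set.univ.pi fun i => Set.univ.pi fun j => {x | D.InP (expK T i j) x}) ∩
      {M : Matrix (Fin 3) (Fin 3) E | Mᵀ * βmat E * M.map D.conj = βmat E} := by
    ext M
    constructor
    · rintro ⟨g, hg, rfl⟩
      exact ⟨fun i _ j _ => hg i j, D.mat_eq g⟩
    · rintro ⟨h1, h2⟩
      exact ⟨D.ofMatrix M h2, fun i j => h1 i trivial j trivial, rfl⟩
  rw [h]
  refine IsCompact.inter_right ?_ ?_
  · exact isCompact_univ_pi fun i => isCompact_univ_pi fun j => D.isCompact_InP _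
  · exact isClosed_eq ((continuous_id.matrix_transpose.matrix_mul continuous_const).matrix_mul
      (continuous_id.matrix_map hc)) continuous_const

instance compactSpace_K (T : MaxCompact) : CompactSpace (D.K T) :=
  isCompact_iff_compactSpace.1 (D.isCompact_K T)

theorem finiteIndex_of_Cong_le (T : MaxCompact) (m : ℕ) {H : Subgroup D.G} (h : D.Cong T m ≤ H) :
    (H.subgroupOf (D.K T)).FiniteIndex := by
  have := Subgroup.quotient_finite_of_isOpen (H.subgroupOf (D.K T))
    ((D.isOpen_of_Cong_le T m h).preimage continuous_subtype_val)
  exact Subgroup.finiteIndex_of_finite_quotient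

/-- Representatives of `N_{n_K} / N_{n_K + 1}`, as elements of `K`. -/
noncomputable def repN (T : MaxCompact) (u : D.N (nK T) ⧸ (D.N (nK T + 1)).subgroupOf (D.N (nK T))) : D.K T :=
  ⟨(u.out : D.N (nK T)), D.I1_le_K T (D.N_le_I1 T u.out.2)⟩

/-- The element `β_K` of `K`. -/
def wK (T : MaxCompact) : D.K T := ⟨D.βK T, D.βK_mem T⟩

theorem rankOne (T : MaxCompact) (p : ℕ) (hp : p.Prime) (hp2 : p ≠ 2) (hpP : D.InP 1 (p : E))
    {t : E} (ht : valuation E t = 1) (ht0 : t + D.conj t = 0) :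
    RankOne p ((D.I T).subgroupOf (D.K T)) ((D.I1 T).subgroupOf (D.K T))
      ((D.N (nK T)).subgroupOf (D.K T)) ((D.Z T).subgroupOf (D.K T)) (D.wK T) (D.repN T) where
  I₁_le _ hg := D.I1_le_I T hg
  N_le _ hg := D.N_le_I1 T hg
  Z_le _ hg := D.Z_le_I1 T hg
  normal := ⟨fun _ hn g => D.Z_conj g.2 hn⟩
  finiteIndex := D.finiteIndex_of_Cong_le T 1 (D.Cong_le_Z T)
  w_mul_w := Subtype.ext (D.βK_mul_self T)
  w_notMem := D.βK_notMem T
  bruhat g := by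
    refine (D.K_bruhat T g.2).imp_right ?_
    rintro ⟨u, hu, i, hi, h⟩
    exact ⟨⟨u, D.I1_le_K T (D.N_le_I1 T hu)⟩, hu, ⟨i, D.I_le_K T hi⟩, hi, Subtype.ext h⟩
  mem_Z u hu h := D.N_le_Z T (D.mem_N_of_βK_conj T hu h)
  decomp g hg := by
    obtain ⟨n, hn, z, hz, h⟩ := D.I1_decomp T hg
    exact ⟨⟨n, D.I1_le_K T (D.N_le_I1 T hn)⟩, hn, ⟨z, D.Z_le_K T hz⟩, hz, Subtype.ext h⟩
  torus i hi := by
    obtain ⟨n, hn, n', hn', a, b, ha, hb, hv, h⟩ := D.I_decomp T hi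
    have hd : D.dEl a b ha hb ∈ D.I T := D.dEl_mem_I T hv
    -- Rewrite `n d n'` as `(n · d n' d⁻¹) d`, so that the torus element stands on the right, as
    -- `torus` requires.
    have h1 : n * (D.dEl a b ha hb * n' * (D.dEl a b ha hb)⁻¹) ∈ D.I1 T :=
      mul_mem (D.N_le_I1 T hn) (D.I1_conj T hd (D.N'_le_I1 T hn'))
    refine ⟨⟨_, D.I1_le_K T h1⟩, h1, ⟨_, D.I_le_K T hd⟩, Subtype.ext ?_, ?_, ?_⟩
    · change (i : D.G) = _ * _
      refine h.trans ?_
      change _ = n * (D.dEl a b ha hb * n' * (D.dEl a b ha hb)⁻¹) * D.dEl a b ha hb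
      group
    · change D.βK T * D.dEl a b ha hb * D.βK T ∈ D.I T
      rw [βK_eq, antiEl_mul_dEl, mul_assoc, antiEl_mul_self, mul_one]
      exact D.dEl_mem_I T (by rw [map_inv₀, valuation_aut, hv, inv_one])
    · intro u hu
      obtain ⟨x, y, hxy, hy, hu'⟩ := D.exists_eq_nEl hu
      change D.dEl a b ha hb * u * (D.dEl a b ha hb)⁻¹ ∈ D.N (nK T)
      change (u : D.G) = _ at hu'
      rw [hu', dEl_mul_nEl, mul_assoc, mul_inv_cancel, mul_one, nEl_mem_N,
        InP_mul_iff_of_val_eq_one (by simp [valuation_aut, hv])]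
      exact hy
  comm a ha b hb := D.I_comm T ha hb
  pow_mem u hu := by
    refine ⟨1, D.Cong_le_Z T ?_⟩
    rw [pow_one]
    exact D.pow_mem_Cong T p hp hp2 hpP hu
  r_mem i := i.out.2
  r_exists u hu := by
    refine ⟨((⟨u, hu⟩ : D.N (nK T)) : D.N (nK T) ⧸ _), D.N_le_Z T ?_⟩
    have h1 := QuotientGroup.eq.1 (QuotientGroup.out_eq'
      ((⟨u, hu⟩ : D.N (nK T)) : D.N (nK T) ⧸ (D.N (nK T + 1)).subgroupOf (D.N (nK T))))
    exact h1
  r_unique i j h := by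
    have h1 : (i.out)⁻¹ * j.out ∈ (D.N (nK T + 1)).subgroupOf (D.N (nK T)) :=
      D.mem_N_of_mem_Z T ((i.out)⁻¹ * j.out).2 h
    have h2 := QuotientGroup.eq.2 h1
    rwa [QuotientGroup.out_eq', QuotientGroup.out_eq'] at h2
  not_le := by
    -- The unit `t` of trace zero gives an element `n(0, t ϖ^(n_K))` that survives in the reduction.
    have h0 : (0 : E) * D.conj 0 + t * D.ϖ ^ nK T + D.conj (t * D.ϖ ^ nK T) = 0 := by
      rw [map_mul, conj_ϖ_zpow]
      linear_combination D.ϖ ^ nK T * ht0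
    have h1 : D.nEl 0 (t * D.ϖ ^ nK T) h0 ∈ D.N (nK T) := by
      rw [nEl_mem_N, InP_mul_iff_of_val_eq_one ht]
      exact D.InP_of_eq rfl
    refine ⟨⟨_, D.I1_le_K T (D.N_le_I1 T h1)⟩, h1, fun hZ => ?_⟩
    have h2 := D.mem_N_of_mem_Z T h1 hZ
    rw [nEl_mem_N, InP_mul_iff_of_val_eq_one ht] at h2
    exact not_InP_zpow (by omega) h2

end TopologyOfG


/-! ### Residue classes: `N_k ⧸ N_{k+1}` as the set `L`. -/

section Residues

set_option linter.unusedSectionVars false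

variable {F E : Type*} [Field F] [ValuativeRel F] [TopologicalSpace F]
  [IsNonarchimedeanLocalField F] [Field E] [ValuativeRel E] [TopologicalSpace E]
  [IsNonarchimedeanLocalField E] [Algebra F E] [ValuativeExtension F E]
  [IsUnramifiedQuadratic F E] (D : Datum F E)

open Classical in
/-- The residue class of an element of `𝔬_E`. -/
noncomputable def res (x : E) : 𝓀[E] :=
  if h : valuation E x ≤ 1 then IsLocalRing.residue 𝒪[E] ⟨x, h⟩ else 0

theorem InP_zero_iff {x : E} : D.InP 0 x ↔ valuation E x ≤ 1 := by
  rw [InP, zpow_zero]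

theorem InP_one_iff {x : E} : D.InP 1 x ↔ valuation E x < 1 :=
  ⟨fun h => lt_of_le_of_lt h (by simpa using D.val_ϖ_lt_one), D.InP_of_val_lt_one⟩

theorem res_coe (x : 𝒪[E]) : res (x : E) = IsLocalRing.residue 𝒪[E] x := by
  rw [res, dif_pos (show valuation E (x : E) ≤ 1 from x.2)]

theorem res_surjective (a : 𝓀[E]) : ∃ x : E, D.InP 0 x ∧ res x = a := by
  obtain ⟨x, rfl⟩ := IsLocalRing.residue_surjective a
  exact ⟨x, D.InP_zero_iff.2 x.2, res_coe x⟩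

variable {D}

theorem res_add {x y : E} (hx : D.InP 0 x) (hy : D.InP 0 y) : res (x + y) = res x + res y := by
  have hx' := D.InP_zero_iff.1 hx
  have hy' := D.InP_zero_iff.1 hy
  rw [res, res, res, dif_pos hx', dif_pos hy', dif_pos (D.InP_zero_iff.1 (hx.add hy)), ← map_add]
  rfl

theorem res_mul {x y : E} (hx : D.InP 0 x) (hy : D.InP 0 y) : res (x * y) = res x * res y := by
  have hx' := D.InP_zero_iff.1 hx
  have hy' := D.InP_zero_iff.1 hy
  rw [res, res, res, dif_pos hx', dif_pos hy', dif_pos (D.InP_zero_iff.1 (hx.mul hy)), ← map_mul]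
  rfl

theorem res_conj {x : E} (hx : D.InP 0 x) : res (D.conj x) = D.conjRes (res x) := by
  have hx' := D.InP_zero_iff.1 hx
  rw [res, res, dif_pos hx', dif_pos (D.InP_zero_iff.1 (InP_conj_iff.2 hx))]
  rfl

theorem val_eq_one_iff_isUnit (x : 𝒪[E]) : valuation E (x : E) = 1 ↔ IsUnit x := by
  constructor
  · intro h
    have h0 : (x : E) ≠ 0 := val_ne_zero_of_eq_one h
    refine isUnit_iff_exists_inv.mpr ⟨⟨(x : E)⁻¹, ?_⟩, Subtype.ext (mul_inv_cancel₀ h0)⟩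
    rw [Valuation.mem_integer_iff, map_inv₀, h, inv_one]
  · intro h
    obtain ⟨y, hy⟩ := isUnit_iff_exists_inv.1 h
    have h2 := congrArg (fun z : 𝒪[E] => valuation E (z : E)) hy
    simp only [Subring.coe_mul, Subring.coe_one, map_mul, map_one] at h2
    exact le_antisymm x.2 (h2 ▸ mul_le_of_le_one_right' y.2)

theorem res_eq_zero_iff {x : E} (hx : D.InP 0 x) : res x = 0 ↔ D.InP 1 x := by
  have hx' := D.InP_zero_iff.1 hx
  rw [res, dif_pos hx', IsLocalRing.residue_eq_zero_iff, IsLocalRing.mem_maximalIdeal,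
    mem_nonunits_iff, ← val_eq_one_iff_isUnit, D.InP_one_iff, lt_iff_le_and_ne]
  exact ⟨fun h => ⟨hx', h⟩, fun h => h.2⟩

theorem InP_zero_of_InP_one {x : E} (hx : D.InP 1 x) : D.InP 0 x := hx.mono zero_le_one

theorem res_eq_iff {x y : E} (hx : D.InP 0 x) (hy : D.InP 0 y) :
    res x = res y ↔ D.InP 1 (y - x) := by
  have h1 : res y = res (y - x) + res x := by
    rw [← res_add (hy.sub hx) hx, sub_add_cancel]
  rw [h1, ← res_eq_zero_iff (hy.sub hx)]
  exact ⟨fun h => by simpa using h.symm, fun h => by rw [h, zero_add]⟩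

theorem val_two {p : ℕ} (hp : p.Prime) (hp2 : p ≠ 2) (hpP : D.InP 1 (p : E)) :
    valuation E (2 : E) = 1 := by
  have h0 : D.InP 0 (2 : E) := by
    rw [← one_add_one_eq_two]
    exact InP.one.add InP.one
  refine le_antisymm (D.InP_zero_iff.1 h0) (not_lt.1 fun hlt => ?_)
  obtain ⟨j, rfl⟩ := hp.odd_of_ne_two hp2
  have h1 := D.InP_of_val_lt_one hlt
  have h2 : ∀ j : ℕ, D.InP 0 (j : E) := fun j => by
    induction j with
    | zero => simpa using InP.zero
    | succ j ih =>
      rw [Nat.cast_succ]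
      exact ih.add InP.one
  have h3 : D.InP 1 (1 : E) := by
    have h4 := hpP.sub (h1.mul (h2 j))
    replace h4 : D.InP 1 (((2 * j + 1 : ℕ) : E) - 2 * (j : E)) := h4
    have h5 : ((2 * j + 1 : ℕ) : E) - 2 * (j : E) = 1 := by push_cast; ring
    rwa [h5] at h4
  rw [← zpow_zero D.ϖ] at h3
  exact not_InP_zpow (by norm_num) h3

variable (D)

open Classical in
/-- The reduction of `n(x, y)` in `N_k`, where `k = 2 l` for `r = 3` and `k = 2 l - 1` for
`r = 1`. -/
noncomputable def red (r : ℕ) (k l : ℤ) (x y : E) : 𝓀[E] × 𝓀[E] :=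
  (if r = 1 then 0 else res (D.ϖ ^ (-l) * x), res (D.ϖ ^ (-k) * y))

variable {D} {r : ℕ} {k l : ℤ}

theorem red_mem (hr : k = 2 * l ∧ r = 3 ∨ k = 2 * l - 1 ∧ r = 1) {x y : E}
    (h : x * D.conj x + y + D.conj y = 0) (hy : D.InP k y) : D.red r k l x y ∈ D.L r := by
  have hx : D.InP l x := InP_of_norm h hy (by omega)
  have hx0 : D.InP 0 (D.ϖ ^ (-l) * x) := InP_zpow_mul_iff.2 (hx.mono (by omega))
  have hy0 : D.InP 0 (D.ϖ ^ (-k) * y) := InP_zpow_mul_iff.2 (hy.mono (by omega))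
  -- For `r = 1`, `k` is odd and the norm of `x` lies in `𝔭^(2l) = 𝔭^(k+1)`, so it drops out of the
  -- equation and the residue of `y` alone has trace zero.
  have hP : D.InP 1 (if r = 1 then D.ϖ ^ (-k) * (x * D.conj x) else 0) := by
    split_ifs with h1
    · exact InP_zpow_mul_iff.2 ((hx.mul (InP_conj_iff.2 hx)).mono (by omega))
    · exact InP.zero
  rcases hr with ⟨rfl, rfl⟩ | ⟨rfl, rfl⟩
  · refine ⟨?_, fun h => absurd h (by decide)⟩
    simp only [red, if_neg (by decide : ¬ (3 = 1))]
    rw [← res_conj hx0, ← res_conj hy0, ← res_mul hx0 (InP_conj_iff.2 hx0),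
      ← res_add (hx0.mul (InP_conj_iff.2 hx0)) hy0, ← res_add ((hx0.mul (InP_conj_iff.2 hx0)).add hy0)
      (InP_conj_iff.2 hy0), map_mul, map_mul, D.conj_ϖ_zpow, D.conj_ϖ_zpow]
    have h1 : D.ϖ ^ (-(2 * l)) = D.ϖ ^ (-l) * D.ϖ ^ (-l) := by
      rw [← zpow_add₀ D.ϖ_ne_zero]; congr 1; ring
    have h2 : D.ϖ ^ (-l) * x * (D.ϖ ^ (-l) * D.conj x) + D.ϖ ^ (-(2 * l)) * y +
        D.ϖ ^ (-(2 * l)) * D.conj y = 0 := by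
      rw [h1]
      linear_combination D.ϖ ^ (-l) * D.ϖ ^ (-l) * h
    rw [h2, res_eq_zero_iff (InP.zero (D := D) (k := 0))]
    exact InP.zero
  · refine ⟨?_, fun _ => by simp [red]⟩
    simp only [red, if_true, zero_mul, zero_add]
    rw [← res_conj hy0, ← res_add hy0 (InP_conj_iff.2 hy0),
      res_eq_zero_iff (hy0.add (InP_conj_iff.2 hy0))]
    rw [if_pos rfl] at hP
    have h2 : D.ϖ ^ (-(2 * l - 1)) * y + D.conj (D.ϖ ^ (-(2 * l - 1)) * y) =
        -(D.ϖ ^ (-(2 * l - 1)) * (x * D.conj x)) := by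
      rw [map_mul, D.conj_ϖ_zpow]
      linear_combination D.ϖ ^ (-(2 * l - 1)) * h
    rw [h2]
    exact hP.neg

/-- The right side is the corner entry of `n(x, y)⁻¹ n(x', y')`: two elements have the same
reduction exactly when they agree modulo `N_{k+1}`. -/
theorem red_eq_iff (hr : k = 2 * l ∧ r = 3 ∨ k = 2 * l - 1 ∧ r = 1) {x y x' y' : E}
    (h : x * D.conj x + y + D.conj y = 0) (hy : D.InP k y)
    (h' : x' * D.conj x' + y' + D.conj y' = 0) (hy' : D.InP k y') :
    D.red r k l x y = D.red r k l x' y' ↔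
      D.InP (k + 1) (y' - y + x * D.conj (x' - x)) := by
  have hx : D.InP l x := InP_of_norm h hy (by omega)
  have hx' : D.InP l x' := InP_of_norm h' hy' (by omega)
  have hx0 : D.InP 0 (D.ϖ ^ (-l) * x) := InP_zpow_mul_iff.2 (hx.mono (by omega))
  have hy0 : D.InP 0 (D.ϖ ^ (-k) * y) := InP_zpow_mul_iff.2 (hy.mono (by omega))
  have hx0' : D.InP 0 (D.ϖ ^ (-l) * x') := InP_zpow_mul_iff.2 (hx'.mono (by omega))
  have hy0' : D.InP 0 (D.ϖ ^ (-k) * y') := InP_zpow_mul_iff.2 (hy'.mono (by omega))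
  have hz : (x' - x) * D.conj (x' - x) + (y' - y + x * D.conj (x' - x)) +
      D.conj (y' - y + x * D.conj (x' - x)) = 0 := by
    simp only [map_add, map_sub, map_mul, D.conj_conj]
    linear_combination h' - h
  have e2 : res (D.ϖ ^ (-k) * y) = res (D.ϖ ^ (-k) * y') ↔ D.InP (k + 1) (y' - y) := by
    rw [res_eq_iff hy0 hy0', ← mul_sub, InP_zpow_mul_iff, sub_neg_eq_add, add_comm]
  have e1 : res (D.ϖ ^ (-l) * x) = res (D.ϖ ^ (-l) * x') ↔ D.InP (l + 1) (x' - x) := by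
    rw [res_eq_iff hx0 hx0', ← mul_sub, InP_zpow_mul_iff, sub_neg_eq_add, add_comm]
  rw [red, red, Prod.mk.injEq, e2]
  constructor
  · rintro ⟨h1, h2⟩
    refine h2.add ?_
    rcases hr with ⟨rfl, rfl⟩ | ⟨rfl, rfl⟩
    · rw [if_neg (by decide), if_neg (by decide), e1] at h1
      exact (hx.mul (InP_conj_iff.2 h1)).mono (by omega)
    · exact (hx.mul (InP_conj_iff.2 (hx'.sub hx))).mono (by omega)
  · intro h1
    have h2 : D.InP (k + 1) (x * D.conj (x' - x)) := by
      rcases hr with ⟨rfl, rfl⟩ | ⟨rfl, rfl⟩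
      · exact (hx.mul (InP_conj_iff.2 (InP_of_norm hz h1 (le_refl (2 * (l + 1)) |>.trans
          (by omega))))).mono (by omega)
      · exact (hx.mul (InP_conj_iff.2 (hx'.sub hx))).mono (by omega)
    refine ⟨?_, by simpa using h1.sub h2⟩
    rcases hr with ⟨rfl, rfl⟩ | ⟨rfl, rfl⟩
    · rw [if_neg (by decide), if_neg (by decide), e1]
      exact InP_of_norm hz h1 (by omega)
    · rw [if_pos rfl, if_pos rfl]

theorem red_surjective (h2 : valuation E (2 : E) = 1)
    (hr : k = 2 * l ∧ r = 3 ∨ k = 2 * l - 1 ∧ r = 1) {a : 𝓀[E] × 𝓀[E]} (ha : a ∈ D.L r) :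
    ∃ x y, x * D.conj x + y + D.conj y = 0 ∧ D.InP k y ∧ D.red r k l x y = a := by
  obtain ⟨x₀, hx₀, hx⟩ := D.res_surjective a.1
  obtain ⟨t, ht, hta⟩ := D.res_surjective a.2
  have h20 := val_ne_zero_of_eq_one h2
  obtain ⟨x, hxc, e, he, hex⟩ : ∃ x : E, (if r = 1 then 0 else res (D.ϖ ^ (-l) * x)) = a.1 ∧
      ∃ e, D.InP 1 e ∧ e = D.ϖ ^ (-k) * (x * D.conj x) + t + D.conj t := by
    have hL := ha.1
    rcases hr with ⟨rfl, rfl⟩ | ⟨rfl, rfl⟩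
    · refine ⟨D.ϖ ^ l * x₀, ?_, _, ?_, rfl⟩
      · rw [if_neg (by decide), ← mul_assoc, ← zpow_add₀ D.ϖ_ne_zero, neg_add_cancel, zpow_zero,
          one_mul, hx]
      · have h1 : D.ϖ ^ (-(2 * l)) * (D.ϖ ^ l * x₀ * D.conj (D.ϖ ^ l * x₀)) = x₀ * D.conj x₀ := by
          have h3 : D.ϖ ^ (-(2 * l)) * D.ϖ ^ l * D.ϖ ^ l = 1 := by
            rw [← zpow_add₀ D.ϖ_ne_zero, ← zpow_add₀ D.ϖ_ne_zero,
              show -(2 * l) + l + l = 0 by ring, zpow_zero]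
          rw [map_mul, D.conj_ϖ_zpow]
          linear_combination x₀ * D.conj x₀ * h3
        rw [h1]
        have hP1 := hx₀.mul (InP_conj_iff.2 hx₀)
        have hP2 := hP1.add ht
        rw [← res_eq_zero_iff (hP2.add (InP_conj_iff.2 ht)), res_add hP2 (InP_conj_iff.2 ht),
          res_add hP1 ht, res_mul hx₀ (InP_conj_iff.2 hx₀), res_conj hx₀, res_conj ht, hx, hta, hL]
    · have h1 : a.1 = 0 := ha.2 rfl
      refine ⟨0, by rw [if_pos rfl, h1], _, ?_, rfl⟩
      rw [h1, zero_mul, zero_add] at hL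
      rw [zero_mul, mul_zero, zero_add, ← res_eq_zero_iff (ht.add (InP_conj_iff.2 ht)),
        res_add ht (InP_conj_iff.2 ht), res_conj ht, hta, hL]
  have hz : D.ϖ ^ k * D.ϖ ^ (-k) = 1 := by
    rw [← zpow_add₀ D.ϖ_ne_zero, add_neg_cancel, zpow_zero]
  have hec : D.conj e = e := by
    rw [hex]
    simp only [map_add, map_mul, D.conj_conj, D.conj_ϖ_zpow]
    ring
  have he2 : D.InP 1 (e / 2) := by
    rw [div_eq_mul_inv, mul_comm, InP_mul_iff_of_val_eq_one (by rw [map_inv₀, h2, inv_one])]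
    exact he
  -- `e` measures the failure of the lifted equation. It is fixed by conjugation and lies in `𝔭`, so
  -- subtracting `e / 2` restores the equation without changing the residue; this needs `2` to be a
  -- unit.
  refine ⟨x, D.ϖ ^ k * (t - e / 2), ?_, ?_, Prod.ext hxc ?_⟩
  · rw [map_mul, map_sub, map_div₀, hec, D.conj_ϖ_zpow, map_ofNat]
    have h3 : D.ϖ ^ k * (t - e / 2) + D.ϖ ^ k * (D.conj t - e / 2) =
        D.ϖ ^ k * (t + D.conj t - e) := by
      field_simp
      ring
    rw [add_assoc, h3, hex]
    linear_combination -(x * D.conj x) * hz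
  · rw [InP_zpow_mul_iff, sub_self]
    exact ht.sub (InP_zero_of_InP_one he2)
  · change res _ = _
    rw [← mul_assoc, ← zpow_add₀ D.ϖ_ne_zero, neg_add_cancel, zpow_zero, one_mul, ← hta,
      res_eq_iff (ht.sub (InP_zero_of_InP_one he2)) ht]
    simpa using he2

variable (D) in
/-- `n(X i, Y i)` are representatives of `N_k / N_{k + 1}`. -/
structure IsCoord {ι : Type*} (k : ℤ) (X Y : ι → E) : Prop where
  rel : ∀ i, X i * D.conj (X i) + Y i + D.conj (Y i) = 0
  mem : ∀ i, D.InP k (Y i)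
  ex : ∀ x y, x * D.conj x + y + D.conj y = 0 → D.InP k y →
    ∃ i, D.InP (k + 1) (y - Y i + X i * D.conj (x - X i))
  uniq : ∀ i j, D.InP (k + 1) (Y j - Y i + X i * D.conj (X j - X i)) → i = j

namespace IsCoord

variable {ι : Type*} {X Y : ι → E} (hc : D.IsCoord k X Y)
  (hr : k = 2 * l ∧ r = 3 ∨ k = 2 * l - 1 ∧ r = 1)

include hc hr

theorem red_injective : Function.Injective fun i => D.red r k l (X i) (Y i) := fun i j hij =>
  hc.uniq i j ((red_eq_iff hr (hc.rel i) (hc.mem i) (hc.rel j) (hc.mem j)).1 hij)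

theorem finite : Finite ι := Finite.of_injective _ (hc.red_injective hr)

/-- Reduction is injective on the chosen representatives and its image is all of `L`. -/
theorem finsum_red {M : Type*} [AddCommMonoid M] (h2 : valuation E (2 : E) = 1)
    (g : 𝓀[E] × 𝓀[E] → M) :
    ∑ᶠ i, g (D.red r k l (X i) (Y i)) = ∑ᶠ a ∈ D.L r, g a := by
  have hrange : Set.range (fun i => D.red r k l (X i) (Y i)) = D.L r := by
    ext a
    constructor
    · rintro ⟨i, rfl⟩
      exact red_mem hr (hc.rel i) (hc.mem i)
    · intro ha
      obtain ⟨x, y, hxy, hy, rfl⟩ := red_surjective h2 hr ha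
      obtain ⟨i, hi⟩ := hc.ex x y hxy hy
      exact ⟨i, (red_eq_iff hr (hc.rel i) (hc.mem i) hxy hy).2 hi⟩
  rw [← hrange, finsum_mem_range (hc.red_injective hr)]

theorem red_eq_zero_iff (i : ι) : D.red r k l (X i) (Y i) = (0, 0) ↔ D.InP (k + 1) (Y i) := by
  have h0 : D.red r k l 0 0 = (0, 0) := by
    have h1 : res (0 : E) = 0 := (res_eq_zero_iff (InP.zero (D := D) (k := 0))).2 InP.zero
    simp [red, h1]
  rw [← h0, red_eq_iff hr (hc.rel i) (hc.mem i) (by simp) InP.zero, ← InP_conj_iff (x := Y i)]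
  have h1 : 0 - Y i + X i * D.conj (0 - X i) = D.conj (Y i) := by
    simp only [map_sub, map_zero]
    linear_combination -hc.rel i
  rw [h1]

/-- A sum over representatives of `N_k / N_{k + 1}`, as a sum over `L`. -/
theorem finsum_eq {M : Type*} [AddCommMonoid M] (h2 : valuation E (2 : E) = 1)
    (Φ : ι → M) (A : M) (B : 𝓀[E] → M) (hA : ∀ i, D.InP (k + 1) (Y i) → Φ i = A)
    (hB : ∀ i, ¬ D.InP (k + 1) (Y i) → Φ i = B (res (D.ϖ ^ (-k) * Y i))) :
    ∑ᶠ i, Φ i = A + ∑ᶠ a ∈ D.L r \ {(0, 0)}, B a.2 := by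
  classical
  let g : 𝓀[E] × 𝓀[E] → M := fun a => if a = (0, 0) then A else B a.2
  have h1 : ∀ i, Φ i = g (D.red r k l (X i) (Y i)) := by
    intro i
    by_cases hi : D.InP (k + 1) (Y i)
    · rw [hA i hi]
      exact (if_pos ((hc.red_eq_zero_iff hr i).2 hi)).symm
    · rw [hB i hi]
      exact (if_neg (mt (hc.red_eq_zero_iff hr i).1 hi)).symm
  have h0 : ((0, 0) : 𝓀[E] × 𝓀[E]) ∈ D.L r := by simp [L]
  rw [finsum_congr h1, hc.finsum_red hr h2, ← Set.insert_sdiff_self_of_mem h0,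
    finsum_mem_insert _ (by simp) (Set.toFinite _)]
  refine congrArg₂ (· + ·) (if_pos rfl) (finsum_mem_congr (by simp) fun a ha => if_neg ?_)
  simpa using ha.2

end IsCoord

theorem natCast_eq_zero {p : ℕ} (hpP : D.InP 1 (p : E)) : (p : 𝓀[E]) = 0 := by
  have h1 : res ((p : 𝒪[E]) : E) = (p : 𝓀[E]) := by rw [res_coe, map_natCast]
  have h2 : ((p : 𝒪[E]) : E) = (p : E) := by simp
  rw [← h1, h2, res_eq_zero_iff (InP_zero_of_InP_one hpP)]
  exact hpP

-- Translation by `(0, t)`, with `t` a nonzero residue of trace zero, acts on `L` without fixed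
-- points, and its `p`-th power is the identity.
open Classical in
theorem dvd_card_L {p : ℕ} [Fact p.Prime] (hpP : D.InP 1 (p : E)) {t : E}
    (ht : valuation E t = 1) (ht0 : t + D.conj t = 0) : p ∣ Nat.card (D.L r) := by
  have hP : D.InP 0 t := D.InP_zero_iff.2 ht.le
  have hs0 : res t + D.conjRes (res t) = 0 := by
    rw [← res_conj hP, ← res_add hP (InP_conj_iff.2 hP), ht0, res_eq_zero_iff (InP.zero (D := D) (k := 0))]
    exact InP.zero
  have hs : res t ≠ 0 := fun h0 => by
    rw [res_eq_zero_iff hP, D.InP_one_iff, ht] at h0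
    exact lt_irrefl _ h0
  let f : Function.End (D.L r) := fun a => ⟨(a.1.1, a.1.2 + res t), by
    obtain ⟨h1, h2⟩ := a.2
    refine ⟨?_, h2⟩
    simp only [map_add]
    linear_combination h1 + hs0⟩
  have hpow : ∀ (n : ℕ) (a : D.L r),
      ((f ^ n) a : 𝓀[E] × 𝓀[E]) = (a.1.1, a.1.2 + n * res t) := by
    intro n
    induction n with
    | zero =>
      intro a
      rw [pow_zero, Nat.cast_zero, zero_mul, add_zero]
      rfl
    | succ n ih =>
      intro a
      rw [pow_succ']
      change (((f ^ n) a : 𝓀[E] × 𝓀[E]).1, ((f ^ n) a : 𝓀[E] × 𝓀[E]).2 + res t) = _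
      rw [ih]
      refine Prod.ext rfl ?_
      push_cast
      ring
  have := Fintype.ofFinite (D.L r)
  have hp := Equiv.Perm.card_fixedPoints_modEq (f := f) (p := p) (n := 1) (by
    funext a
    rw [pow_one]
    refine Subtype.ext ((hpow p a).trans ?_)
    rw [natCast_eq_zero hpP, zero_mul, add_zero]
    rfl)
  have hfix : IsEmpty (Function.fixedPoints f) := ⟨fun a => by
    have h1 := congrArg (fun b : D.L r => (b : 𝓀[E] × 𝓀[E]).2) a.2
    exact hs (add_eq_left.1 h1)⟩
  rw [Fintype.card_eq_zero_iff.2 hfix] at hp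
  rw [Nat.card_eq_fintype_card]
  exact (Nat.modEq_zero_iff_dvd).1 hp

theorem IsCoord.finsum_const {K W : Type*} [Field K] [AddCommGroup W] [Module K W] {p : ℕ}
    [Fact p.Prime] [CharP K p] {ι : Type*} {X Y : ι → E} (hc : D.IsCoord k X Y)
    (hr : k = 2 * l ∧ r = 3 ∨ k = 2 * l - 1 ∧ r = 1) (h2 : valuation E (2 : E) = 1)
    (hpP : D.InP 1 (p : E)) {t : E} (ht : valuation E t = 1) (ht0 : t + D.conj t = 0) (w : W) :
    ∑ᶠ _ : ι, w = 0 := by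
  have := Fintype.ofFinite (D.L r)
  have h1 := hc.finsum_red hr h2 fun _ => w
  rw [h1, ← finsum_set_coe_eq_finsum_mem, finsum_eq_sum_of_fintype, Finset.sum_const,
    Finset.card_univ, ← Nat.card_eq_fintype_card, ← Nat.cast_smul_eq_nsmul K,
    (CharP.cast_eq_zero_iff K p _).2 (dvd_card_L hpP ht ht0), zero_smul]

end Residues


/-! ### The character `χ_σ` on the line of `I₁`-fixed vectors. -/

section Weights

set_option linter.unusedSectionVars false

variable {F E : Type*} [Field F] [ValuativeRel F] [TopologicalSpace F]
  [IsNonarchimedeanLocalField F] [Field E] [ValuativeRel E] [TopologicalSpace E]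
  [IsNonarchimedeanLocalField E] [Algebra F E] [ValuativeExtension F E]
  [IsUnramifiedQuadratic F E] (D : Datum F E)
  {k W : Type*} [Field k] [AddCommGroup W] [Module k W] {T : MaxCompact}

/-- `v₀` spans the line of `I₁`-fixed vectors of `σ`, and `σ` is trivial on the kernel of
`K → Γ_K`. -/
structure IsWeightVector (σ : Representation k (D.K T) W) (v₀ : W) : Prop where
  ne_zero : v₀ ≠ 0
  mem : v₀ ∈ D.weightLine σ
  finrank_eq : Module.finrank k (D.weightLine σ) = 1
  trivial : ∀ z : D.K T, (z : D.G) ∈ D.Z T → ∀ x, σ z x = x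

variable {D} {σ : Representation k (D.K T) W} {v₀ : W}

theorem mem_weightLine_iff {v : W} :
    v ∈ D.weightLine σ ↔ ∀ κ : D.K T, (κ : D.G) ∈ D.I1 T → σ κ v = v :=
  mem_fixedBy_iff

namespace IsWeightVector

variable (h : D.IsWeightVector σ v₀)

include h

theorem fixed {κ : D.K T} (hκ : (κ : D.G) ∈ D.I1 T) : σ κ v₀ = v₀ :=
  mem_weightLine_iff.1 h.mem κ hκ

theorem exists_smul {v : W} (hv : v ∈ D.weightLine σ) : ∃ c : k, v = c • v₀ := by
  obtain ⟨c, hc⟩ := exists_smul_eq_of_finrank_eq_one h.finrank_eq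
    (x := (⟨v₀, h.mem⟩ : D.weightLine σ)) (fun h0 => h.ne_zero (congrArg Subtype.val h0)) ⟨v, hv⟩
  exact ⟨c, (congrArg Subtype.val hc).symm⟩

/-- `I` normalises `I₁` and so preserves the line; a scalar as sought in the definition of `χ`
therefore exists, and the choice made there is the right one. -/
theorem χ_smul (i : D.I T) {v : W} (hv : v ∈ D.weightLine σ) :
    σ (Subgroup.inclusion (D.I_le_K T) i) v = D.χ σ i • v := by
  refine Classical.epsilon_spec (p := fun c : k =>
    ∀ v ∈ D.weightLine σ, σ (Subgroup.inclusion (D.I_le_K T) i) v = c • v) ?_ v hv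
  have h1 : σ (Subgroup.inclusion (D.I_le_K T) i) v₀ ∈ D.weightLine σ := by
    rw [mem_weightLine_iff]
    intro κ hκ
    have h2 : (i : D.G)⁻¹ * κ * i ∈ D.I1 T := by
      have := D.I1_conj T (inv_mem i.2) hκ
      rwa [inv_inv] at this
    have h3 : κ * Subgroup.inclusion (D.I_le_K T) i =
        Subgroup.inclusion (D.I_le_K T) i * ⟨_, D.I1_le_K T h2⟩ := by
      refine Subtype.ext ?_
      change (κ : D.G) * i = i * ((i : D.G)⁻¹ * κ * i)
      group
    rw [← rep_mul_apply, h3, rep_mul_apply, h.fixed h2]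
  obtain ⟨c, hc⟩ := h.exists_smul h1
  refine ⟨c, fun v hv => ?_⟩
  obtain ⟨a, rfl⟩ := h.exists_smul hv
  rw [map_smul, hc, smul_comm]

/-- `I₁ = N_{n_K} Z`, and `Z` acts trivially. -/
theorem mem_weightLine_of_N {v : W}
    (hv : ∀ κ : D.K T, (κ : D.G) ∈ D.N (nK T) → σ κ v = v) : v ∈ D.weightLine σ := by
  rw [mem_weightLine_iff]
  intro κ hκ
  obtain ⟨n, hn, z, hz, he⟩ := D.I1_decomp T hκ
  have h1 : κ = ⟨n, D.I1_le_K T (D.N_le_I1 T hn)⟩ * ⟨z, D.Z_le_K T hz⟩ := Subtype.ext he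
  rw [h1, rep_mul_apply, h.trivial ⟨z, _⟩ hz, hv ⟨n, _⟩ hn]

/-- `χ_σ(h(z))` depends only on the residue class of `z`. -/
theorem dEl_smul {z : E} (hz : valuation E z = 1) {b : E} (hb0 : b = -D.conj z * z⁻¹) (ha hb) :
    σ ⟨D.dEl z b ha hb, D.I_le_K T (D.dEl_mem_I T hz)⟩ v₀ = D.χh σ (res z) • v₀ := by
  have hz0 : D.InP 0 z := D.InP_zero_iff.2 hz.le
  have hne : res z ≠ 0 := fun h0 => by
    rw [res_eq_zero_iff hz0, D.InP_one_iff, hz] at h0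
    exact lt_irrefl _ h0
  rw [χh, dif_pos hne]
  generalize hu : Function.surjInv _ (Units.mk0 (res z) hne) = u
  have hu' : IsLocalRing.residue 𝒪[E] (u : 𝒪[E]) = res z := by
    have h1 := Function.surjInv_eq
      (IsLocalRing.surjective_units_map_of_local_ringHom (IsLocalRing.residue 𝒪[E])
        IsLocalRing.residue_surjective inferInstance) (Units.mk0 (res z) hne)
    rw [hu] at h1
    exact congrArg Units.val h1
  have huv : valuation E ((u : 𝒪[E]) : E) = 1 := (val_eq_one_iff_isUnit _).2 u.isUnit
  rw [← res_coe, res_eq_iff (D.InP_zero_iff.2 huv.le) hz0] at hu'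
  generalize hU : ((u : 𝒪[E]) : E) = U at hu' huv
  have hU0 := val_ne_zero_of_eq_one huv
  have hUc : D.conj U ≠ 0 := by simpa using hU0
  have hzc : D.conj z ≠ 0 := by simpa using ha
  have hvU : valuation E U⁻¹ = 1 := by rw [map_inv₀, huv, inv_one]
  have hvz : valuation E z⁻¹ = 1 := by rw [map_inv₀, hz, inv_one]
  have hhI : ((D.hI T u : D.I T) : D.G) = D.dEl U (-D.conj U * U⁻¹) hU0 (D.norm_unit hU0) := by
    subst hU
    rfl
  -- Two lifts of the same residue class differ by a torus element congruent to `1` modulo `𝔭`; it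
  -- lies in `I₁` and fixes `v₀`.
  let e := (D.dEl U (-D.conj U * U⁻¹) hU0 (D.norm_unit hU0))⁻¹ * D.dEl z b ha hb
  have he : e = D.dEl (U⁻¹ * z) (D.conj (-D.conj U * U⁻¹) * b) (mul_ne_zero (inv_ne_zero hU0) ha)
      (by
        have h1 := D.norm_unit hU0
        have h2 := D.conj_conj (-D.conj U * U⁻¹)
        rw [map_mul D.conj (D.conj _) b, h2]
        linear_combination b * D.conj b * h1 + hb) := by
    change _ * _ = _
    rw [dEl_inv, dEl_mul]
  have he1 : e ∈ D.I1 T := by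
    refine ⟨?_, fun i => ?_⟩
    · rw [he]
      exact D.dEl_mem_I T (by rw [map_mul, hvU, hz, one_mul])
    · rw [he, mat_dEl]
      fin_cases i
      · have h1 : U⁻¹ * z - 1 = U⁻¹ * (z - U) := by field_simp
        simp only [Fin.zero_eta, Matrix.of_apply, Matrix.cons_val', Matrix.cons_val_zero]
        rw [h1, InP_mul_iff_of_val_eq_one hvU]
        exact hu'
      · have h1 : D.conj (-D.conj U * U⁻¹) * b - 1 =
            z⁻¹ * ((D.conj U)⁻¹ * (U * D.conj (z - U) - (z - U) * D.conj U)) := by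
          rw [hb0]
          simp only [map_mul, map_neg, map_inv₀, D.conj_conj, map_sub]
          field_simp
          ring
        simp only [Fin.mk_one, Matrix.of_apply, Matrix.cons_val', Matrix.cons_val_one]
        simp only [Matrix.cons_val_zero]
        rw [h1, InP_mul_iff_of_val_eq_one hvz,
          InP_mul_iff_of_val_eq_one (by rw [map_inv₀, valuation_aut, huv, inv_one])]
        refine InP.sub ?_ ?_
        · rw [InP_mul_iff_of_val_eq_one huv, InP_conj_iff]
          exact hu'
        · rw [mul_comm, InP_mul_iff_of_val_eq_one (by rw [valuation_aut, huv])]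
          exact hu'
      · have h1 : (D.conj (U⁻¹ * z))⁻¹ - 1 = (D.conj z)⁻¹ * (-D.conj (z - U)) := by
          simp only [map_mul, map_inv₀, map_sub]
          field_simp
          ring
        change D.InP 1 ((D.conj (U⁻¹ * z))⁻¹ - 1)
        rw [h1, InP_mul_iff_of_val_eq_one (by rw [map_inv₀, valuation_aut, hz, inv_one])]
        exact (InP_conj_iff.2 hu').neg
  have hmul : (⟨D.dEl z b ha hb, D.I_le_K T (D.dEl_mem_I T hz)⟩ : D.K T) =
      Subgroup.inclusion (D.I_le_K T) (D.hI T u) * ⟨e, D.I1_le_K T he1⟩ := by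
    refine Subtype.ext ?_
    change D.dEl z b ha hb = (D.hI T u : D.I T) * e
    rw [hhI, mul_inv_cancel_left]
  rw [hmul, rep_mul_apply, h.fixed (κ := ⟨e, D.I1_le_K T he1⟩) he1, h.χ_smul _ h.mem]

end IsWeightVector

end Weights

/-! ### The basis `f_n` of the `I₁`-fixed vectors. -/

section HeckeFunctions

set_option linter.unusedSectionVars false

variable {F E : Type*} [Field F] [ValuativeRel F] [TopologicalSpace F]
  [IsNonarchimedeanLocalField F] [Field E] [ValuativeRel E] [TopologicalSpace E]
  [IsNonarchimedeanLocalField E] [Algebra F E] [ValuativeExtension F E]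
  [IsUnramifiedQuadratic F E] (D : Datum F E)
  {k W : Type*} [Field k] [AddCommGroup W] [Module k W] {T : MaxCompact}

/-- The functions on `G` which are left `K`-equivariant and right `I₁`-invariant. -/
structure IsHecke (σ : Representation k (D.K T) W) (f : D.G → W) : Prop where
  left : ∀ (κ : D.K T) (g : D.G), f (κ * g) = σ κ (f g)
  right : ∀ i ∈ D.I1 T, ∀ g, f (g * i) = f g

/-- The double coset `K α⁻ⁿ I₁`. -/
def cell (T : MaxCompact) (n : ℤ) : Set D.G :=
  {g | ∃ κ : D.K T, ∃ i ∈ D.I1 T, g = κ * D.α ^ (-n) * i}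

/-- The prescribed value of `f_n` at `α⁻ⁿ`. -/
noncomputable def cellValue (σ : Representation k (D.K T) W) (v₀ : W) (n : ℤ) : W :=
  if 0 < n then σ (D.wK T) v₀ else v₀

open Classical in
/-- The function `f_n`. -/
noncomputable def cellFun (σ : Representation k (D.K T) W) (v₀ : W) (n : ℤ) (g : D.G) : W :=
  if h : ∃ κ : D.K T, ∃ i ∈ D.I1 T, g = κ * D.α ^ (-n) * i then
    σ h.choose (D.cellValue σ v₀ n) else 0

theorem isOpen_cell (n : ℤ) : IsOpen (D.cell T n) := by
  have h : D.cell T n = ⋃ κ : D.K T, (fun g => (κ * D.α ^ (-n))⁻¹ * g) ⁻¹' (D.I1 T : Set D.G) := by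
    ext g
    simp only [Set.mem_iUnion]
    constructor
    · rintro ⟨κ, i, hi, rfl⟩
      refine ⟨κ, ?_⟩
      change (κ * D.α ^ (-n) : D.G)⁻¹ * (κ * D.α ^ (-n) * i) ∈ D.I1 T
      rwa [inv_mul_cancel_left]
    · rintro ⟨κ, hκ⟩
      exact ⟨κ, _, hκ, (mul_inv_cancel_left _ _).symm⟩
  rw [h]
  exact isOpen_iUnion fun κ => (D.isOpen_I1 T).preimage (continuous_const_mul _)

theorem exists_mem_cell (g : D.G) : ∃ n, g ∈ D.cell T n := by
  obtain ⟨κ, hκ, n, i, hi, h⟩ := D.exists_alpha T g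
  exact ⟨-n, ⟨κ, hκ⟩, i, hi, by rw [neg_neg, h]⟩

theorem eq_of_α_mem_cell {m n : ℤ} (h : D.α ^ (-m) ∈ D.cell T n) : m = n := by
  obtain ⟨κ, i, hi, h⟩ := h
  exact neg_injective (D.alpha_unique T κ.2 hi h)

variable {D} {σ : Representation k (D.K T) W} {v₀ : W}

theorem IsHecke.ext {f f' : D.G → W} (hf : D.IsHecke σ f) (hf' : D.IsHecke σ f')
    (h : ∀ m : ℤ, f (D.α ^ (-m)) = f' (D.α ^ (-m))) : f = f' := by
  funext g
  obtain ⟨n, κ, i, hi, rfl⟩ := D.exists_mem_cell (T := T) g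
  rw [hf.right _ hi, hf'.right _ hi, hf.left, hf'.left, h]

theorem IsHecke.of_mem {f : D.compInd σ} (hf : f ∈ fixedBy (D.ind σ) (D.I1 T)) :
    D.IsHecke σ f where
  left := f.2.1
  right i hi g := congrFun (congrArg Subtype.val (mem_fixedBy_iff.1 hf i hi)) g

theorem wK_smul_wK (x : W) : σ (D.wK T) (σ (D.wK T) x) = x := by
  rw [← rep_mul_apply]
  have : D.wK T * D.wK T = 1 := Subtype.ext (D.βK_mul_self T)
  rw [this, map_one, Module.End.one_apply]

/-- The value prescribed at `α⁻ⁿ` must be fixed by `K ∩ α⁻ⁿ I₁ αⁿ`. For `n ≤ 0` this group lies in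
`I₁`; for `n > 0` only its conjugate by `β_K` does, which is why the value is then `β_K v₀`. -/
theorem IsWeightVector.cellValue_fixed (h : D.IsWeightVector σ v₀) {n : ℤ} {κ : D.K T} {i : D.G}
    (hi : i ∈ D.I1 T) (hκ : (κ : D.G) = D.α ^ (-n) * i * D.α ^ n) :
    σ κ (D.cellValue σ v₀ n) = D.cellValue σ v₀ n := by
  have hK : D.α ^ (-n) * i * D.α ^ (-(-n)) ∈ D.K T := by
    rw [neg_neg, ← hκ]
    exact κ.2
  rw [cellValue]
  split_ifs with hn
  · have h1 := D.βK_conj_mem_I1_of_α_conj T hi (neg_lt_zero.2 hn) hK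
    have h2 : κ * D.wK T = D.wK T * ⟨_, D.I1_le_K T h1⟩ := by
      refine Subtype.ext ?_
      change (κ : D.G) * D.βK T =
        D.βK T * (D.βK T * (D.α ^ (-n) * i * D.α ^ (-(-n))) * D.βK T)
      rw [← mul_assoc, ← mul_assoc (D.βK T) (D.βK T), βK_mul_self, one_mul, neg_neg, ← hκ]
    rw [← rep_mul_apply, h2, rep_mul_apply, h.fixed h1]
  · have h1 := D.mem_I1_of_α_conj T hi (by omega) hK
    refine h.fixed ?_
    rwa [neg_neg, ← hκ] at h1

theorem IsWeightVector.cellFun_apply (h : D.IsWeightVector σ v₀) (n : ℤ) (κ : D.K T) {i : D.G}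
    (hi : i ∈ D.I1 T) :
    D.cellFun σ v₀ n (κ * D.α ^ (-n) * i) = σ κ (D.cellValue σ v₀ n) := by
  have hex : ∃ κ' : D.K T, ∃ i' ∈ D.I1 T, κ * D.α ^ (-n) * i = κ' * D.α ^ (-n) * i' :=
    ⟨κ, i, hi, rfl⟩
  rw [cellFun, dif_pos hex]
  obtain ⟨i', hi', he⟩ := hex.choose_spec
  generalize hex.choose = κ' at he
  have h1 : ((κ⁻¹ * κ' : D.K T) : D.G) = D.α ^ (-n) * (i * i'⁻¹) * D.α ^ n := by
    change (κ : D.G)⁻¹ * κ' = _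
    have h2 : (κ' : D.G) = κ * D.α ^ (-n) * i * i'⁻¹ * (D.α ^ (-n))⁻¹ := by
      rw [he]
      group
    rw [h2]
    group
  have h3 := h.cellValue_fixed (mul_mem hi (inv_mem hi')) h1
  have h4 : κ' = κ * (κ⁻¹ * κ') := (mul_inv_cancel_left _ _).symm
  rw [h4, rep_mul_apply, h3]

theorem cellFun_of_notMem {n : ℤ} {g : D.G} (hg : g ∉ D.cell T n) : D.cellFun σ v₀ n g = 0 :=
  dif_neg hg

theorem IsWeightVector.isHecke_cellFun (h : D.IsWeightVector σ v₀) (n : ℤ) :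
    D.IsHecke σ (D.cellFun σ v₀ n) where
  left κ g := by
    by_cases hg : g ∈ D.cell T n
    · obtain ⟨κ', i, hi, rfl⟩ := hg
      have h1 : (κ : D.G) * (κ' * D.α ^ (-n) * i) = ((κ * κ' : D.K T) : D.G) * D.α ^ (-n) * i := by
        rw [Subgroup.coe_mul]
        group
      rw [h1, h.cellFun_apply n _ hi, h.cellFun_apply n _ hi, rep_mul_apply]
    · rw [cellFun_of_notMem hg, cellFun_of_notMem, map_zero]
      rintro ⟨κ', i, hi, he⟩
      refine hg ⟨κ⁻¹ * κ', i, hi, ?_⟩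
      rw [Subgroup.coe_mul, Subgroup.coe_inv, mul_assoc, mul_assoc, ← mul_assoc (κ' : D.G), ← he,
        inv_mul_cancel_left]
  right i hi g := by
    by_cases hg : g ∈ D.cell T n
    · obtain ⟨κ', i', hi', rfl⟩ := hg
      rw [mul_assoc, h.cellFun_apply n _ hi', h.cellFun_apply n _ (mul_mem hi' hi)]
    · rw [cellFun_of_notMem hg, cellFun_of_notMem]
      rintro ⟨κ', i', hi', he⟩
      exact hg ⟨κ', i' * i⁻¹, mul_mem hi' (inv_mem hi), by rw [← mul_assoc, ← he]; group⟩

theorem IsWeightVector.cellFun_mem (h : D.IsWeightVector σ v₀) (n : ℤ) :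
    D.cellFun σ v₀ n ∈ D.compInd σ := by
  have := t2Space E
  have hH := h.isHecke_cellFun n
  refine ⟨hH.left, ⟨D.I1 T, D.isOpen_I1 T, fun u hu g => hH.right u hu g⟩, ?_⟩
  have hc : IsCompact ((fun a : D.G × D.G => a.1 * D.α ^ (-n) * a.2) ''
      ((D.K T : Set D.G) ×ˢ (D.K T : Set D.G))) := by
    refine ((D.isCompact_K T).prod (D.isCompact_K T)).image ?_
    fun_prop
  refine HasCompactSupport.intro hc fun g hg => cellFun_of_notMem fun hg' => hg ?_
  obtain ⟨κ, i, hi, rfl⟩ := hg'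
  exact ⟨(κ, i), ⟨κ.2, D.I1_le_K T hi⟩, rfl⟩

/-- The function `f_n`, as an element of the space of `I₁`-fixed vectors. -/
noncomputable def IsWeightVector.fn (h : D.IsWeightVector σ v₀) (n : ℤ) :
    fixedBy (D.ind σ) (D.I1 T) :=
  ⟨⟨D.cellFun σ v₀ n, h.cellFun_mem n⟩, mem_fixedBy_iff.2 fun i hi =>
    Subtype.ext (funext fun g => (h.isHecke_cellFun n).right i hi g)⟩

theorem IsWeightVector.cellFun_α (h : D.IsWeightVector σ v₀) (m n : ℤ) :
    D.cellFun σ v₀ n (D.α ^ (-m)) = if m = n then D.cellValue σ v₀ n else 0 := by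
  split_ifs with hmn
  · subst hmn
    have h1 := h.cellFun_apply m 1 (one_mem (D.I1 T))
    rwa [Subgroup.coe_one, one_mul, mul_one, map_one, Module.End.one_apply] at h1
  · exact cellFun_of_notMem fun hm => hmn (D.eq_of_α_mem_cell hm)

theorem IsWeightVector.cellValue_ne_zero (h : D.IsWeightVector σ v₀) (n : ℤ) :
    D.cellValue σ v₀ n ≠ 0 := by
  rw [cellValue]
  split_ifs with hn
  · intro h0
    refine h.ne_zero ?_
    rw [← wK_smul_wK (σ := σ) v₀, h0, map_zero]
  · exact h.ne_zero

/-- For `j ≥ 0`, conjugation by `α⁻ʲ` maps `N_{n_K}` into itself, so right invariance makes `f(αʲ)`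
fixed by `N_{n_K}`. -/
theorem IsHecke.exists_smul_of_nonneg {f : D.G → W} (hf : D.IsHecke σ f)
    (h : D.IsWeightVector σ v₀) {j : ℤ} (hj : 0 ≤ j) : ∃ c : k, f (D.α ^ j) = c • v₀ := by
  refine h.exists_smul (h.mem_weightLine_of_N fun κ hκ => ?_)
  obtain ⟨u, hu, he⟩ := D.α_conj_N (n := -j) (l := nK T) (by omega) hκ
  have h1 : (κ : D.G) * D.α ^ j = D.α ^ j * u := by
    have h2 : u = D.α ^ (-j) * κ * D.α ^ j := by
      rw [he]
      group
    rw [h2]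
    group
  rw [← hf.left, h1, hf.right _ (D.N_le_I1 T hu)]

/-- The same argument applied to `β_K f(α⁻ʲ) = f(αʲ β_K)`. Here `j > 0` is needed: the conjugate
must lie in `N_{n_K + 1}` for `β_K` to carry it into `N'_{m_K}`. -/
theorem IsHecke.exists_smul_of_pos {f : D.G → W} (hf : D.IsHecke σ f)
    (h : D.IsWeightVector σ v₀) {j : ℤ} (hj : 0 < j) :
    ∃ c : k, f (D.α ^ (-j)) = c • σ (D.wK T) v₀ := by
  have h0 : σ (D.wK T) (f (D.α ^ (-j))) = f (D.α ^ j * D.βK T) := by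
    rw [← hf.left, wK, D.βK_mul_α_zpow, neg_neg]
  have h4 : σ (D.wK T) (f (D.α ^ (-j))) ∈ D.weightLine σ := by
    refine h.mem_weightLine_of_N fun κ hκ => ?_
    obtain ⟨u, hu, he⟩ := D.α_conj_N (n := -j) (l := nK T + 1) (by omega) hκ
    have h3 := D.βK_conj_N T hu
    have h1 : (κ : D.G) * (D.α ^ j * D.βK T) =
        D.α ^ j * D.βK T * ((D.βK T)⁻¹ * u * D.βK T) := by
      have h2 : u = D.α ^ (-j) * κ * D.α ^ j := by
        rw [he]
        group
      rw [h2]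
      group
    rw [h0, ← hf.left, h1, hf.right _ (D.N'_le_I1 T h3)]
  obtain ⟨c, hc⟩ := h.exists_smul h4
  exact ⟨c, by rw [← map_smul, ← hc, wK_smul_wK]⟩

theorem IsHecke.exists_smul {f : D.G → W} (hf : D.IsHecke σ f)
    (h : D.IsWeightVector σ v₀) (n : ℤ) : ∃ c : k, f (D.α ^ (-n)) = c • D.cellValue σ v₀ n := by
  rw [cellValue]
  split_ifs with hn
  · exact hf.exists_smul_of_pos h hn
  · exact hf.exists_smul_of_nonneg h (by omega)

/-- The cells form an open cover of the compact support, and each contains only one power of `α`. -/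
theorem finite_support_α (T : MaxCompact) {f : D.G → W} (hf : HasCompactSupport f) :
    {n : ℤ | f (D.α ^ (-n)) ≠ 0}.Finite := by
  obtain ⟨t, ht⟩ := hf.isCompact.elim_finite_subcover (fun n => D.cell T n)
    (fun n => D.isOpen_cell n) fun g _ => Set.mem_iUnion.2 (D.exists_mem_cell g)
  refine t.finite_toSet.subset fun n hn => ?_
  obtain ⟨m, hm, hmn⟩ := Set.mem_iUnion₂.1 (ht (subset_tsupport f hn))
  rw [D.eq_of_α_mem_cell hmn]
  exact hm

theorem IsWeightVector.sum_apply (h : D.IsWeightVector σ v₀) (s : Finset ℤ) (a : ℤ → k) (m : ℤ) :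
    (((∑ n ∈ s, a n • h.fn n : fixedBy (D.ind σ) (D.I1 T)) : D.compInd σ) : D.G → W)
      (D.α ^ (-m)) = ∑ n ∈ s, if m = n then a n • D.cellValue σ v₀ n else 0 := by
  simp only [Submodule.coe_sum, Finset.sum_apply, Submodule.coe_smul, Pi.smul_apply]
  refine Finset.sum_congr rfl fun n _ => ?_
  have h1 := h.cellFun_α m n
  rw [← smul_ite_zero, ← h1]
  rfl

theorem IsWeightVector.linearIndependent (h : D.IsWeightVector σ v₀) :
    LinearIndependent k h.fn := by
  rw [linearIndependent_iff'ₛ]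
  intro s a b hab m hm
  have h1 := congrArg (fun f : fixedBy (D.ind σ) (D.I1 T) =>
    ((f : D.compInd σ) : D.G → W) (D.α ^ (-m))) hab
  rw [h.sum_apply, h.sum_apply, Finset.sum_ite_eq, Finset.sum_ite_eq, if_pos hm, if_pos hm] at h1
  rw [← sub_eq_zero, ← sub_smul] at h1
  exact sub_eq_zero.1 ((smul_eq_zero.1 h1).resolve_right (h.cellValue_ne_zero m))

theorem IsWeightVector.span_eq_top (h : D.IsWeightVector σ v₀) :
    ⊤ ≤ Submodule.span k (Set.range h.fn) := by
  rintro f -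
  have hf := IsHecke.of_mem f.2
  choose c hc using hf.exists_smul h
  have hcs : HasCompactSupport ((f : D.compInd σ) : D.G → W) := f.1.2.2.2
  have hfin := finite_support_α T hcs
  have h1 : f = ∑ n ∈ hfin.toFinset, c n • h.fn n := by
    refine Subtype.ext (Subtype.ext ?_)
    refine hf.ext (IsHecke.of_mem (∑ n ∈ hfin.toFinset, c n • h.fn n).2) fun m => ?_
    rw [h.sum_apply, Finset.sum_ite_eq]
    split_ifs with hm
    · exact hc m
    · simpa using hm
  rw [h1]
  exact Submodule.sum_mem _ fun n _ => Submodule.smul_mem _ _ (Submodule.subset_span ⟨n, rfl⟩)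

theorem IsWeightVector.isBasisFunction (h : D.IsWeightVector σ v₀) (n : ℤ) :
    D.IsBasisFunction σ v₀ n (D.cellFun σ v₀ n) := by
  refine ⟨fun g hg => ?_, ?_⟩
  · by_contra h0
    refine hg (cellFun_of_notMem fun hg' => h0 ?_)
    obtain ⟨κ, i, hi, he⟩ := hg'
    exact ⟨κ, κ.2, i, hi, he⟩
  · rw [h.cellFun_α, if_pos rfl]
    rfl

end HeckeFunctions


/-! ### The operators `S_K` and `S_-` preserve `I₁`-fixed vectors. -/

section Operators

set_option linter.unusedSectionVars false

variable {F E : Type*} [Field F] [ValuativeRel F] [TopologicalSpace F]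
  [IsNonarchimedeanLocalField F] [Field E] [ValuativeRel E] [TopologicalSpace E]
  [IsNonarchimedeanLocalField E] [Algebra F E] [ValuativeExtension F E]
  [IsUnramifiedQuadratic F E] (D : Datum F E)

theorem nEl_inv_mul {x y x' y' : E} (h h') : (D.nEl x y h)⁻¹ * D.nEl x' y' h' =
    D.nEl (x' - x) (y' - y + x * D.conj (x' - x)) (by
      simp only [map_add, map_sub, map_mul, D.conj_conj]
      linear_combination h' - h) := by
  rw [inv_mul_eq_iff_eq_mul]
  apply D.mat_injective
  ext i j
  fin_cases i <;> fin_cases j <;>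
    simp [nMat, Matrix.mul_apply, Fin.sum_univ_three] <;> ring

theorem nEl'_inv_mul {x y x' y' : E} (h h') : (D.nEl' x y h)⁻¹ * D.nEl' x' y' h' =
    D.nEl' (x' - x) (y' - y + D.conj x * (x' - x)) (by
      simp only [map_add, map_sub, map_mul, D.conj_conj]
      linear_combination h' - h) := by
  rw [inv_mul_eq_iff_eq_mul]
  apply D.mat_injective
  ext i j
  fin_cases i <;> fin_cases j <;>
    simp [nMat', Matrix.mul_apply, Fin.sum_univ_three] <;> ring

theorem rep_mul_mem_N (k : ℤ) {u : D.G} (hu : u ∈ D.N k) :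
    ∃ j : D.N k ⧸ (D.N (k + 1)).subgroupOf (D.N k),
      ((j.out : D.N k) : D.G)⁻¹ * u ∈ D.N (k + 1) := by
  have h1 := QuotientGroup.eq.1 (QuotientGroup.out_eq'
    ((⟨u, hu⟩ : D.N k) : D.N k ⧸ (D.N (k + 1)).subgroupOf (D.N k)))
  exact ⟨_, h1⟩

theorem rep_unique_N (k : ℤ) {i j : D.N k ⧸ (D.N (k + 1)).subgroupOf (D.N k)}
    (h : ((i.out : D.N k) : D.G)⁻¹ * (j.out : D.N k) ∈ D.N (k + 1)) : i = j := by
  have h1 : (i.out)⁻¹ * j.out ∈ (D.N (k + 1)).subgroupOf (D.N k) := h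
  have h2 := QuotientGroup.eq.2 h1
  rwa [QuotientGroup.out_eq', QuotientGroup.out_eq'] at h2

theorem rep_mul_mem_N' (k : ℤ) {u : D.G} (hu : u ∈ D.N' k) :
    ∃ j : D.N' k ⧸ (D.N' (k + 1)).subgroupOf (D.N' k),
      ((j.out : D.N' k) : D.G)⁻¹ * u ∈ D.N' (k + 1) := by
  have h1 := QuotientGroup.eq.1 (QuotientGroup.out_eq'
    ((⟨u, hu⟩ : D.N' k) : D.N' k ⧸ (D.N' (k + 1)).subgroupOf (D.N' k)))
  exact ⟨_, h1⟩

theorem rep_unique_N' (k : ℤ) {i j : D.N' k ⧸ (D.N' (k + 1)).subgroupOf (D.N' k)}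
    (h : ((i.out : D.N' k) : D.G)⁻¹ * (j.out : D.N' k) ∈ D.N' (k + 1)) : i = j := by
  have h1 : (i.out)⁻¹ * j.out ∈ (D.N' (k + 1)).subgroupOf (D.N' k) := h
  have h2 := QuotientGroup.eq.2 h1
  rwa [QuotientGroup.out_eq', QuotientGroup.out_eq'] at h2

theorem exists_isCoord_N (k : ℤ) : ∃ X Y : D.N k ⧸ (D.N (k + 1)).subgroupOf (D.N k) → E,
    ∃ hc : D.IsCoord k X Y, ∀ u, ((u.out : D.N k) : D.G) = D.nEl (X u) (Y u) (hc.rel u) := by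
  choose X Y h hY hu using fun u : D.N k ⧸ (D.N (k + 1)).subgroupOf (D.N k) =>
    D.exists_eq_nEl u.out.2
  refine ⟨X, Y, ⟨h, hY, fun x y hxy hy => ?_, fun i j hij => D.rep_unique_N k ?_⟩, hu⟩
  · obtain ⟨j, hj⟩ := D.rep_mul_mem_N k ((D.nEl_mem_N (h := hxy)).2 hy)
    rw [hu, nEl_inv_mul, nEl_mem_N] at hj
    exact ⟨j, hj⟩
  · rw [hu, hu, nEl_inv_mul, nEl_mem_N]
    exact hij

/-- The product law of `n'` has `x̄` where that of `n` has `x`; taking the conjugate as coordinate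
lets `IsCoord` serve both groups. -/
theorem exists_isCoord_N' (k : ℤ) : ∃ X Y : D.N' k ⧸ (D.N' (k + 1)).subgroupOf (D.N' k) → E,
    D.IsCoord k X Y ∧ ∀ u, ∃ h, ((u.out : D.N' k) : D.G) = D.nEl' (D.conj (X u)) (Y u) h := by
  choose X Y h hY hu using fun u : D.N' k ⧸ (D.N' (k + 1)).subgroupOf (D.N' k) =>
    D.exists_eq_nEl' u.out.2
  refine ⟨fun u => D.conj (X u), Y, ⟨fun u => ?_, hY, fun x y hxy hy => ?_,
    fun i j hij => D.rep_unique_N' k ?_⟩, fun u => ⟨by rw [D.conj_conj]; exact h u, ?_⟩⟩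
  · rw [D.conj_conj, mul_comm]
    exact h u
  · have hxy' : D.conj x * D.conj (D.conj x) + y + D.conj y = 0 := by
      rw [D.conj_conj, mul_comm]
      exact hxy
    obtain ⟨j, hj⟩ := D.rep_mul_mem_N' k ((D.nEl'_mem_N' (h := hxy')).2 hy)
    rw [hu, nEl'_inv_mul, nEl'_mem_N'] at hj
    refine ⟨j, ?_⟩
    rw [map_sub, D.conj_conj]
    exact hj
  · rw [hu, hu, nEl'_inv_mul, nEl'_mem_N']
    rw [map_sub, D.conj_conj, D.conj_conj] at hij
    exact hij
  · rw [hu]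
    exact D.nEl'_congr _ _ (D.conj_conj _).symm rfl

theorem val_eq_one_of_not_InP {k : ℤ} {y : E} (hy : D.InP k y) (hy' : ¬ D.InP (k + 1) y) :
    valuation E (D.ϖ ^ (-k) * y) = 1 := by
  refine le_antisymm (D.InP_zero_iff.1 (InP_zpow_mul_iff.2 (hy.mono (by omega))))
    (not_lt.1 fun hlt => hy' ?_)
  have h1 := D.InP_of_val_lt_one hlt
  rw [InP_zpow_mul_iff] at h1
  exact h1.mono (by omega)

theorem InP_inv_of_not_InP {k : ℤ} {y : E} (hy : ¬ D.InP (k + 1) y) : D.InP (-k) y⁻¹ :=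
  (InP_of_not_InP hy).mono (by omega)

theorem InP_of_nEl_mem_I1 (T : MaxCompact) {x y : E} {h} (hn : D.nEl x y h ∈ D.I1 T) :
    D.InP (nK T) y :=
  (D.nEl_mem_N).1 ((D.N_inter_I1 T _).1 ⟨hn, x, y, h, rfl⟩)

/-- The rank one relation with `c = ϖ^(-n_K)`. Since `y` is not in `𝔭^(n_K + 1)`, its inverse is in
`𝔭^(-n_K)`, which locates the two outer factors. -/
theorem nEl_mul_βK (T : MaxCompact) {x y : E} (h) (hy0 : y ≠ 0) (hy : ¬ D.InP (nK T + 1) y)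
    (hz hb) : ∃ n' ∈ D.N' (-nK T), ∃ n ∈ D.N (nK T), D.nEl x y h * D.βK T =
      n' * D.dEl (D.ϖ ^ (-nK T) * y) (-D.conj (D.ϖ ^ (-nK T) * y) * (D.ϖ ^ (-nK T) * y)⁻¹) hz hb *
        n := by
  have hm : mK T - 1 = -nK T := by rw [nK_eq]; ring
  have hrel := D.nEl_mul_antiEl (D.conj_ϖ_zpow (-nK T)) (D.ϖ_zpow_ne_zero _) h hy0
  have hβ : D.βK T = D.antiEl (D.ϖ ^ (-nK T)) (D.conj_ϖ_zpow _) (D.ϖ_zpow_ne_zero _) := by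
    rw [βK_eq]
    congr 1
    rw [hm]
  have hi := D.InP_inv_of_not_InP hy
  rw [hβ]
  refine ⟨_, ?_, _, ?_, hrel⟩
  · rw [nEl'_mem_N', one_div]
    exact hi
  · rw [nEl_mem_N]
    have h1 : 1 / ((D.ϖ ^ (-nK T)) ^ 2 * y) = D.ϖ ^ (2 * nK T) * y⁻¹ := by
      rw [one_div, mul_inv, ← zpow_natCast, ← zpow_mul, ← zpow_neg]
      congr 2
      push_cast
      ring
    rw [h1, InP_zpow_mul_iff]
    exact hi.mono (by omega)

/-- The mirrored relation with `c = ϖ^(m_K)`. The torus factor is not `h(z)` for `z = ϖ^(-m_K) y`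
but its conjugate by `β_K`. -/
theorem nEl'_mul_βK_α (T : MaxCompact) {x y : E} (h) (hy0 : y ≠ 0) (hy : ¬ D.InP (mK T + 1) y)
    (hz hb) : ∃ n ∈ D.N (-mK T), ∃ n' ∈ D.N' (mK T), D.nEl' x y h * (D.βK T * D.α⁻¹) =
      n * D.dEl (D.conj (D.ϖ ^ (-mK T) * y))⁻¹
        (-D.conj (D.ϖ ^ (-mK T) * y) * (D.ϖ ^ (-mK T) * y)⁻¹) hz hb * n' := by
  have hrel := D.nEl'_mul_antiEl (D.conj_ϖ_zpow (mK T)) (D.ϖ_zpow_ne_zero _) h hy0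
  have hi := D.InP_inv_of_not_InP hy
  have hyc : D.conj y ≠ 0 := by simpa using hy0
  have hϖ := D.ϖ_zpow_ne_zero (mK T)
  rw [βK_mul_α_inv, hrel]
  refine ⟨_, ?_, _, ?_, congrArg₂ (· * ·) (congrArg (_ * ·) (D.dEl_congr _ _ _ _ ?_ ?_)) rfl⟩
  · rw [nEl_mem_N, one_div]
    exact hi
  · rw [nEl'_mem_N', div_eq_mul_inv, ← zpow_natCast, ← zpow_mul, InP_zpow_mul_iff]
    refine hi.mono ?_
    push_cast
    omega
  · rw [map_mul, D.conj_ϖ_zpow, zpow_neg]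
    field_simp
  · simp only [map_mul, map_div₀, D.conj_conj, D.conj_ϖ_zpow, zpow_neg, map_inv₀]
    field_simp

theorem nK_tK (T : MaxCompact) : nK T = 2 * 0 ∧ tK T = 3 ∨ nK T = 2 * 0 - 1 ∧ tK T = 1 := by
  cases T <;> decide

theorem mK_tK (T : MaxCompact) :
    mK T = 2 * 1 ∧ 4 - tK T = 3 ∨ mK T = 2 * 1 - 1 ∧ 4 - tK T = 1 := by
  cases T <;> decide

instance finite_N (T : MaxCompact) :
    Finite (D.N (nK T) ⧸ (D.N (nK T + 1)).subgroupOf (D.N (nK T))) := by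
  obtain ⟨X, Y, hc, -⟩ := D.exists_isCoord_N (nK T)
  exact hc.finite (nK_tK T)

instance finite_N' (T : MaxCompact) :
    Finite (D.N' (mK T) ⧸ (D.N' (mK T + 1)).subgroupOf (D.N' (mK T))) := by
  obtain ⟨X, Y, hc, -⟩ := D.exists_isCoord_N' (mK T)
  exact hc.finite (mK_tK T)

section Actions

variable {k V : Type*} [Field k] [AddCommGroup V] [Module k V] (T : MaxCompact)

theorem SK_mem_fixedBy (π : Representation k D.G V) {v : V} (hv : v ∈ fixedBy π (D.I1 T)) :
    D.SK T π v ∈ fixedBy π (D.I1 T) := by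
  rw [mem_fixedBy_iff]
  intro g hg
  refine rep_finsum_eq π (D.I1 T) (D.βK T)
    (fun u : D.N (nK T) ⧸ (D.N (nK T + 1)).subgroupOf (D.N (nK T)) => ((u.out : D.N (nK T)) : D.G))
    (fun g hg i => ?_) (fun i j hij => ?_) hv hg
  · obtain ⟨u, hu, z, hz, he⟩ := D.I1_decomp T (mul_mem hg (D.N_le_I1 T i.out.2))
    obtain ⟨j, hj⟩ := D.rep_mul_mem_N _ hu
    refine ⟨j, D.Z_le_I1 T ?_⟩
    have h1 := D.Z_conj (D.βK_mem T) (mul_mem (D.N_le_Z T hj) hz)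
    rw [mul_assoc _ u, ← he, βK_inv, ← mul_assoc _ g] at h1
    rw [βK_inv]
    exact h1
  · refine D.rep_unique_N _ (D.mem_N_of_βK_conj T
      (mul_mem (inv_mem i.out.2) j.out.2) (D.I1_le_I T ?_))
    rwa [βK_inv] at hij

/-- The reflection `β_K α⁻¹` lies outside `K`, so conjugation-invariance of `Z` cannot be used as
for `S_K`. Instead each factor of the Iwahori decomposition `n' d n` is conjugated into `I₁`
separately. -/
theorem Sminus_mem_fixedBy (π : Representation k D.G V) {v : V} (hv : v ∈ fixedBy π (D.I1 T)) :
    D.Sminus T π v ∈ fixedBy π (D.I1 T) := by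
  have hw : (D.βK T * D.α⁻¹)⁻¹ = D.βK T * D.α⁻¹ := by rw [βK_mul_α_inv, antiEl_inv]
  have hm := nK_eq T
  rw [mem_fixedBy_iff]
  intro g hg
  refine rep_finsum_eq π (D.I1 T) (D.βK T * D.α⁻¹)
    (fun u : D.N' (mK T) ⧸ (D.N' (mK T + 1)).subgroupOf (D.N' (mK T)) =>
      ((u.out : D.N' (mK T)) : D.G)) (fun g hg i => ?_) (fun i j hij => ?_) hv hg
  · have hgi := mul_mem hg (D.N'_le_I1 T i.out.2)
    obtain ⟨n', hn', n, hn, a, b, ha, hb, hv, he⟩ := D.I_decomp' T (D.I1_le_I T hgi)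
    obtain ⟨j, hj⟩ := D.rep_mul_mem_N' _ hn'
    have hd : D.dEl a b ha hb ∈ D.I1 T := by
      have h1 : D.dEl a b ha hb = n'⁻¹ * (g * (i.out : D.N' (mK T))) * n⁻¹ := by
        rw [he]
        group
      rw [h1]
      exact mul_mem (mul_mem (inv_mem (D.N'_le_I1 T hn')) hgi) (inv_mem (D.N_le_I1 T hn))
    have hd' : (D.βK T * D.α⁻¹)⁻¹ * D.dEl a b ha hb * (D.βK T * D.α⁻¹) ∈ D.I1 T := by
      have h1 := D.Z_conj (D.βK_mem T) (D.dEl_mem_Z T hd)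
      have h2 : D.βK T * D.dEl a b ha hb * (D.βK T)⁻¹ =
          (D.βK T * D.α⁻¹)⁻¹ * D.dEl a b ha hb * (D.βK T * D.α⁻¹) := by
        rw [hw, βK_mul_α_inv, antiEl_mul_dEl, mul_assoc _ (D.antiEl _ _ _), antiEl_mul_self, βK_eq,
          antiEl_mul_dEl, mul_assoc, mul_inv_cancel]
      rw [← h2]
      exact D.Z_le_I1 T h1
    have hn2 : (D.βK T * D.α⁻¹)⁻¹ * n * (D.βK T * D.α⁻¹) ∈ D.I1 T := by
      obtain ⟨x, y, hxy, hy, rfl⟩ := D.exists_eq_nEl hn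
      refine D.N'_le_I1 T ?_
      rw [hw, βK_mul_α_inv, antiEl_mul_nEl, mul_assoc, antiEl_mul_self, mul_one, nEl'_mem_N',
        ← zpow_natCast, ← zpow_mul, InP_zpow_mul_iff]
      refine hy.mono ?_
      push_cast
      omega
    refine ⟨j, ?_⟩
    have h3 := mul_mem (mul_mem (D.N_le_I1 T (D.βK_conj_N' T hj)) hd') hn2
    have h4 : (D.βK T * D.α⁻¹)⁻¹ * (((j.out : D.N' (mK T)) : D.G)⁻¹ * g *
        (i.out : D.N' (mK T))) * (D.βK T * D.α⁻¹) =
        (D.βK T * D.α⁻¹)⁻¹ * (((j.out : D.N' (mK T)) : D.G)⁻¹ * n') * (D.βK T * D.α⁻¹) *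
        ((D.βK T * D.α⁻¹)⁻¹ * D.dEl a b ha hb * (D.βK T * D.α⁻¹)) *
        ((D.βK T * D.α⁻¹)⁻¹ * n * (D.βK T * D.α⁻¹)) := by
      rw [mul_assoc _ g, he]
      group
    rw [h4]
    exact h3
  · refine D.rep_unique_N' _ ?_
    have h0 := mul_mem (inv_mem i.out.2) j.out.2
    obtain ⟨x, y, hxy, hy, he⟩ := D.exists_eq_nEl' h0
    rw [he, nEl'_mem_N']
    rw [he, hw, βK_mul_α_inv, antiEl_mul_nEl', mul_assoc, antiEl_mul_self, mul_one] at hij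
    have h1 := D.InP_of_nEl_mem_I1 T hij
    rw [← zpow_neg, ← zpow_natCast, ← zpow_mul, InP_zpow_mul_iff] at h1
    refine h1.mono ?_
    push_cast
    omega

end Actions

end Operators


/-! ### Values of `S_K f` and `S_- f` at the powers of `α`. -/

section Values

set_option linter.unusedSectionVars false

variable {F E : Type*} [Field F] [ValuativeRel F] [TopologicalSpace F]
  [IsNonarchimedeanLocalField F] [Field E] [ValuativeRel E] [TopologicalSpace E]
  [IsNonarchimedeanLocalField E] [Algebra F E] [ValuativeExtension F E]
  [IsUnramifiedQuadratic F E] {D : Datum F E}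
  {k W : Type*} [Field k] [AddCommGroup W] [Module k W] {T : MaxCompact}
  {σ : Representation k (D.K T) W} {v₀ : W}

theorem SK_apply (f : D.compInd σ) (g : D.G) :
    ((D.SK T (D.ind σ) f : D.compInd σ) : D.G → W) g =
      ∑ᶠ u : D.N (nK T) ⧸ (D.N (nK T + 1)).subgroupOf (D.N (nK T)),
        (f : D.G → W) (g * ((u.out : D.N (nK T)) * D.βK T)) := by
  let φ : D.compInd σ →ₗ[k] W := (LinearMap.proj g).comp (Submodule.subtype _)
  refine (map_finsum φ (Set.toFinite _)).trans (finsum_congr fun u => ?_)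
  exact congrArg (f : D.G → W) (mul_assoc _ _ _)

theorem Sminus_apply (f : D.compInd σ) (g : D.G) :
    ((D.Sminus T (D.ind σ) f : D.compInd σ) : D.G → W) g =
      ∑ᶠ u : D.N' (mK T) ⧸ (D.N' (mK T + 1)).subgroupOf (D.N' (mK T)),
        (f : D.G → W) (g * ((u.out : D.N' (mK T)) * (D.βK T * D.α⁻¹))) := by
  let φ : D.compInd σ →ₗ[k] W := (LinearMap.proj g).comp (Submodule.subtype _)
  refine (map_finsum φ (Set.toFinite _)).trans (finsum_congr fun u => ?_)
  exact congrArg (f : D.G → W) (mul_assoc _ _ _)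

theorem IsHecke.left' {f : D.G → W} (hf : D.IsHecke σ f) {κ : D.G} (hκ : κ ∈ D.K T) (g : D.G) :
    f (κ * g) = σ ⟨κ, hκ⟩ (f g) := hf.left ⟨κ, hκ⟩ g

theorem IsHecke.trivial {f : D.G → W} (hf : D.IsHecke σ f) (h : D.IsWeightVector σ v₀) {z : D.G}
    (hz : z ∈ D.Z T) (g : D.G) : f (z * g) = f g := by
  rw [hf.left' (D.Z_le_K T hz), h.trivial ⟨z, _⟩ hz]

/-- `p` is an odd prime which is not a unit of `𝔬_E`, and `t` is a unit of trace zero. -/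
structure IsOddPrime (D : Datum F E) (p : ℕ) (t : E) : Prop where
  prime : p.Prime
  ne_two : p ≠ 2
  mem : D.InP 1 (p : E)
  val_t : valuation E t = 1
  trace_t : t + D.conj t = 0

theorem IsOddPrime.val_two {p : ℕ} {t : E} (hp : D.IsOddPrime p t) : valuation E (2 : E) = 1 :=
  Datum.val_two hp.prime hp.ne_two hp.mem

theorem smul_charSum (r : ℕ) (w : W) :
    D.charSum σ r • w = ∑ᶠ a ∈ D.L r \ {(0, 0)}, D.χh σ a.2 • w := by
  rw [charSum]
  exact AddMonoidHom.map_finsum_mem _ (LinearMap.toSpanSingleton k W w).toAddMonoidHom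
    (Set.toFinite _)

section Sums

variable {p : ℕ} {t : E} (hp : D.IsOddPrime p t) (h : D.IsWeightVector σ v₀)
  {f : D.G → W} (hf : D.IsHecke σ f)

include hp h hf

/-- Conjugation by `α⁻ᵐ` moves `N_{n_K}` into `N_{n_K + 1} ≤ Z`, so all terms are equal and their
number is a multiple of `p`. -/
theorem SK_value_of_pos [CharP k p] {m : ℤ} (hm : 0 < m) :
    ∑ᶠ u : D.N (nK T) ⧸ (D.N (nK T + 1)).subgroupOf (D.N (nK T)),
      f (D.α ^ (-m) * ((u.out : D.N (nK T)) * D.βK T)) = 0 := by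
  have := Fact.mk hp.prime
  obtain ⟨X, Y, hc, -⟩ := D.exists_isCoord_N (nK T)
  refine (finsum_congr fun u => ?_).trans
    (hc.finsum_const (K := k) (nK_tK T) hp.val_two hp.mem hp.val_t hp.trace_t
      (f (D.α ^ (-m) * D.βK T)))
  obtain ⟨z, hz, he⟩ := D.α_conj_N (n := -m) (l := nK T + 1) (by omega) u.out.2
  rw [← mul_assoc, he, mul_assoc, hf.trivial h (D.N_le_Z T hz)]

/-- On the trivial coset `β_K` is pulled to the left and inverts the power of `α`. On the others the
rank one relation leaves `h(z)`, with `n'` pushed by `αʲ` into `N'_{m_K} ≤ Z`. -/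
theorem SK_value_of_neg {j : ℤ} (hj : 0 < j) :
    ∑ᶠ u : D.N (nK T) ⧸ (D.N (nK T + 1)).subgroupOf (D.N (nK T)),
      f (D.α ^ j * ((u.out : D.N (nK T)) * D.βK T)) =
        σ (D.wK T) (f (D.α ^ (-j))) + D.charSum σ (tK T) • f (D.α ^ j) := by
  obtain ⟨c, hcv⟩ := hf.exists_smul_of_nonneg h hj.le
  obtain ⟨X, Y, hc, hu⟩ := D.exists_isCoord_N (nK T)
  rw [smul_charSum]
  refine hc.finsum_eq (nK_tK T) hp.val_two _ _ (fun s => D.χh σ s • f (D.α ^ j))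
    (fun u hY => ?_) (fun u hY => ?_)
  · have hmem : ((u.out : D.N (nK T)) : D.G) ∈ D.N (nK T + 1) := by
      rw [hu]
      exact (D.nEl_mem_N).2 hY
    have h1 := D.N'_le_I1 T (D.βK_conj_N T hmem)
    have h2 : D.α ^ j * ((u.out : D.N (nK T)) * D.βK T) =
        D.βK T * D.α ^ (-j) * ((D.βK T)⁻¹ * (u.out : D.N (nK T)) * D.βK T) := by
      rw [βK_mul_α_zpow, neg_neg]
      group
    rw [h2, hf.right _ h1, hf.left' (D.βK_mem T), wK]
  · have hy0 : Y u ≠ 0 := fun h0 => hY (h0 ▸ InP.zero)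
    have hz := D.val_eq_one_of_not_InP (hc.mem u) hY
    have hz0 := val_ne_zero_of_eq_one hz
    obtain ⟨n', hn', n, hn, he⟩ := D.nEl_mul_βK T (hc.rel u) hy0 hY hz0 (D.norm_unit hz0)
    obtain ⟨z, hz', he'⟩ := D.α_conj_N' (n := j) (l := mK T) (by rw [nK_eq]; omega) hn'
    have h2 : D.α ^ j * ((u.out : D.N (nK T)) * D.βK T) = z * (D.dEl _ _ hz0 (D.norm_unit hz0) *
        (D.α ^ j * n)) := by
      rw [hu, he, ← mul_assoc, ← mul_assoc, he', mul_assoc z, α_zpow_mul_dEl]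
      simp only [mul_assoc]
    rw [h2, hf.trivial h (D.N'_le_Z T hz'), hf.left' (D.I_le_K T (D.dEl_mem_I T hz)),
      hf.right _ (D.N_le_I1 T hn), hcv, map_smul, h.dEl_smul hz rfl, smul_comm]

/-- Unlike `N_{n_K}`, the group `N'_{m_K}` is already contained in `Z`, so the vanishing includes `j
= 0` and `S_-` has no exceptional value at `1`. -/
theorem Sminus_value_of_nonpos [CharP k p] {j : ℤ} (hj : 0 ≤ j) :
    ∑ᶠ u : D.N' (mK T) ⧸ (D.N' (mK T + 1)).subgroupOf (D.N' (mK T)),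
      f (D.α ^ j * ((u.out : D.N' (mK T)) * (D.βK T * D.α⁻¹))) = 0 := by
  have := Fact.mk hp.prime
  obtain ⟨X, Y, hc, -⟩ := D.exists_isCoord_N' (mK T)
  refine (finsum_congr fun u => ?_).trans
    (hc.finsum_const (K := k) (mK_tK T) hp.val_two hp.mem hp.val_t hp.trace_t
      (f (D.α ^ j * (D.βK T * D.α⁻¹))))
  obtain ⟨z, hz, he⟩ := D.α_conj_N' (n := j) (l := mK T) (by omega) u.out.2
  rw [← mul_assoc, he, mul_assoc, hf.trivial h (D.N'_le_Z T hz)]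

theorem Sminus_value_of_pos {m : ℤ} (hm : 0 < m) :
    ∑ᶠ u : D.N' (mK T) ⧸ (D.N' (mK T + 1)).subgroupOf (D.N' (mK T)),
      f (D.α ^ (-m) * ((u.out : D.N' (mK T)) * (D.βK T * D.α⁻¹))) =
        σ (D.wK T) (f (D.α ^ (m - 1))) + D.charSum σ (4 - tK T) • f (D.α ^ (-m)) := by
  obtain ⟨c, hcv⟩ := hf.exists_smul_of_pos h hm
  obtain ⟨X, Y, hc, hu⟩ := D.exists_isCoord_N' (mK T)
  rw [smul_charSum]
  refine hc.finsum_eq (mK_tK T) hp.val_two _ _ (fun s => D.χh σ s • f (D.α ^ (-m)))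
    (fun u hY => ?_) (fun u hY => ?_)
  · have hmem : ((u.out : D.N' (mK T)) : D.G) ∈ D.N' (mK T + 1) := by
      obtain ⟨hh, he⟩ := hu u
      rw [he]
      exact (D.nEl'_mem_N').2 hY
    have h1 := D.N_le_I1 T (D.βK_conj_N' T hmem)
    have h2 : D.α ^ (-m) * ((u.out : D.N' (mK T)) * (D.βK T * D.α⁻¹)) =
        D.βK T * D.α ^ (m - 1) *
          ((D.βK T * D.α⁻¹)⁻¹ * (u.out : D.N' (mK T)) * (D.βK T * D.α⁻¹)) := by
      have h3 : D.βK T * D.α ^ (m - 1) = D.α ^ (-m) * (D.βK T * D.α⁻¹) := by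
        rw [← mul_assoc, ← D.βK_mul_α_zpow, mul_assoc, ← zpow_sub_one]
      rw [h3]
      group
    rw [h2, hf.right _ h1, hf.left' (D.βK_mem T), wK]
  · have hy0 : Y u ≠ 0 := fun h0 => hY (h0 ▸ InP.zero)
    have hz := D.val_eq_one_of_not_InP (hc.mem u) hY
    have hz0 := val_ne_zero_of_eq_one hz
    have hz1 : (D.conj (D.ϖ ^ (-mK T) * Y u))⁻¹ ≠ 0 :=
      inv_ne_zero ((map_ne_zero D.conj).2 hz0)
    have hvz1 : valuation E (D.conj (D.ϖ ^ (-mK T) * Y u))⁻¹ = 1 := by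
      rw [map_inv₀, valuation_aut, hz, inv_one]
    obtain ⟨hh, hue⟩ := hu u
    obtain ⟨n, hn, n', hn', he⟩ := D.nEl'_mul_βK_α T hh hy0 hY hz1 (D.norm_unit hz0)
    -- The exponent `-m_K + 2 m` must reach `n_K + 1 = 2 - m_K`, which is exactly `m ≥ 1`.
    obtain ⟨z, hz', he'⟩ := D.α_conj_N (n := -m) (l := nK T + 1) (by rw [nK_eq]; omega) hn
    have h2 : D.α ^ (-m) * ((u.out : D.N' (mK T)) * (D.βK T * D.α⁻¹)) =
        z * (D.dEl _ _ hz1 (D.norm_unit hz0) * (D.α ^ (-m) * n')) := by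
      rw [hue, he, ← mul_assoc, ← mul_assoc, he', mul_assoc z, α_zpow_mul_dEl]
      simp only [mul_assoc]
    -- `f(α⁻ᵐ)` is a multiple of `β_K v₀`; moving the torus element across `β_K` turns it into
    -- `h(z)`, which acts on `v₀` by `χ_σ`.
    have h3 : (⟨D.dEl _ _ hz1 (D.norm_unit hz0), D.I_le_K T (D.dEl_mem_I T hvz1)⟩ : D.K T) * D.wK T = D.wK T *
        ⟨D.dEl _ _ hz0 (D.norm_unit hz0), D.I_le_K T (D.dEl_mem_I T hz)⟩ := by
      refine Subtype.ext ?_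
      change D.dEl _ _ hz1 (D.norm_unit hz0) * D.βK T = D.βK T * D.dEl _ _ hz0 (D.norm_unit hz0)
      rw [βK_eq, antiEl_mul_dEl]
    rw [h2, hf.trivial h (D.N_le_Z T hz'), hf.left' (D.I_le_K T (D.dEl_mem_I T hvz1)),
      hf.right _ (D.N'_le_I1 T hn'), hcv, map_smul, ← rep_mul_apply, h3, rep_mul_apply,
      h.dEl_smul hz rfl, map_smul, smul_comm]

end Sums

theorem SK_value_zero {f : D.G → W} (hf : D.IsHecke σ f) :
    ∑ᶠ u : D.N (nK T) ⧸ (D.N (nK T + 1)).subgroupOf (D.N (nK T)),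
      f (1 * ((u.out : D.N (nK T)) * D.βK T)) =
        ∑ᶠ u, σ (D.repN T u) (σ (D.wK T) (f 1)) := by
  refine finsum_congr fun u => ?_
  have h1 : 1 * (((u.out : D.N (nK T)) : D.G) * D.βK T) =
      D.repN T u * (D.wK T * 1) := by
    rw [one_mul, mul_one]
    rfl
  rw [h1, hf.left, hf.left]

end Values


/-! ### Evaluation of both operators on the basis. -/

section Main

set_option linter.unusedSectionVars false

variable {F E : Type*} [Field F] [ValuativeRel F] [TopologicalSpace F]
  [IsNonarchimedeanLocalField F] [Field E] [ValuativeRel E] [TopologicalSpace E]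
  [IsNonarchimedeanLocalField E] [Algebra F E] [ValuativeExtension F E]
  [IsUnramifiedQuadratic F E] {D : Datum F E}
  {k W : Type*} [Field k] [AddCommGroup W] [Module k W] {T : MaxCompact}
  {σ : Representation k (D.K T) W} {v₀ : W} {p : ℕ} {t : E}

theorem IsOddPrime.rankOne (hp : D.IsOddPrime p t) (T : MaxCompact) :
    RankOne p ((D.I T).subgroupOf (D.K T)) ((D.I1 T).subgroupOf (D.K T))
      ((D.N (nK T)).subgroupOf (D.K T)) ((D.Z T).subgroupOf (D.K T)) (D.wK T) (D.repN T) :=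
  D.rankOne T p hp.prime hp.ne_two hp.mem hp.val_t hp.trace_t

/-- `Z` is normal in `K` and contained in `I₁`, so it fixes `v₀` and, by irreducibility, acts
trivially on `σ`; the rank one theory then applies. -/
theorem isWeightVector [IsAlgClosed k] [CharP k p] (hp : D.IsOddPrime p t)
    (hσ : σ.IsIrreducible) (hv : v₀ ∈ D.weightLine σ) (hv0 : v₀ ≠ 0) :
    D.IsWeightVector σ v₀ := by
  have := Fact.mk hp.prime
  have hR := hp.rankOne T
  have := Fintype.ofFinite (D.N (nK T) ⧸ (D.N (nK T + 1)).subgroupOf (D.N (nK T)))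
  have hZ := irreducible_trivial_of_normal hσ _ hR.normal hv0
    (mem_fixedBy_iff.2 fun z hz => mem_fixedBy_iff.1 hv z (D.Z_le_I1 T hz))
  exact ⟨hv0, hv, hR.finrank_fixedBy hZ hσ, hZ⟩

/-- The relation needed by `sum_eq_of_equiv_twist` is the rank one relation at `x = 0`, `y = 𝔱
ϖ^(n_K)`: its torus factor is exactly `h(𝔱)`, and its lower unipotent factor is a `β_K`-conjugate of
an element of `N_{n_K}`. -/
theorem IsWeightVector.sum_of_isSteinbergTwist [CharP k p] (h : D.IsWeightVector σ v₀)
    (𝔱 : (𝒪[E])ˣ) (hp : D.IsOddPrime p ((𝔱 : 𝒪[E]) : E)) (hσ : D.IsSteinbergTwist σ) :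
    ∑ᶠ u, σ (D.repN T u) (σ (D.wK T) v₀) = (-D.χ σ (D.hI T 𝔱)) • v₀ := by
  have := Fact.mk hp.prime
  have hR := hp.rankOne T
  have := Fintype.ofFinite (D.N (nK T) ⧸ (D.N (nK T + 1)).subgroupOf (D.N (nK T)))
  obtain ⟨ψ, -, ⟨e⟩⟩ := hσ
  rw [finsum_eq_sum_of_fintype]
  have ht0 := val_ne_zero_of_eq_one hp.val_t
  have hy0 : ((𝔱 : 𝒪[E]) : E) * D.ϖ ^ nK T ≠ 0 := mul_ne_zero ht0 (D.ϖ_zpow_ne_zero _)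
  have hrel : (0 : E) * D.conj 0 + ((𝔱 : 𝒪[E]) : E) * D.ϖ ^ nK T +
      D.conj (((𝔱 : 𝒪[E]) : E) * D.ϖ ^ nK T) = 0 := by
    rw [map_mul, conj_ϖ_zpow]
    linear_combination D.ϖ ^ nK T * hp.trace_t
  have hy : D.InP (nK T) (((𝔱 : 𝒪[E]) : E) * D.ϖ ^ nK T) := by
    rw [InP_mul_iff_of_val_eq_one hp.val_t]
    exact InP_zpow _
  have hy' : ¬ D.InP (nK T + 1) (((𝔱 : 𝒪[E]) : E) * D.ϖ ^ nK T) := by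
    rw [InP_mul_iff_of_val_eq_one hp.val_t]
    exact not_InP_zpow (by omega)
  have hz : D.ϖ ^ (-nK T) * (((𝔱 : 𝒪[E]) : E) * D.ϖ ^ nK T) = ((𝔱 : 𝒪[E]) : E) := by
    have := D.ϖ_zpow_ne_zero (nK T)
    rw [zpow_neg]
    field_simp
  have hz0 : D.ϖ ^ (-nK T) * (((𝔱 : 𝒪[E]) : E) * D.ϖ ^ nK T) ≠ 0 := by
    rw [hz]
    exact ht0
  obtain ⟨n', hn', n'', hn'', he⟩ := D.nEl_mul_βK T hrel hy0 hy' hz0 (D.norm_unit hz0)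
  have hd : D.dEl _ _ hz0 (D.norm_unit hz0) = (D.hI T 𝔱 : D.I T) :=
    D.dEl_congr _ _ ht0 (D.norm_unit ht0) hz (by rw [hz])
  have hn1 : D.βK T * n' * D.βK T ∈ D.I1 T := by
    obtain ⟨x, y, hxy, hyy, rfl⟩ := D.exists_eq_nEl' hn'
    refine D.N_le_I1 T ?_
    rw [βK_eq, antiEl_mul_nEl', mul_assoc, antiEl_mul_self, mul_one, nEl_mem_N, ← zpow_neg,
      ← zpow_natCast, ← zpow_mul, InP_zpow_mul_iff]
    refine hyy.mono ?_
    rw [nK_eq]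
    push_cast
    omega
  have hn : D.nEl _ _ hrel ∈ D.I1 T := D.N_le_I1 T ((D.nEl_mem_N).2 hy)
  refine hR.sum_eq_of_equiv_twist h.trivial h.finrank_eq h.ne_zero h.mem e
    (n := ⟨_, D.I1_le_K T hn⟩) (n' := ⟨_, D.I1_le_K T hn1⟩)
    (n'' := ⟨n'', D.I1_le_K T (D.N_le_I1 T hn'')⟩)
    (t := Subgroup.inclusion (D.I_le_K T) (D.hI T 𝔱)) hn hn1 (D.N_le_I1 T hn'') (D.hI T 𝔱).2
    (Subtype.ext ?_) (h.χ_smul _ h.mem)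
  change D.nEl _ _ hrel * D.βK T =
    D.βK T * (D.βK T * n' * D.βK T) * D.βK T * (D.hI T 𝔱 : D.I T) * n''
  have h1 : D.βK T * (D.βK T * n' * D.βK T) * D.βK T = n' := by
    rw [← mul_assoc, ← mul_assoc, βK_mul_self, one_mul, mul_assoc, βK_mul_self, mul_one]
  rw [he, hd, h1]

/-- The operator acts on the line by a scalar, and a nonzero scalar would make `σ` a twist of
Steinberg. The twisting character is trivial on the open subgroup `Z`, so it is smooth. -/
theorem IsWeightVector.sum_of_not_isSteinbergTwist [IsAlgClosed k] [CharP k p]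
    (h : D.IsWeightVector σ v₀) (hp : D.IsOddPrime p t) (hirr : σ.IsIrreducible)
    (hσ : ¬ D.IsSteinbergTwist σ) : ∑ᶠ u, σ (D.repN T u) (σ (D.wK T) v₀) = 0 := by
  have := Fact.mk hp.prime
  have hR := hp.rankOne T
  have := Fintype.ofFinite (D.N (nK T) ⧸ (D.N (nK T + 1)).subgroupOf (D.N (nK T)))
  rw [finsum_eq_sum_of_fintype]
  obtain ⟨d, hd⟩ := h.exists_smul (hR.sum_mem h.trivial h.mem)
  rw [hd]
  by_contra h0
  have hd0 : d ≠ 0 := by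
    rintro rfl
    exact h0 (zero_smul _ _)
  obtain ⟨ψ, hψ, he⟩ := hR.exists_equiv_twist hirr h.ne_zero h.mem
    (fun i hi => ⟨_, h.χ_smul ⟨i, hi⟩ h.mem⟩) hd0 hd
  refine hσ ⟨ψ, Subgroup.isOpen_mono hψ ?_, he⟩
  exact (D.isOpen_of_Cong_le T 1 (D.Cong_le_Z T)).preimage continuous_subtype_val

theorem eq_of_forall_α {f f' : D.compInd σ} (hf : f ∈ fixedBy (D.ind σ) (D.I1 T))
    (hf' : f' ∈ fixedBy (D.ind σ) (D.I1 T))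
    (hα : ∀ m : ℤ, (f : D.G → W) (D.α ^ (-m)) = (f' : D.G → W) (D.α ^ (-m))) : f = f' :=
  Subtype.ext ((IsHecke.of_mem hf).ext (IsHecke.of_mem hf') hα)

namespace IsWeightVector

theorem fn_apply (h : D.IsWeightVector σ v₀) (n m : ℤ) :
    (((h.fn n : fixedBy (D.ind σ) (D.I1 T)) : D.compInd σ) : D.G → W) (D.α ^ m) =
      if -m = n then D.cellValue σ v₀ n else 0 := by
  have h1 := h.cellFun_α (-m) n
  rw [neg_neg] at h1
  exact h1

theorem SK_fn_apply_of_pos [CharP k p] (h : D.IsWeightVector σ v₀) (hp : D.IsOddPrime p t) (n : ℤ)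
    {m : ℤ} (hm : 0 < m) :
    ((D.SK T (D.ind σ) (h.fn n) : D.compInd σ) : D.G → W) (D.α ^ (-m)) = 0 :=
  (SK_apply _ _).trans (SK_value_of_pos hp h (IsHecke.of_mem (h.fn n).2) hm)

theorem SK_fn_apply_of_neg (h : D.IsWeightVector σ v₀) (hp : D.IsOddPrime p t) (n : ℤ)
    {m : ℤ} (hm : m < 0) :
    ((D.SK T (D.ind σ) (h.fn n) : D.compInd σ) : D.G → W) (D.α ^ (-m)) =
      σ (D.wK T) (if -m = n then D.cellValue σ v₀ n else 0) +
        D.charSum σ (tK T) • if m = n then D.cellValue σ v₀ n else 0 := by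
  have h1 := SK_value_of_neg hp h (IsHecke.of_mem (h.fn n).2) (neg_pos.2 hm)
  rw [neg_neg, h.fn_apply, h.fn_apply, neg_neg] at h1
  exact (SK_apply _ _).trans h1

theorem SK_fn_apply_zero (h : D.IsWeightVector σ v₀) (n : ℤ) :
    ((D.SK T (D.ind σ) (h.fn n) : D.compInd σ) : D.G → W) 1 =
      if n = 0 then ∑ᶠ u, σ (D.repN T u) (σ (D.wK T) v₀) else 0 := by
  refine (SK_apply _ _).trans ((SK_value_zero (IsHecke.of_mem (h.fn n).2)).trans ?_)
  have h1 := h.fn_apply n 0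
  rw [zpow_zero] at h1
  simp only [h1, neg_zero]
  by_cases hn : n = 0
  · subst hn
    simp [cellValue]
  · simp [hn, Ne.symm hn]

theorem Sminus_fn_apply_of_nonpos [CharP k p] (h : D.IsWeightVector σ v₀)
    (hp : D.IsOddPrime p t) (n : ℤ) {m : ℤ} (hm : m ≤ 0) :
    ((D.Sminus T (D.ind σ) (h.fn n) : D.compInd σ) : D.G → W) (D.α ^ (-m)) = 0 :=
  (Sminus_apply _ _).trans
    (Sminus_value_of_nonpos hp h (IsHecke.of_mem (h.fn n).2) (neg_nonneg.2 hm))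

theorem Sminus_fn_apply_of_pos (h : D.IsWeightVector σ v₀) (hp : D.IsOddPrime p t) (n : ℤ)
    {m : ℤ} (hm : 0 < m) :
    ((D.Sminus T (D.ind σ) (h.fn n) : D.compInd σ) : D.G → W) (D.α ^ (-m)) =
      σ (D.wK T) (if -(m - 1) = n then D.cellValue σ v₀ n else 0) +
        D.charSum σ (4 - tK T) • if m = n then D.cellValue σ v₀ n else 0 := by
  have h1 := Sminus_value_of_pos hp h (IsHecke.of_mem (h.fn n).2) hm
  rw [h.fn_apply, h.fn_apply, neg_neg] at h1
  exact (Sminus_apply _ _).trans h1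

variable [CharP k p] (h : D.IsWeightVector σ v₀) (hp : D.IsOddPrime p t)

include hp

/-- The only surviving value is at `αⁿ`, the reflection of the support point `α⁻ⁿ`; there `β_K (β_K
v₀) = v₀` matches the normalisation of `f_{-n}`. -/
theorem SK_fn {n : ℤ} (hn : 0 < n) : D.SK T (D.ind σ) (h.fn n) = h.fn (-n) := by
  refine eq_of_forall_α (D.SK_mem_fixedBy T _ (h.fn n).2) (h.fn (-n)).2 fun m => ?_
  rw [h.fn_apply]
  rcases lt_trichotomy m 0 with hm | rfl | hm
  · rw [h.SK_fn_apply_of_neg hp n hm, neg_neg, if_neg (by omega : m ≠ n), smul_zero, add_zero]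
    by_cases hmn : m = -n
    · rw [if_pos hmn, if_pos (by omega), cellValue, if_pos hn, wK_smul_wK, cellValue,
        if_neg (by omega)]
    · rw [if_neg hmn, if_neg (by omega), map_zero]
  · rw [neg_zero, zpow_zero, h.SK_fn_apply_zero, if_neg hn.ne', if_neg (by omega)]
  · rw [h.SK_fn_apply_of_pos hp n hm, if_neg (by omega)]

theorem SK_fn_neg {n : ℤ} (hn : 0 < n) :
    D.SK T (D.ind σ) (h.fn (-n)) = D.charSum σ (tK T) • (h.fn (-n) : D.compInd σ) := by
  refine eq_of_forall_α (D.SK_mem_fixedBy T _ (h.fn (-n)).2)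
    (Submodule.smul_mem _ _ (h.fn (-n)).2) fun m => ?_
  rw [Submodule.coe_smul, Pi.smul_apply, h.fn_apply, neg_neg]
  rcases lt_trichotomy m 0 with hm | rfl | hm
  · rw [h.SK_fn_apply_of_neg hp _ hm, if_neg (by omega : -m ≠ -n), map_zero, zero_add]
  · rw [neg_zero, zpow_zero, h.SK_fn_apply_zero, if_neg (by omega), if_neg (by omega), smul_zero]
  · rw [h.SK_fn_apply_of_pos hp _ hm, if_neg (by omega), smul_zero]

theorem SK_fn_zero {d : k} (hd : ∑ᶠ u, σ (D.repN T u) (σ (D.wK T) v₀) = d • v₀) :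
    D.SK T (D.ind σ) (h.fn 0) = d • (h.fn 0 : D.compInd σ) := by
  refine eq_of_forall_α (D.SK_mem_fixedBy T _ (h.fn 0).2)
    (Submodule.smul_mem _ _ (h.fn 0).2) fun m => ?_
  rw [Submodule.coe_smul, Pi.smul_apply, h.fn_apply, neg_neg]
  rcases lt_trichotomy m 0 with hm | rfl | hm
  · rw [h.SK_fn_apply_of_neg hp _ hm, if_neg (by omega), if_neg hm.ne, map_zero, smul_zero,
      smul_zero, add_zero]
  · rw [neg_zero, zpow_zero, h.SK_fn_apply_zero, if_pos rfl, if_pos rfl, hd, cellValue,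
      if_neg (lt_irrefl _)]
  · rw [h.SK_fn_apply_of_pos hp _ hm, if_neg hm.ne', smul_zero]

theorem Sminus_fn {n : ℤ} (hn : 0 < n) :
    D.Sminus T (D.ind σ) (h.fn n) = D.charSum σ (4 - tK T) • (h.fn n : D.compInd σ) := by
  refine eq_of_forall_α (D.Sminus_mem_fixedBy T _ (h.fn n).2)
    (Submodule.smul_mem _ _ (h.fn n).2) fun m => ?_
  rw [Submodule.coe_smul, Pi.smul_apply, h.fn_apply, neg_neg]
  rcases le_or_gt m 0 with hm | hm
  · rw [h.Sminus_fn_apply_of_nonpos hp _ hm, if_neg (by omega), smul_zero]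
  · rw [h.Sminus_fn_apply_of_pos hp _ hm, if_neg (by omega : -(m - 1) ≠ n), map_zero, zero_add]

/-- The reflection sends `m` to `m - 1`, so `αⁿ` contributes at `m = n + 1`, where `β_K v₀` is the
normalised value of `f_{n+1}`. -/
theorem Sminus_fn_neg {n : ℤ} (hn : 0 ≤ n) :
    D.Sminus T (D.ind σ) (h.fn (-n)) = h.fn (n + 1) := by
  refine eq_of_forall_α (D.Sminus_mem_fixedBy T _ (h.fn (-n)).2) (h.fn (n + 1)).2 fun m => ?_
  rw [h.fn_apply, neg_neg]
  rcases le_or_gt m 0 with hm | hm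
  · rw [h.Sminus_fn_apply_of_nonpos hp _ hm, if_neg (by omega)]
  · rw [h.Sminus_fn_apply_of_pos hp _ hm, if_neg (by omega : m ≠ -n), smul_zero, add_zero]
    by_cases hmn : m = n + 1
    · rw [if_pos hmn, if_pos (by omega), cellValue, if_neg (by omega), cellValue,
        if_pos (by omega)]
    · rw [if_neg hmn, if_neg (by omega), map_zero]

end IsWeightVector

end Main

end Datum

end U21

theorem mainTheorem3 (p : ℕ) [Fact p.Prime] (hp : p ≠ 2)
    (F E : Type*) [Field F] [ValuativeRel F] [TopologicalSpace F] [IsNonarchimedeanLocalField F]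
    [CharP 𝓀[F] p]
    [Field E] [ValuativeRel E] [TopologicalSpace E] [IsNonarchimedeanLocalField E]
    [Algebra F E] [ValuativeExtension F E] [IsUnramifiedQuadratic F E]
    (D : Datum F E) (T : MaxCompact)
    (W : Type*) [AddCommGroup W] [Module (AlgebraicClosure (ZMod p)) W]
    (σ : Representation (AlgebraicClosure (ZMod p)) (D.K T) W)
    (hσ : σ.IsIrreducible) (hσs : IsSmooth σ)
    (v₀ : W) (hv₀ : v₀ ∈ D.weightLine σ) (hv₀' : v₀ ≠ 0)
    (𝔱 : (𝒪[E])ˣ) (h𝔱 : ((𝔱 : 𝒪[E]) : E) + D.conj ((𝔱 : 𝒪[E]) : E) = 0) :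
    (Module.finrank (AlgebraicClosure (ZMod p)) (D.weightLine σ) = 1 ∧
      ∀ (i : D.I T), ∀ v ∈ D.weightLine σ,
        σ (Subgroup.inclusion (D.I_le_K T) i) v = D.χ σ i • v) ∧
    ∃ f : Module.Basis ℤ (AlgebraicClosure (ZMod p)) (fixedBy (D.ind σ) (D.I1 T)),
      (∀ n : ℤ, D.IsBasisFunction σ v₀ n (f n : D.compInd σ)) ∧
      (∀ n : ℤ, 1 ≤ n →
        D.SK T (D.ind σ) (f n) = f (-n) ∧
        D.Sminus T (D.ind σ) (f n) = D.charSum σ (4 - Datum.tK T) • (f n : D.compInd σ)) ∧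
      (∀ n : ℤ, 1 ≤ n →
        D.SK T (D.ind σ) (f (-n)) = D.charSum σ (Datum.tK T) • (f (-n) : D.compInd σ)) ∧
      (D.IsSteinbergTwist σ →
        D.SK T (D.ind σ) (f 0) = (-D.χ σ (D.hI T 𝔱)) • (f 0 : D.compInd σ)) ∧
      (¬ D.IsSteinbergTwist σ →
        D.SK T (D.ind σ) (f 0) = (0 : AlgebraicClosure (ZMod p)) • (f 0 : D.compInd σ)) ∧
      (∀ n : ℤ, 0 ≤ n →
        D.Sminus T (D.ind σ) (f (-n)) = f (n + 1)) := by
  have hp' : D.IsOddPrime p ((𝔱 : 𝒪[E]) : E) :=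
    ⟨Fact.out, hp, D.InP_natCast p, (Datum.val_eq_one_iff_isUnit _).2 𝔱.isUnit, h𝔱⟩
  have : CharP (AlgebraicClosure (ZMod p)) p :=
    charP_of_injective_algebraMap (algebraMap (ZMod p) (AlgebraicClosure (ZMod p))).injective p
  have h : D.IsWeightVector σ v₀ := Datum.isWeightVector hp' hσ hv₀ hv₀'
  refine ⟨⟨h.finrank_eq, fun i v hv => h.χ_smul i hv⟩,
    Module.Basis.mk h.linearIndependent h.span_eq_top, ?_⟩
  simp only [Module.Basis.mk_apply]
  refine ⟨h.isBasisFunction, fun n hn => ⟨h.SK_fn hp' hn, h.Sminus_fn hp' hn⟩,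
    fun n hn => h.SK_fn_neg hp' hn,
    fun hS => h.SK_fn_zero hp' (h.sum_of_isSteinbergTwist 𝔱 hp' hS),
    fun hS => h.SK_fn_zero hp' ?_, fun n hn => h.Sminus_fn_neg hp' hn⟩
  rw [h.sum_of_not_isSteinbergTwist hp' hσ hS, zero_smul]
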